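/- Let $n\ge 2$, $m>1-\frac2n$, $2-n<B<A\le 2$ and $\lambda>0$, and let $$U(x)=\frac{|x|^A}{A}-\lambda\frac{|x|^B}{B},\qquad x\in\mathbb R^n\setminus\{0\},$$ with the convention $\frac{|x|^0}{0}:=\log|x|$. Let $\rho_0\in L^1(\mathbb R^n)\cap L^\infty(\mathbb R^n)$ be nonnegative. A nonnegative measurable function $\rho$ on $(0,\infty)\times\mathbb R^n$ is called a global weak solution of $$\rho_t=\Delta\rho^m+\operatorname{div}\big(\rho\,\nabla(U*\rho)\big),\qquad \rho(\cdot,0)=\rho_0,$$ if: $\rho\in L^\infty\big((0,T);L^1(\mathbb R^n)\cap L^\infty(\mathbb R^n)\big)$ for every $T<\infty$; the mass is conserved, $\int_{\mathbb R^n}\rho(t,x)\,dx=\int_{\mathbb R^n}\rho_0\,dx$ for a.e. $t>0$; the field $\nabla(U*\rho):=(\nabla U)*\rho$ is given by an absolutely convergent integral for a.e. $(t,x)$ and is integrable on bounded subsets of $(0,\infty)\times\mathbb R^n$; $\rho^m$ has a weak gradient $\nabla\rho^m$ in $x$ that is square integrable on bounded subsets of $(0,\infty)\times\mathbb R^n$;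 and $$\int_0^\infty\!\!\int_{\mathbb R^n}\Big(\rho\,\partial_t\varphi-\nabla\rho^m\cdot\nabla\varphi-\rho\,\nabla(U*\rho)\cdot\nabla\varphi\Big)\,dx\,dt+\int_{\mathbb R^n}\rho_0(x)\,\varphi(0,x)\,dx=0$$ for every $\varphi\in C_c^\infty(\mathbb R\times\mathbb R^n)$. Then every global weak solution $\rho$ satisfies the uniform-in-time bound $$\|\rho\|_{L^\infty(\mathbb R_+;L^\infty(\mathbb R^n))}\le C,$$ where $C$ depends only on $n,m,A,B,\lambda$ and on upper bounds for $\|\rho_0\|_{L^1(\mathbb R^n)}$ and $\|\rho_0\|_{L^\infty(\mathbb R^n)}$. -/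

import Mathlib

open MeasureTheory Set
open scoped ENNReal NNReal ContDiff

namespace AggregationDiffusion

/-- The Euclidean space `ℝⁿ`. -/
abbrev Space (n : ℕ) : Type := EuclideanSpace ℝ (Fin n)

/-- The power `r ^ s / s`, with the convention that it is `log r` for `s = 0`. -/
noncomputable def powerProfile (s r : ℝ) : ℝ :=
  if s = 0 then Real.log r else r ^ s / s

/-- The interaction potential `U(x) = |x|^A / A - lam * |x|^B / B`. -/
noncomputable def potential (n : ℕ) (A B lam : ℝ) (x : Space n) : ℝ :=
  powerProfile A ‖x‖ - lam * powerProfile B ‖x‖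

/-- The vector field `∇U`. The value at the origin, where `U` need not be differentiable, is
irrelevant: the field is only used inside integrals. -/
noncomputable def potentialGradient (n : ℕ) (A B lam : ℝ) (x : Space n) : Space n :=
  gradient (potential n A B lam) x

/-- The convolution `(∇U * u)(x) = ∫ u(y) ∇U(x - y) dy` for a density `u` on `ℝⁿ`. -/
noncomputable def forceField (n : ℕ) (A B lam : ℝ) (u : Space n → ℝ) : Space n → Space n :=
  MeasureTheory.convolution u (potentialGradient n A B lam)
    (ContinuousLinearMap.lsmul ℝ ℝ) volume

/-- `g` is the weak gradient of `w` on `ℝⁿ`: both are locally integrable and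
`∫ w ∇ψ dx = - ∫ ψ g dx` for all smooth compactly supported `ψ`. -/
def HasWeakGradient {n : ℕ} (w : Space n → ℝ) (g : Space n → Space n) : Prop :=
  LocallyIntegrable w volume ∧ LocallyIntegrable g volume ∧
    ∀ ψ : Space n → ℝ, ContDiff ℝ ∞ ψ → HasCompactSupport ψ →
      ∫ x, w x • gradient ψ x = - ∫ x, ψ x • g x

/-- `ρ` is a global (in time) weak solution of
`∂ₜρ = Δ(ρ^m) + div(ρ ∇(U * ρ))` on `ℝⁿ × (0, ∞)` with initial datum `ρ₀`.
Only the values of `ρ t` for `t > 0` matter. -/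
structure IsGlobalWeakSolution (n : ℕ) (m A B lam : ℝ) (ρ₀ : Space n → ℝ)
    (ρ : ℝ → Space n → ℝ) : Prop where
  /-- `ρ` is a (class of a) measurable function on `(0, ∞) × ℝⁿ`. -/
  measurable : AEStronglyMeasurable (fun z : ℝ × Space n => ρ z.1 z.2)
    (volume.restrict (Ioi (0 : ℝ) ×ˢ univ))
  /-- `ρ` is nonnegative. -/
  nonneg : ∀ᵐ t ∂(volume.restrict (Ioi (0 : ℝ))), ∀ᵐ x, 0 ≤ ρ t x
  /-- `ρ ∈ L^∞((0,T); L¹ ∩ L^∞)` for every finite `T`. -/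
  locally_bounded : ∀ T : ℝ, 0 < T → ∃ K : ℝ≥0,
    ∀ᵐ t ∂(volume.restrict (Ioo (0 : ℝ) T)),
      eLpNorm (ρ t) 1 volume ≤ K ∧ eLpNorm (ρ t) ∞ volume ≤ K
  /-- The mass is conserved. -/
  mass : ∀ᵐ t ∂(volume.restrict (Ioi (0 : ℝ))), ∫ x, ρ t x = ∫ x, ρ₀ x
  /-- `∇U * ρ` is given by an absolutely convergent integral almost everywhere. -/
  force_exists : ∀ᵐ t ∂(volume.restrict (Ioi (0 : ℝ))), ∀ᵐ x,
    ConvolutionExistsAt (ρ t) (potentialGradient n A B lam) x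
      (ContinuousLinearMap.lsmul ℝ ℝ) volume
  /-- `∇U * ρ` is integrable on bounded subsets of `(0, ∞) × ℝⁿ`. -/
  force_integrable : ∀ T R : ℝ, 0 < T → 0 < R →
    IntegrableOn (fun z : ℝ × Space n => forceField n A B lam (ρ z.1) z.2)
      (Ioo (0 : ℝ) T ×ˢ Metric.ball (0 : Space n) R) volume
  /-- `ρ^m` has a weak spatial gradient `G`, square integrable on bounded subsets of
  `(0, ∞) × ℝⁿ`, and the equation holds, with the initial datum, when tested against every
  smooth function with compact support in `[0, ∞) × ℝⁿ`. -/
  equation : ∃ G : ℝ → Space n → Space n,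
    (∀ T R : ℝ, 0 < T → 0 < R →
      MemLp (fun z : ℝ × Space n => G z.1 z.2) 2
        (volume.restrict (Ioo (0 : ℝ) T ×ˢ Metric.ball (0 : Space n) R))) ∧
    (∀ᵐ t ∂(volume.restrict (Ioi (0 : ℝ))), HasWeakGradient (fun x => ρ t x ^ m) (G t)) ∧
    ∀ φ : ℝ × Space n → ℝ, ContDiff ℝ ∞ φ → HasCompactSupport φ →
      (∫ t in Ioi (0 : ℝ), ∫ x,
        (ρ t x * deriv (fun s => φ (s, x)) t
          - inner ℝ (G t x) (gradient (fun y => φ (t, y)) x)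
          - ρ t x * inner ℝ (forceField n A B lam (ρ t) x) (gradient (fun y => φ (t, y)) x)))
        + ∫ x, ρ₀ x * φ (0, x) = 0

end AggregationDiffusion

namespace AggregationDiffusion

/-! The proof is a De Giorgi iteration in which only an upper bound on the divergence of the drift
is used. Away from the origin, `div ∇U = (n + A - 2)|x|^(A-2) - lam (n + B - 2)|x|^(B-2)`. Since `B
> 2 - n` and `B < A ≤ 2`, the repulsive term wins near the origin and the attractive one is bounded
elsewhere. So `div ∇U ≤ Λ₀` (`exists_divLE_interactionField`), and by mass conservation `div (∇U *
ρ) ≤ Λ := Λ₀ M` at all times, however large `ρ` is.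

Suppose `ρ ≤ S` on `(0, T)`, and let `k ≥ S / 4` lie above the initial datum. Put `u = (ρ - k)₊` and
let `μ` bound the measure of `{ρ > k}`. Testing with `u²`, the drift contributes at most `Λ S³ μ`.
The diffusion, whose coefficient `m ρ^(m-1)` is comparable to `S^(m-1)` on `{ρ > k}`, contributes a
damping of `∫ u³`: the Sobolev inequality `W^{1,1} ⊂ L^{n/(n-1)}` on a set of measure `μ` bounds `∫
u³` by `9 σ² ∫ u |∇u|²` with `σ ~ μ^(1/n)` (`IsSlice.energy`, with cutoff errors). Gronwall's
inequality gives `∫ u³ ≲ Λ S³ μ σ² / S^(m-1)`, and Chebyshev's inequality then bounds the measure of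
a higher level set (`IsFlow.volume_superlevel_le`).

Let the levels increase from `S / 4` to `S / 2`, starting from the mass bound `|{ρ > S / 4}| ≤ 4 M /
S`. The measures decay geometrically once `Λ M^(2/n) S^(-(m - 1 + 2/n))` is small, which is so for
large `S` exactly because `m > 1 - 2/n`. Hence every bound `S` above a threshold depending only on
the data improves to `S / 2` (`exists_halving_threshold`). Repeated halving of the a priori bound on
`(0, T)`, which may depend on `T`, ends at the threshold, which does not (`exists_uniform_bound`).

Three points need care. The drift `∇U * ρ` equals a field of linear growth plus a field `c(t)` that
is constant in space and merely integrable in time; `c` is removed by passing to a moving frame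
(`IsDriftedFlow.isFlow`). The density has no time derivative, so the chain rule in time is replaced
by time increments and the convexity of `u³` (`IsFlow.pairing_le`), and Gronwall's inequality by a
weight solving the dual equation backwards (`exists_isTimeWeight`). Finally, spatial cutoffs are
needed; their errors tend to zero with the inverse radius and the tail of the mass, so the growth
constant of the drift never enters the threshold. -/

section Main

open Filter Topology Metric ContinuousLinearMap
open scoped Convolution

set_option linter.unusedSectionVars false

/-! ### Continuity of translations. -/

section Translation

variable {G F : Type*} [NormedAddCommGroup G] [NormedSpace ℝ G] [FiniteDimensional ℝ G]
  [MeasureSpace G] [BorelSpace G] [(volume : Measure G).IsAddHaarMeasure]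
  [NormedAddCommGroup F]

/-- Translations act continuously on `Lᵖ`, `1 ≤ p < ∞`. -/
theorem tendsto_eLpNorm_translate_sub {p : ℝ≥0∞} (hp1 : 1 ≤ p) (hp : p ≠ ⊤) {f : G → F}
    (hf : MemLp f p volume) (z₀ : G) :
    Tendsto (fun z => eLpNorm (fun x => f (x - z) - f (x - z₀)) p volume) (𝓝 z₀) (𝓝 0) := by
  have : Fact (1 ≤ p) := ⟨hp1⟩
  have : ProperSpace G := FiniteDimensional.proper ℝ G
  -- Currying makes the translations a continuous curve for the compact-open topology, the mode of
  -- convergence under which composition with measure preserving maps is continuous on `Lᵖ`.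
  let g : G → C(G, G) := (ContinuousMap.curry ⟨fun a : G × G => a.2 - a.1, by fun_prop⟩)
  have hg : Continuous g := ContinuousMap.continuous _
  have hgm : ∀ z, MeasurePreserving (g z) (volume : Measure G) volume := fun z =>
    measurePreserving_sub_right volume z
  have h := Filter.Tendsto.compMeasurePreservingLp (tendsto_const_nhds (x := hf.toLp f))
    (hg.tendsto z₀) hgm (hgm z₀) hp
  rw [tendsto_iff_edist_tendsto_0] at h
  refine h.congr fun z => ?_
  rw [Lp.edist_def]
  refine eLpNorm_congr_ae ?_
  have e : ∀ z, (Lp.compMeasurePreserving (g z) (hgm z) (hf.toLp f) : G → F) =ᵐ[volume]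
      fun x => f (x - z) := fun z =>
    (Lp.coeFn_compMeasurePreserving _ (hgm z)).trans
      ((hgm z).quasiMeasurePreserving.ae_eq_comp hf.coeFn_toLp)
  filter_upwards [e z, e z₀] with x h1 h2
  rw [Pi.sub_apply, h1, h2]

end Translation

/-! ### Mollification and convergence in `L¹`. -/

section Mollifier

variable (G : Type*) [NormedAddCommGroup G] [NormedSpace ℝ G]

/-- A sequence of bump functions whose supports shrink to the origin. -/
noncomputable def bump (j : ℕ) : ContDiffBump (0 : G) where
  rIn := 1 / (2 * ((j : ℝ) + 1))
  rOut := 1 / ((j : ℝ) + 1)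
  rIn_pos := by positivity
  rIn_lt_rOut := by
    apply one_div_lt_one_div_of_lt <;> nlinarith [(Nat.cast_nonneg j : (0 : ℝ) ≤ j)]

theorem bump_rOut_tendsto : Tendsto (fun j => (bump G j).rOut) atTop (𝓝 0) :=
  tendsto_one_div_add_atTop_nhds_zero_nat

theorem bump_rOut_le_one (j : ℕ) : (bump G j).rOut ≤ 1 := by
  change 1 / ((j : ℝ) + 1) ≤ 1
  rw [div_le_one (by positivity)]
  linarith [(Nat.cast_nonneg j : (0 : ℝ) ≤ j)]

variable {G}
variable [FiniteDimensional ℝ G]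
  [MeasureSpace G] [BorelSpace G] [(volume : Measure G).IsAddHaarMeasure]

/-- The normalized smooth kernels of the mollification. -/
noncomputable def kernel (j : ℕ) : G → ℝ := (bump G j).normed volume

theorem kernel_nonneg (j : ℕ) (z : G) : 0 ≤ kernel j z := (bump G j).nonneg_normed z

theorem integral_kernel (j : ℕ) : ∫ z : G, kernel j z = 1 := (bump G j).integral_normed

theorem contDiff_kernel (j : ℕ) : ContDiff ℝ ∞ (kernel j : G → ℝ) :=
  (bump G j).contDiff_normed

theorem hasCompactSupport_kernel (j : ℕ) : HasCompactSupport (kernel j : G → ℝ) :=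
  (bump G j).hasCompactSupport_normed

theorem kernel_eq_zero {j : ℕ} {z : G} (hz : (bump G j).rOut ≤ ‖z‖) : kernel j z = 0 := by
  have : z ∉ Function.support (kernel j : G → ℝ) := by
    rw [kernel, (bump G j).support_normed_eq]
    simpa using hz
  simpa using this

theorem continuous_kernel (j : ℕ) : Continuous (kernel j : G → ℝ) :=
  (contDiff_kernel j).continuous

theorem integrable_kernel (j : ℕ) : Integrable (kernel j : G → ℝ) :=
  (continuous_kernel j).integrable_of_hasCompactSupport (hasCompactSupport_kernel j)

theorem lintegral_kernel (j : ℕ) : ∫⁻ z : G, ‖kernel j z‖ₑ = 1 := by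
  rw [← ofReal_integral_norm_eq_lintegral_enorm (integrable_kernel j)]
  simp only [Real.norm_of_nonneg (kernel_nonneg _ _), integral_kernel, ENNReal.ofReal_one]

variable {F : Type*} [NormedAddCommGroup F] [NormedSpace ℝ F]

/-- The mollification of a function. -/
noncomputable def mollify (j : ℕ) (f : G → F) : G → F := kernel j ⋆[lsmul ℝ ℝ, volume] f

theorem mollify_apply (j : ℕ) (f : G → F) (x : G) :
    mollify j f x = ∫ z, kernel j z • f (x - z) := rfl

theorem mollify_apply' (j : ℕ) (f : G → F) (x : G) :
    mollify j f x = ∫ y, kernel j (x - y) • f y := by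
  rw [mollify, convolution_lsmul_swap]

theorem contDiff_mollify {f : G → F} [CompleteSpace F] (j : ℕ) (hf : LocallyIntegrable f volume) :
    ContDiff ℝ ∞ (mollify j f) :=
  (hasCompactSupport_kernel j).contDiff_convolution_left _ (contDiff_kernel j) hf

theorem hasCompactSupport_mollify {f : G → F} (j : ℕ) (hf : HasCompactSupport f) :
    HasCompactSupport (mollify j f) :=
  (hasCompactSupport_kernel j).convolution _ hf

theorem integrable_mollify {f : G → F} (j : ℕ) (hf : Integrable f) : Integrable (mollify j f) :=
  (integrable_kernel j).integrable_convolution _ hf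

theorem integrable_kernel_smul {f : G → F} (j : ℕ) (hf : LocallyIntegrable f volume) (x : G) :
    Integrable fun z => kernel j z • f (x - z) := by
  have : ProperSpace G := FiniteDimensional.proper ℝ G
  exact (hasCompactSupport_kernel j).convolutionExists_left (lsmul ℝ ℝ) (continuous_kernel j) hf x

theorem mollify_sub_apply [CompleteSpace F] {f : G → F} (j : ℕ) (hf : LocallyIntegrable f volume)
    (x : G) : mollify j f x - f x = ∫ z, kernel j z • (f (x - z) - f x) := by
  simp_rw [smul_sub]
  rw [integral_sub (integrable_kernel_smul j hf x) ((integrable_kernel j).smul_const _),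
    integral_smul_const, integral_kernel, one_smul, mollify_apply]

/-- Mollifications of an integrable function converge in `L¹`. -/
theorem tendsto_mollify_L1 [CompleteSpace F] {f : G → F} (hf : Integrable f) :
    Tendsto (fun j => ∫⁻ x, ‖mollify j f x - f x‖ₑ) atTop (𝓝 0) := by
  have ht := tendsto_eLpNorm_translate_sub le_rfl (by simp) (memLp_one_iff_integrable.2 hf) 0
  rw [ENNReal.tendsto_nhds_zero] at ht ⊢
  intro ε hε
  obtain ⟨δ, hδ, hb⟩ := Metric.eventually_nhds_iff.1 (ht ε hε)
  filter_upwards [(bump_rOut_tendsto G).eventually_lt_const hδ] with j hj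
  have hmeas : AEStronglyMeasurable (fun p : G × G => f (p.1 - p.2) - f p.1)
      (volume.prod volume) := by
    refine AEStronglyMeasurable.sub ?_ hf.1.comp_fst
    exact hf.1.comp_quasiMeasurePreserving (quasiMeasurePreserving_sub_of_right_invariant _ _)
  calc ∫⁻ x, ‖mollify j f x - f x‖ₑ
      ≤ ∫⁻ x, ∫⁻ z, ‖kernel j z‖ₑ * ‖f (x - z) - f x‖ₑ := by
        refine lintegral_mono fun x => ?_
        rw [mollify_sub_apply j hf.locallyIntegrable]
        refine (enorm_integral_le_lintegral_enorm _).trans (lintegral_mono fun z => ?_)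
        rw [enorm_smul]
    _ = ∫⁻ z, ∫⁻ x, ‖kernel j z‖ₑ * ‖f (x - z) - f x‖ₑ := by
        refine lintegral_lintegral_swap ?_
        exact ((continuous_kernel j).aestronglyMeasurable.comp_snd.enorm).mul hmeas.enorm
    _ ≤ ∫⁻ z : G, ‖kernel j z‖ₑ * ε := by
        refine lintegral_mono fun z => ?_
        rw [lintegral_const_mul' _ _ enorm_ne_top]
        by_cases hz : (bump G j).rOut ≤ ‖z‖
        · simp [kernel_eq_zero hz]
        · gcongr
          have := hb (y := z) (by rw [dist_zero_right]; exact (not_le.1 hz).trans hj)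
          simpa [eLpNorm_one_eq_lintegral_enorm] using this
    _ = ε := by
        rw [lintegral_mul_const _ (continuous_kernel j).measurable.enorm, lintegral_kernel, one_mul]

end Mollifier

/-! ### Mollification of locally integrable functions. -/

section LocalMollifier

variable {G : Type*} [NormedAddCommGroup G] [NormedSpace ℝ G] [FiniteDimensional ℝ G]
  [MeasureSpace G] [BorelSpace G] [(volume : Measure G).IsAddHaarMeasure]
  {F : Type*} [NormedAddCommGroup F] [NormedSpace ℝ F] [CompleteSpace F]

theorem ae_tendsto_mollify {f : G → F} (hf : LocallyIntegrable f volume) :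
    ∀ᵐ x, Tendsto (fun j => mollify j f x) atTop (𝓝 (f x)) := by
  -- The ratio of the outer to the inner radius is exactly 2 for every bump, as Lebesgue
  -- differentiation requires a bounded ratio.
  refine ContDiffBump.ae_convolution_tendsto_right_of_locallyIntegrable (K := 2)
    (bump_rOut_tendsto G) (Eventually.of_forall fun j => ?_) hf
  change 1 / ((j : ℝ) + 1) ≤ 2 * (1 / (2 * ((j : ℝ) + 1)))
  have : (0 : ℝ) < (j : ℝ) + 1 := by positivity
  exact le_of_eq (by field_simp)

theorem mollify_congr_ball {f g : G → F} {j : ℕ} {x : G}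
    (h : ∀ y, dist y x < 1 → f y = g y) : mollify j f x = mollify j g x := by
  rw [mollify_apply, mollify_apply]
  congr 1
  ext z
  by_cases hz : (bump G j).rOut ≤ ‖z‖
  · simp [kernel_eq_zero hz]
  · rw [h]
    simpa [dist_eq_norm] using (not_le.1 hz).trans_le (bump_rOut_le_one G j)

theorem mollify_eq_zero_of_norm {f : G → F} {j : ℕ} {R : ℝ} (hf : ∀ x, R ≤ ‖x‖ → f x = 0) {x : G}
    (hx : R + 1 ≤ ‖x‖) : mollify j f x = 0 := by
  rw [mollify_congr_ball (g := fun _ => 0), mollify_apply]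
  · simp
  · intro y hy
    refine hf y ?_
    have := norm_sub_norm_le x y
    rw [dist_comm, dist_eq_norm] at hy
    linarith

theorem tendsto_mollify_L1_ball {f : G → F} (hf : LocallyIntegrable f volume) (R : ℝ) :
    Tendsto (fun j => ∫⁻ x in ball (0 : G) R, ‖mollify j f x - f x‖ₑ) atTop (𝓝 0) := by
  have : ProperSpace G := FiniteDimensional.proper ℝ G
  -- All kernels live in the unit ball, so inside radius `R` the mollification sees `f` only up to
  -- radius `R + 1`.
  let f' := (closedBall (0 : G) (R + 1)).indicator f
  have hf' : Integrable f' :=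
    (hf.integrableOn_isCompact (isCompact_closedBall _ _)).integrable_indicator
      measurableSet_closedBall
  refine tendsto_of_tendsto_of_tendsto_of_le_of_le tendsto_const_nhds (tendsto_mollify_L1 hf')
    (fun _ => zero_le) fun j => ?_
  calc ∫⁻ x in ball (0 : G) R, ‖mollify j f x - f x‖ₑ
      = ∫⁻ x in ball (0 : G) R, ‖mollify j f' x - f' x‖ₑ := by
        refine setLIntegral_congr_fun measurableSet_ball fun x hx => ?_
        have hx' : ‖x‖ < R := by simpa using hx
        have h1 : f' x = f x := indicator_of_mem (by simpa using by linarith) _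
        have h2 : mollify j f' x = mollify j f x := by
          refine mollify_congr_ball fun y hy => indicator_of_mem ?_ _
          rw [dist_eq_norm] at hy
          have := norm_sub_norm_le y x
          simpa using by linarith
        simp only [h1, h2]
    _ ≤ _ := setLIntegral_le_lintegral _ _

/-- The kernel is a probability density, so a mollification is an average of values. This keeps
mollified functions in the range where a nonlinearity and its derivative are bounded. -/
theorem mollify_mem_Icc {f : G → ℝ} {a b : ℝ} (hf : LocallyIntegrable f volume)
    (hab : ∀ᵐ x, f x ∈ Icc a b) (j : ℕ) (x : G) : mollify j f x ∈ Icc a b := by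
  have h' : ∀ᵐ z, f (x - z) ∈ Icc a b :=
    (Measure.measurePreserving_sub_left volume x).quasiMeasurePreserving.ae hab
  have hc : ∀ c : ℝ, ∫ z : G, kernel j z • c = c := fun c => by
    rw [integral_smul_const, integral_kernel, one_smul]
  constructor
  · rw [← hc a, mollify_apply]
    refine integral_mono_ae ((integrable_kernel j).smul_const _)
      (integrable_kernel_smul j hf x) ?_
    filter_upwards [h'] with z hz
    exact smul_le_smul_of_nonneg_left hz.1 (kernel_nonneg j z)
  · rw [← hc b, mollify_apply]
    refine integral_mono_ae (integrable_kernel_smul j hf x)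
      ((integrable_kernel j).smul_const _) ?_
    filter_upwards [h'] with z hz
    exact smul_le_smul_of_nonneg_left hz.2 (kernel_nonneg j z)

/-- A bounded factor is harmless under `L¹` convergence. The bilinear form is general so as to cover
both products of scalars and inner products of fields. -/
theorem tendsto_integral_bilin_of_L1 {H K : Type*} [NormedAddCommGroup H] [NormedSpace ℝ H]
    [NormedAddCommGroup K] [NormedSpace ℝ K] (B : H →L[ℝ] F →L[ℝ] K)
    {s : Set G} {a : G → H} {C : ℝ} (ha : AEStronglyMeasurable a volume)
    (hs : MeasurableSet s) (hC : ∀ᵐ x, x ∈ s → ‖a x‖ ≤ C) (f : ℕ → G → F) (g : G → F)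
    (hf : ∀ j, IntegrableOn (f j) s) (hg : IntegrableOn g s)
    (h : Tendsto (fun j => ∫⁻ x in s, ‖f j x - g x‖ₑ) atTop (𝓝 0)) :
    Tendsto (fun j => ∫ x in s, B (a x) (f j x)) atTop (𝓝 (∫ x in s, B (a x) (g x))) := by
  have hint : ∀ u : G → F, IntegrableOn u s → IntegrableOn (fun x => B (a x) (u x)) s := by
    intro u hu
    refine Integrable.mono' (hu.norm.const_mul (‖B‖ * C)) (B.aestronglyMeasurable_comp₂
      ha.restrict hu.1) ?_
    filter_upwards [ae_restrict_of_ae hC, ae_restrict_mem hs] with x hx hxs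
    refine (B.le_opNorm₂ _ _).trans ?_
    gcongr
    exact hx hxs
  rw [tendsto_iff_edist_tendsto_0]
  have h2 : Tendsto (fun j => ENNReal.ofReal (‖B‖ * C) * ∫⁻ x in s, ‖f j x - g x‖ₑ)
      atTop (𝓝 0) := by
    simpa using ENNReal.Tendsto.const_mul h (Or.inr ENNReal.ofReal_ne_top)
  refine tendsto_of_tendsto_of_tendsto_of_le_of_le tendsto_const_nhds h2 (fun _ => zero_le) ?_
  intro j
  change edist (∫ x in s, B (a x) (f j x)) (∫ x in s, B (a x) (g x)) ≤
    ENNReal.ofReal (‖B‖ * C) * ∫⁻ x in s, ‖f j x - g x‖ₑ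
  rw [edist_eq_enorm_sub, ← integral_sub (hint _ (hf j)) (hint _ hg), ← lintegral_const_mul' _ _ ENNReal.ofReal_ne_top]
  refine (enorm_integral_le_lintegral_enorm _).trans (lintegral_mono_ae ?_)
  filter_upwards [ae_restrict_of_ae hC, ae_restrict_mem hs] with x hx hxs
  rw [← map_sub, ← ofReal_norm, ← ofReal_norm, ← ENNReal.ofReal_mul' (norm_nonneg _)]
  refine ENNReal.ofReal_le_ofReal ((B.le_opNorm₂ _ _).trans ?_)
  gcongr
  exact hx hxs

end LocalMollifier

/-! ### Gradients of smooth functions. -/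

section Gradient

variable {n : ℕ}

theorem inner_gradient (f : Space n → ℝ) (x v : Space n) :
    inner ℝ (gradient f x) v = fderiv ℝ f x v := by
  simp [gradient]

theorem continuous_gradient {f : Space n → ℝ} (hf : ContDiff ℝ 1 f) : Continuous (gradient f) :=
  (InnerProductSpace.toDual ℝ (Space n)).symm.continuous.comp (hf.continuous_fderiv one_ne_zero)

theorem hasCompactSupport_gradient {f : Space n → ℝ} (hf : HasCompactSupport f) :
    HasCompactSupport (gradient f) := by
  have h := hf.fderiv (𝕜 := ℝ)
  exact h.comp_left (g := (InnerProductSpace.toDual ℝ (Space n)).symm) (map_zero _)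

theorem integral_smul_gradient_eq {f ψ : Space n → ℝ} (hf : ContDiff ℝ 1 f) (hψ : ContDiff ℝ 1 ψ)
    (hc : HasCompactSupport ψ) : ∫ x, f x • gradient ψ x = - ∫ x, ψ x • gradient f x := by
  have i1 : Integrable fun x => f x • gradient ψ x :=
    (hf.continuous.smul (continuous_gradient hψ)).integrable_of_hasCompactSupport
      (hasCompactSupport_gradient hc).smul_left
  have i2 : Integrable fun x => ψ x • gradient f x :=
    (hψ.continuous.smul (continuous_gradient hf)).integrable_of_hasCompactSupport hc.smul_right
  refine ext_inner_left ℝ fun v => ?_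
  rw [inner_neg_right, ← integral_inner i1, ← integral_inner i2]
  have h1 := Integrable.const_inner (𝕜 := ℝ) v i1
  have h2 := Integrable.const_inner (𝕜 := ℝ) v i2
  have e : ∀ (f : Space n → ℝ) x, inner ℝ v (gradient f x) = fderiv ℝ f x v := fun f x => by
    rw [real_inner_comm, inner_gradient]
  simp_rw [inner_smul_right, e] at h1 h2 ⊢
  simp_rw [mul_comm (ψ _)] at h2 ⊢
  exact integral_mul_fderiv_eq_neg_fderiv_mul_of_integrable h2 h1
    ((hf.continuous.mul hψ.continuous).integrable_of_hasCompactSupport hc.mul_left)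
    (fun x _ => hf.differentiable one_ne_zero x) (fun x _ => hψ.differentiable one_ne_zero x)

theorem gradient_comp_sub_left {f : Space n → ℝ} (hf : Differentiable ℝ f) (x y : Space n) :
    gradient (fun y => f (x - y)) y = - gradient f (x - y) := by
  refine ext_inner_right ℝ fun v => ?_
  rw [inner_neg_left, inner_gradient, inner_gradient]
  have h := (hf (x - y)).hasFDerivAt.comp y ((hasFDerivAt_const x y).sub (hasFDerivAt_id y))
  have h' : fderiv ℝ (fun y => f (x - y)) y = _ := h.fderiv
  rw [h']
  simp

theorem gradient_mul {f g : Space n → ℝ} {x : Space n} (hf : DifferentiableAt ℝ f x)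
    (hg : DifferentiableAt ℝ g x) :
    gradient (fun x => f x * g x) x = f x • gradient g x + g x • gradient f x := by
  refine ext_inner_right ℝ fun v => ?_
  rw [inner_add_left, inner_smul_left, inner_smul_left, inner_gradient, inner_gradient,
    inner_gradient, fderiv_fun_mul hf hg]
  simp

theorem gradient_comp {h : ℝ → ℝ} {h' : ℝ} {f : Space n → ℝ} {x : Space n}
    (hh : HasDerivAt h h' (f x)) (hf : DifferentiableAt ℝ f x) :
    gradient (fun x => h (f x)) x = h' • gradient f x := by
  refine ext_inner_right ℝ fun v => ?_
  have e : fderiv ℝ (fun x => h (f x)) x = _ := (hh.comp_hasFDerivAt x hf.hasFDerivAt).fderiv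
  rw [inner_smul_left, inner_gradient, inner_gradient, e]
  simp

theorem norm_gradient (f : Space n → ℝ) (x : Space n) : ‖gradient f x‖ = ‖fderiv ℝ f x‖ := by
  simp [gradient]

end Gradient

/-! ### Weak gradients: approximation, product rule and chain rule. -/

section WeakGradient

variable {n : ℕ} {w : Space n → ℝ} {g : Space n → Space n}

theorem HasWeakGradient.congr {w' : Space n → ℝ} {g' : Space n → Space n}
    (h : HasWeakGradient w g) (hw : w =ᵐ[volume] w') (hg : g =ᵐ[volume] g') :
    HasWeakGradient w' g' := by
  refine ⟨h.1.congr hw, h.2.1.congr hg, fun ψ h1 h2 => ?_⟩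
  rw [← integral_congr_ae (hw.smul (ae_eq_refl (gradient ψ))), h.2.2 ψ h1 h2,
    integral_congr_ae ((ae_eq_refl ψ).smul hg)]

/-- The mollification of a weakly differentiable function is smooth, and its gradient is the
mollification of the weak gradient. -/
theorem HasWeakGradient.gradient_mollify (h : HasWeakGradient w g) (j : ℕ) (x : Space n) :
    gradient (mollify j w) x = mollify j g x := by
  have hk : ContDiff ℝ 1 (kernel j : Space n → ℝ) := (contDiff_kernel j).of_le (by simp)
  have hd := (hasCompactSupport_kernel j).hasFDerivAt_convolution_right (mul ℝ ℝ) h.1 hk x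
  have hmul : mollify j w = w ⋆[mul ℝ ℝ, volume] kernel j := by
    ext x
    rw [mollify_apply', convolution_mul]
    simp [mul_comm]
  have hc : HasCompactSupport fun y => kernel j (x - y) :=
    (hasCompactSupport_kernel j).comp_homeomorph (Homeomorph.subLeft x)
  have hs : ContDiff ℝ ∞ fun y => kernel j (x - y) :=
    (contDiff_kernel j).comp (contDiff_const.sub contDiff_id)
  -- The weak gradient is tested with `y ↦ kernel j (x - y)`; the sign from differentiating in `y`
  -- cancels the sign in the definition.
  have key := h.2.2 _ hs hc
  simp_rw [gradient_comp_sub_left (hk.differentiable one_ne_zero), smul_neg, integral_neg,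
    neg_inj] at key
  rw [mollify_apply', ← key]
  refine ext_inner_right ℝ fun v => ?_
  have hi : Integrable fun y => w y • gradient (kernel j) (x - y) := by
    have := (hasCompactSupport_gradient (hasCompactSupport_kernel j)).convolutionExists_right
      (lsmul ℝ ℝ) h.1 (continuous_gradient hk) x
    exact this
  rw [inner_gradient, hmul, hd.fderiv, convolution_precompR_apply _ h.1
    ((hasCompactSupport_kernel j).fderiv (𝕜 := ℝ)) (hk.continuous_fderiv one_ne_zero),
    real_inner_comm, ← integral_inner hi, convolution_mul]
  congr 1
  ext y
  rw [inner_smul_right, real_inner_comm, inner_gradient]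

/-- The factor `χ` moves onto the test function: `χ ψ` is again admissible, and the product rule for
its gradient produces the extra term. -/
theorem HasWeakGradient.smul_contDiff (h : HasWeakGradient w g) {χ : Space n → ℝ}
    (hχ : ContDiff ℝ ∞ χ) :
    HasWeakGradient (fun x => χ x * w x) fun x => χ x • g x + w x • gradient χ x := by
  have hχ1 : ContDiff ℝ 1 χ := hχ.of_le (by simp)
  have l1 : LocallyIntegrable (fun x => χ x • g x) volume :=
    h.2.1.continuous_smul hχ.continuous
  have l2 : LocallyIntegrable (fun x => w x • gradient χ x) volume :=
    h.1.smul_continuous (continuous_gradient hχ1)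
  refine ⟨h.1.continuous_smul hχ.continuous, l1.add l2, fun ψ h1 h2 => ?_⟩
  have hψ1 : ContDiff ℝ 1 ψ := h1.of_le (by simp)
  have key := h.2.2 (fun x => χ x * ψ x) (hχ.mul h1) h2.mul_left
  have i1 : Integrable fun x => ψ x • χ x • g x := by
    exact l1.integrable_smul_left_of_hasCompactSupport hψ1.continuous h2
  have i2 : Integrable fun x => ψ x • w x • gradient χ x := by
    exact l2.integrable_smul_left_of_hasCompactSupport hψ1.continuous h2
  have i3 : Integrable fun x => (χ x * w x) • gradient ψ x := by
    exact (h.1.continuous_smul hχ.continuous).integrable_smul_right_of_hasCompactSupport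
      (continuous_gradient hψ1) (hasCompactSupport_gradient h2)
  have e1 : ∀ x, w x • gradient (fun x => χ x * ψ x) x =
      (χ x * w x) • gradient ψ x + ψ x • w x • gradient χ x := fun x => by
    rw [gradient_mul (hχ1.differentiable one_ne_zero x) (hψ1.differentiable one_ne_zero x)]
    module
  have e2 : ∀ x, (χ x * ψ x) • g x = ψ x • χ x • g x := fun x => by module
  simp_rw [e1, e2] at key
  rw [integral_add i3 i2] at key
  simp_rw [smul_add]
  rw [integral_add i1 i2, eq_sub_of_add_eq key]
  abel

/-- The chain rule for a `C¹` function of a bounded weakly differentiable function. -/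
theorem HasWeakGradient.comp (hw : HasWeakGradient w g) {a b : ℝ} (hab : ∀ᵐ x, w x ∈ Icc a b)
    {h h' : ℝ → ℝ} (hh : ∀ s, HasDerivAt h (h' s) s) (hh' : Continuous h') :
    HasWeakGradient (fun x => h (w x)) fun x => h' (w x) • g x := by
  have hc : Continuous h := continuous_iff_continuousAt.2 fun s => (hh s).continuousAt
  obtain ⟨C, hC⟩ := (isCompact_Icc (a := a) (b := b)).exists_bound_of_continuousOn hc.continuousOn
  obtain ⟨C', hC'⟩ := (isCompact_Icc (a := a) (b := b)).exists_bound_of_continuousOn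
    hh'.continuousOn
  have hm : AEStronglyMeasurable w volume := hw.1.aestronglyMeasurable
  have hm' : AEStronglyMeasurable (fun x => h' (w x)) volume := hh'.comp_aestronglyMeasurable hm
  have hl : LocallyIntegrable (fun x => h (w x)) volume := by
    refine (locallyIntegrable_const C).mono (hc.comp_aestronglyMeasurable hm) ?_
    filter_upwards [hab] with x hx using (hC _ hx).trans (le_abs_self C)
  have hl' : LocallyIntegrable (fun x => h' (w x) • g x) volume := by
    refine (hw.2.1.smul C').mono (hm'.smul hw.2.1.aestronglyMeasurable) ?_
    filter_upwards [hab] with x hx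
    rw [Pi.smul_apply, norm_smul, norm_smul]
    gcongr
    exact (hC' _ hx).trans (le_abs_self C')
  refine ⟨hl, hl', fun ψ h1 h2 => ?_⟩
  have hψ1 : ContDiff ℝ 1 ψ := h1.of_le (by simp)
  have hsm : ∀ j, ContDiff ℝ 1 (mollify j w) := fun j => (contDiff_mollify j hw.1).of_le (by simp)
  have hcd : ContDiff ℝ 1 h := contDiff_one_iff_deriv.2
    ⟨fun s => (hh s).differentiableAt, by rwa [show deriv h = h' from funext fun s => (hh s).deriv]⟩
  have hI := fun j x => mollify_mem_Icc hw.1 hab j x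
  have key : ∀ j, ∫ x, h (mollify j w x) • gradient ψ x =
      - ∫ x, (ψ x * h' (mollify j w x)) • mollify j g x := fun j => by
    have := integral_smul_gradient_eq (hcd.comp (hsm j)) hψ1 h2
    simp only [Function.comp_apply] at this
    rw [this]
    congr 2
    ext1 x
    have e : gradient (h ∘ mollify j w) x = _ :=
      gradient_comp (hh _) ((hsm j).differentiable one_ne_zero x)
    rw [e, hw.gradient_mollify, smul_smul]
  have iψ : Integrable ψ := hψ1.continuous.integrable_of_hasCompactSupport h2
  have igψ : Integrable (gradient ψ) := (continuous_gradient hψ1).integrable_of_hasCompactSupport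
    (hasCompactSupport_gradient h2)
  have lim1 : Tendsto (fun j => ∫ x, h (mollify j w x) • gradient ψ x) atTop
      (𝓝 (∫ x, h (w x) • gradient ψ x)) := by
    refine tendsto_integral_of_dominated_convergence (fun x => C * ‖gradient ψ x‖) ?_
      (igψ.norm.const_mul C) ?_ ?_
    · exact fun j => ((hc.comp (hsm j).continuous).smul
        (continuous_gradient hψ1)).aestronglyMeasurable
    · refine fun j => Eventually.of_forall fun x => ?_
      rw [norm_smul]
      gcongr
      exact hC _ (hI j x)
    · filter_upwards [ae_tendsto_mollify hw.1] with x hx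
      exact ((hc.tendsto _).comp hx).smul_const _
  obtain ⟨R, hR⟩ := h2.isCompact.isBounded.subset_ball (0 : Space n)
  have hψ0 : ∀ x, x ∉ ball (0 : Space n) R → ψ x = 0 := fun x hx =>
    image_eq_zero_of_notMem_tsupport fun h => hx (hR h)
  obtain ⟨D, hD⟩ := hψ1.continuous.bounded_above_of_compact_support h2
  have gi : ∀ j, IntegrableOn (mollify j g) (ball 0 R) := fun j =>
    (((contDiff_mollify j hw.2.1).continuous.locallyIntegrable).integrableOn_isCompact
      (isCompact_closedBall 0 R)).mono_set ball_subset_closedBall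
  have gi' : IntegrableOn g (ball 0 R) :=
    (hw.2.1.integrableOn_isCompact (isCompact_closedBall 0 R)).mono_set ball_subset_closedBall
  have hbd : ∀ s ∈ Icc a b, ∀ x, ‖ψ x * h' s‖ ≤ D * C' := fun s hs x => by
    rw [norm_mul]
    exact mul_le_mul (hD x) (hC' s hs) (norm_nonneg _) ((norm_nonneg _).trans (hD x))
  have lim2 : Tendsto (fun j => ∫ x, (ψ x * h' (mollify j w x)) • mollify j g x) atTop
      (𝓝 (∫ x, (ψ x * h' (w x)) • g x)) := by
    have hr : ∀ (u : Space n → ℝ) (v : Space n → Space n), ∫ x, (ψ x * u x) • v x =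
        ∫ x in ball (0 : Space n) R, (ψ x * u x) • v x := fun u v => by
      rw [setIntegral_eq_integral_of_forall_compl_eq_zero]
      intro x hx
      simp [hψ0 x hx]
    have hcont : ∀ j, Continuous fun x => ψ x * h' (mollify j w x) := fun j =>
      hψ1.continuous.mul (hh'.comp (hsm j).continuous)
    have ig : ∀ j, IntegrableOn (fun x => (ψ x * h' (mollify j w x)) • g x) (ball 0 R) := fun j => by
      refine Integrable.mono' (gi'.norm.const_mul (D * C'))
        ((hcont j).aestronglyMeasurable.restrict.smul gi'.1) (Eventually.of_forall fun x => ?_)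
      rw [norm_smul]
      gcongr
      exact hbd _ (hI j x) x
    have ig2 : ∀ j, IntegrableOn (fun x => (ψ x * h' (mollify j w x)) • (mollify j g x - g x))
        (ball 0 R) := fun j => by
      refine Integrable.mono' (((gi j).sub gi').norm.const_mul (D * C'))
        ((hcont j).aestronglyMeasurable.restrict.smul ((gi j).sub gi').1)
        (Eventually.of_forall fun x => ?_)
      rw [norm_smul]
      exact mul_le_mul_of_nonneg_right (hbd _ (hI j x) x) (norm_nonneg _)
    simp_rw [hr]
    -- The coefficient `h' (mollify j w)` converges only almost everywhere and boundedly, and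
    -- `mollify j g` only in `L¹` on balls. So the product is split: with `g` frozen dominated
    -- convergence applies, and the remainder is a bounded factor times an `L¹` null sequence.
    have t1 : Tendsto (fun j => ∫ x in ball (0 : Space n) R, (ψ x * h' (mollify j w x)) • g x) atTop
        (𝓝 (∫ x in ball (0 : Space n) R, (ψ x * h' (w x)) • g x)) := by
      refine tendsto_integral_of_dominated_convergence (fun x => (D * C') * ‖g x‖)
        (fun j => (ig j).1) (gi'.norm.const_mul _) ?_ ?_
      · refine fun j => Eventually.of_forall fun x => ?_
        rw [norm_smul]
        gcongr
        exact hbd _ (hI j x) x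
      · filter_upwards [ae_restrict_of_ae (ae_tendsto_mollify hw.1)] with x hx
        exact (((hh'.tendsto _).comp hx).const_mul _).smul_const _
    have t2 : Tendsto (fun j => ∫ x in ball (0 : Space n) R,
        (ψ x * h' (mollify j w x)) • (mollify j g x - g x)) atTop (𝓝 0) := by
      have hL := tendsto_mollify_L1_ball hw.2.1 R
      have hL2 : Tendsto (fun j => ENNReal.ofReal (D * C') *
          ∫⁻ x in ball (0 : Space n) R, ‖mollify j g x - g x‖ₑ) atTop (𝓝 0) := by
        simpa using ENNReal.Tendsto.const_mul hL (Or.inr ENNReal.ofReal_ne_top)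
      rw [tendsto_zero_iff_enorm_tendsto_zero]
      refine tendsto_of_tendsto_of_tendsto_of_le_of_le tendsto_const_nhds hL2
        (fun _ => zero_le) fun j => ?_
      refine (enorm_integral_le_lintegral_enorm _).trans ?_
      change _ ≤ ENNReal.ofReal (D * C') * ∫⁻ x in ball (0 : Space n) R, ‖mollify j g x - g x‖ₑ
      rw [← lintegral_const_mul' _ _ ENNReal.ofReal_ne_top]
      refine lintegral_mono fun x => ?_
      rw [enorm_smul, ← ofReal_norm (ψ x * _)]
      gcongr
      exact hbd _ (hI j x) x
    have t3 := t1.add t2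
    rw [add_zero] at t3
    refine t3.congr fun j => ?_
    rw [← integral_add (ig j) (ig2 j)]
    congr 1
    ext1 x
    module
  simp_rw [smul_smul]
  exact tendsto_nhds_unique lim1 (by simpa only [key] using lim2.neg)

end WeakGradient

/-! ### Sobolev and Faber–Krahn inequalities. -/

variable {n : ℕ}

/-- A constant in the Sobolev inequality `W^{1,1} ⊂ L^{n/(n-1)}`. -/
noncomputable def sobolevConst (n : ℕ) : ℝ :=
  eLpNormLESNormFDerivOneConst (volume : Measure (Space n)) ((n : ℝ) / (n - 1))

theorem sobolevConst_nonneg (n : ℕ) : 0 ≤ sobolevConst n := NNReal.coe_nonneg _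

/-- Gagliardo–Nirenberg–Sobolev with exponent `n / (n - 1)`, followed by Hölder's inequality on `s`,
which costs `μ` to the power `1 - (n - 1) / n = 1 / n`. -/
theorem integral_norm_le_of_contDiff (hn : 2 ≤ n) {v : Space n → ℝ} (hv : ContDiff ℝ 1 v)
    (hc : HasCompactSupport v) {s : Set (Space n)} {μ : ℝ} (hμ : 0 ≤ μ)
    (hsμ : volume s ≤ ENNReal.ofReal μ) :
    ∫⁻ x in s, ‖v x‖ₑ ≤
      ENNReal.ofReal (sobolevConst n * μ ^ (1 / (n : ℝ))) * ∫⁻ x, ‖gradient v x‖ₑ := by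
  have hn' : (2 : ℝ) ≤ n := by exact_mod_cast hn
  have hpos : (0 : ℝ) < (n : ℝ) / (n - 1) := by apply div_pos <;> linarith
  set p : ℝ≥0 := ⟨(n : ℝ) / (n - 1), hpos.le⟩ with hp
  have hpv : (p : ℝ) = (n : ℝ) / (n - 1) := rfl
  have hn1 : (n : ℝ) - 1 ≠ 0 := by linarith
  have hn0 : (n : ℝ) ≠ 0 := by linarith
  have hconj : NNReal.HolderConjugate (Module.finrank ℝ (Space n)) p := by
    rw [← NNReal.holderConjugate_coe_iff, Real.holderConjugate_iff]
    simp only [finrank_euclideanSpace, Fintype.card_fin, NNReal.coe_natCast, hpv]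
    refine ⟨by linarith, ?_⟩
    field_simp
    ring
  have h1 := eLpNorm_le_eLpNorm_fderiv_one (μ := (volume : Measure (Space n))) hv hc hconj
  have hp1 : (1 : ℝ≥0∞) ≤ p := by
    rw [← ENNReal.coe_one, ENNReal.coe_le_coe, ← NNReal.coe_le_coe]
    change (1 : ℝ) ≤ (n : ℝ) / (n - 1)
    rw [le_div_iff₀ (by linarith)]
    linarith
  have h2 := eLpNorm_le_eLpNorm_mul_rpow_measure_univ (μ := volume.restrict s) hp1
    hv.continuous.aestronglyMeasurable.restrict
  have hexp : 1 / (1 : ℝ≥0∞).toReal - 1 / (p : ℝ≥0∞).toReal = 1 / (n : ℝ) := by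
    rw [ENNReal.toReal_one, ENNReal.coe_toReal, hpv]
    field_simp
    ring
  rw [hexp, Measure.restrict_apply_univ] at h2
  have h3 : eLpNorm v p (volume.restrict s) ≤ eLpNorm v p volume := eLpNorm_restrict_le _ _ _ _
  calc ∫⁻ x in s, ‖v x‖ₑ = eLpNorm v 1 (volume.restrict s) := by
        rw [eLpNorm_one_eq_lintegral_enorm]
    _ ≤ eLpNorm v p (volume.restrict s) * volume s ^ (1 / (n : ℝ)) := h2
    _ ≤ (ENNReal.ofReal (sobolevConst n) * eLpNorm (fderiv ℝ v) 1 volume)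
        * ENNReal.ofReal μ ^ (1 / (n : ℝ)) := by
        gcongr
        refine h3.trans (h1.trans (le_of_eq ?_))
        rw [sobolevConst, ENNReal.ofReal_coe_nnreal]
        rfl
    _ = _ := by
        rw [eLpNorm_one_eq_lintegral_enorm, ENNReal.ofReal_rpow_of_nonneg hμ (by positivity),
          ENNReal.ofReal_mul (sobolevConst_nonneg n)]
        have : ∀ x, ‖gradient v x‖ₑ = ‖fderiv ℝ v x‖ₑ := fun x => by
          rw [← ofReal_norm, norm_gradient, ofReal_norm]
        simp_rw [this]
        ring

theorem tendsto_lintegral_enorm_of_L1 {α F : Type*} [MeasurableSpace α] {μ : Measure α}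
    [NormedAddCommGroup F] {f : ℕ → α → F} {g : α → F}
    (hf : ∀ j, AEStronglyMeasurable (f j) μ) (hg : Integrable g μ)
    (h : Tendsto (fun j => ∫⁻ x, ‖f j x - g x‖ₑ ∂μ) atTop (𝓝 0)) :
    Tendsto (fun j => ∫⁻ x, ‖f j x‖ₑ ∂μ) atTop (𝓝 (∫⁻ x, ‖g x‖ₑ ∂μ)) := by
  have hm : ∀ j, AEMeasurable (fun x => ‖f j x - g x‖ₑ) μ := fun j => ((hf j).sub hg.1).enorm
  refine tendsto_of_tendsto_of_tendsto_of_le_of_le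
    (g := fun j => ∫⁻ x, ‖g x‖ₑ ∂μ - ∫⁻ x, ‖f j x - g x‖ₑ ∂μ)
    (h := fun j => ∫⁻ x, ‖g x‖ₑ ∂μ + ∫⁻ x, ‖f j x - g x‖ₑ ∂μ) ?_ ?_ ?_ ?_
  · simpa using ENNReal.Tendsto.sub tendsto_const_nhds h (Or.inl hg.2.ne)
  · simpa using tendsto_const_nhds.add h
  · intro j
    refine tsub_le_iff_right.2 ?_
    rw [← lintegral_add_right' _ (hm j)]
    refine lintegral_mono fun x => ?_
    have := enorm_sub_le (a := f j x) (b := f j x - g x)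
    simpa using this
  · intro j
    change _ ≤ ∫⁻ x, ‖g x‖ₑ ∂μ + ∫⁻ x, ‖f j x - g x‖ₑ ∂μ
    rw [← lintegral_add_right' _ (hm j)]
    refine lintegral_mono fun x => ?_
    have := enorm_add_le (g x) (f j x - g x)
    simpa using this

/-- A Faber–Krahn inequality in `L¹`: a compactly supported weakly differentiable function on a
set of small measure is controlled by its gradient. -/
theorem HasWeakGradient.lintegral_le (hn : 2 ≤ n) {v : Space n → ℝ} {g : Space n → Space n}
    (h : HasWeakGradient v g) (hv : Integrable v) (hg : Integrable g) {R : ℝ}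
    (hR : ∀ x, R ≤ ‖x‖ → v x = 0) {s : Set (Space n)} {μ : ℝ} (hμ : 0 ≤ μ)
    (hsμ : volume s ≤ ENNReal.ofReal μ) :
    ∫⁻ x in s, ‖v x‖ₑ ≤
      ENNReal.ofReal (sobolevConst n * μ ^ (1 / (n : ℝ))) * ∫⁻ x, ‖g x‖ₑ := by
  have hc : HasCompactSupport v := by
    refine HasCompactSupport.intro (isCompact_closedBall (0 : Space n) R) fun x hx => hR x ?_
    simpa using (not_le.1 (by simpa using hx)).le
  have hj := fun j => integral_norm_le_of_contDiff hn
    ((contDiff_mollify j hv.locallyIntegrable).of_le (by simp))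
    (hasCompactSupport_mollify j hc) hμ hsμ
  have hL := tendsto_mollify_L1 hv
  have l1 : Tendsto (fun j => ∫⁻ x in s, ‖mollify j v x‖ₑ) atTop (𝓝 (∫⁻ x in s, ‖v x‖ₑ)) := by
    refine tendsto_lintegral_enorm_of_L1
      (fun j => (contDiff_mollify j hv.locallyIntegrable).continuous.aestronglyMeasurable)
      hv.restrict ?_
    exact tendsto_of_tendsto_of_tendsto_of_le_of_le tendsto_const_nhds hL (fun _ => zero_le)
      fun j => setLIntegral_le_lintegral _ _
  have l2 : Tendsto (fun j => ∫⁻ x, ‖mollify j g x‖ₑ) atTop (𝓝 (∫⁻ x, ‖g x‖ₑ)) :=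
    tendsto_lintegral_enorm_of_L1
      (fun j => (contDiff_mollify j hg.locallyIntegrable).continuous.aestronglyMeasurable) hg
      (tendsto_mollify_L1 hg)
  simp_rw [h.gradient_mollify] at hj
  exact le_of_tendsto_of_tendsto' l1
    (ENNReal.Tendsto.const_mul l2 (Or.inr ENNReal.ofReal_ne_top)) hj

/-! ### One-sided divergence bounds. -/

/-- The distributional inequality `div b ≤ Λ` on smooth test functions. -/
def DivLE (b : Space n → Space n) (Λ : ℝ) : Prop :=
  ∀ ψ : Space n → ℝ, ContDiff ℝ ∞ ψ → HasCompactSupport ψ → (∀ x, 0 ≤ ψ x) →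
    - ∫ x, inner ℝ (b x) (gradient ψ x) ≤ Λ * ∫ x, ψ x

/-- The inequality `div b ≤ Λ` may be tested with weakly differentiable functions. -/
theorem DivLE.weak {b : Space n → Space n} {Λ : ℝ} (hb : DivLE b Λ)
    (hbm : AEStronglyMeasurable b volume) {v : Space n → ℝ} {g : Space n → Space n}
    (h : HasWeakGradient v g) (hv0 : ∀ x, 0 ≤ v x) (hv : Integrable v) (hg : Integrable g) {R C : ℝ}
    (hbC : ∀ᵐ x, ‖x‖ < R + 1 → ‖b x‖ ≤ C)
    (hR : ∀ x, R ≤ ‖x‖ → v x = 0) (hR' : ∀ x, R ≤ ‖x‖ → g x = 0) :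
    - ∫ x, inner ℝ (b x) (g x) ≤ Λ * ∫ x, v x := by
  have hc : HasCompactSupport v := by
    refine HasCompactSupport.intro (isCompact_closedBall (0 : Space n) R) fun x hx => hR x ?_
    simpa using (not_le.1 (by simpa using hx)).le
  have hj := fun j => hb _ (contDiff_mollify j hv.locallyIntegrable)
    (hasCompactSupport_mollify j hc) fun x => by
      rw [mollify_apply]
      exact integral_nonneg fun z => mul_nonneg (kernel_nonneg j z) (hv0 _)
  simp_rw [h.gradient_mollify] at hj
  have l1 : Tendsto (fun j => ∫ x, mollify j v x) atTop (𝓝 (∫ x, v x)) :=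
    tendsto_integral_of_L1 _ hv.1 (Eventually.of_forall fun j => integrable_mollify j hv)
      (tendsto_mollify_L1 hv)
  -- Mollification widens supports by at most 1; this is why the field is assumed bounded up to
  -- radius `R + 1`.
  have e : ∀ u : Space n → Space n, (∀ x, R + 1 ≤ ‖x‖ → u x = 0) →
      ∫ x, inner ℝ (b x) (u x) = ∫ x in ball (0 : Space n) (R + 1), inner ℝ (b x) (u x) := by
    intro u hu
    rw [setIntegral_eq_integral_of_forall_compl_eq_zero]
    intro x hx
    rw [hu x (by simpa using hx), inner_zero_right]
  have l2 : Tendsto (fun j => ∫ x, inner ℝ (b x) (mollify j g x)) atTop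
      (𝓝 (∫ x, inner ℝ (b x) (g x))) := by
    rw [e g fun x hx => hR' x (by linarith)]
    simp_rw [fun j => e (mollify j g) fun x hx => mollify_eq_zero_of_norm hR' hx]
    exact tendsto_integral_bilin_of_L1 (innerSL ℝ) hbm measurableSet_ball (C := C)
      (by filter_upwards [hbC] with x hx using fun h => hx (by simpa using h)) _ _
      (fun j => (integrable_mollify j hg).integrableOn) hg.integrableOn
      (tendsto_mollify_L1_ball hg.locallyIntegrable _)
  exact le_of_tendsto_of_tendsto' l2.neg (l1.const_mul Λ) hj

/-! ### Truncation above a level. -/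

section Truncation

/-- For exponents at least 2 both one-sided derivatives at the kink vanish, so the power of the
positive part is differentiable. -/
theorem hasDerivAt_posPart_pow {j : ℕ} (hj : 2 ≤ j) (y : ℝ) :
    HasDerivAt (fun y : ℝ => max y 0 ^ j) (j * max y 0 ^ (j - 1)) y := by
  have hj0 : j ≠ 0 := by omega
  have hj1 : j - 1 ≠ 0 := by omega
  rcases lt_trichotomy y 0 with h | h | h
  · rw [max_eq_right h.le, zero_pow hj1, mul_zero]
    refine (hasDerivAt_const y (0 : ℝ)).congr_of_eventuallyEq ?_
    filter_upwards [Iio_mem_nhds h] with z hz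
    rw [max_eq_right (le_of_lt hz), zero_pow hj0]
  · subst h
    rw [max_self, zero_pow hj1, mul_zero, ← hasDerivWithinAt_univ, ← Iic_union_Ici (a := (0 : ℝ))]
    refine HasDerivWithinAt.union ?_ ?_
    · refine (hasDerivWithinAt_const (0 : ℝ) _ (0 : ℝ)).congr (fun z hz => ?_) ?_
      · rw [max_eq_right hz, zero_pow hj0]
      · rw [max_self, zero_pow hj0]
    · have := (hasDerivAt_pow j (0 : ℝ)).hasDerivWithinAt (s := Ici 0)
      rw [zero_pow hj1, mul_zero] at this
      refine this.congr (fun z hz => ?_) ?_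
      · rw [max_eq_left hz]
      · rw [max_self]
  · rw [max_eq_left h.le]
    refine (hasDerivAt_pow j y).congr_of_eventuallyEq ?_
    filter_upwards [Ioi_mem_nhds h] with z hz
    rw [max_eq_left (le_of_lt hz)]

variable {m k : ℝ}

theorem rpow_inv_lt_of_lt (hm : 0 < m) (hk : 0 < k) {s : ℝ} (hs : s < k ^ m) :
    max s 0 ^ (1 / m) < k := by
  have h1 : max s 0 < k ^ m := max_lt hs (by positivity)
  calc max s 0 ^ (1 / m) < (k ^ m) ^ (1 / m) :=
        Real.rpow_lt_rpow (le_max_right _ _) h1 (by positivity)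
    _ = k := by rw [← Real.rpow_mul hk.le, mul_one_div_cancel hm.ne', Real.rpow_one]

/-- The function `s ↦ (s^{1/m} - k)₊ ^ j` is continuously differentiable. -/
theorem hasDerivAt_excess_pow (hm : 0 < m) (hk : 0 < k) {j : ℕ} (hj : 2 ≤ j) (s : ℝ) :
    HasDerivAt (fun s : ℝ => max (max s 0 ^ (1 / m) - k) 0 ^ j)
      (j * max (max s 0 ^ (1 / m) - k) 0 ^ (j - 1) * (1 / m * max s 0 ^ (1 / m - 1))) s := by
  by_cases h : s < k ^ m
  · have h0 : ∀ z < k ^ m, max (max z 0 ^ (1 / m) - k) 0 = 0 := fun z hz =>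
      max_eq_right (by linarith [rpow_inv_lt_of_lt hm hk hz])
    rw [h0 s h, zero_pow (by omega : j - 1 ≠ 0), mul_zero, zero_mul]
    refine (hasDerivAt_const s (0 : ℝ)).congr_of_eventuallyEq ?_
    filter_upwards [Iio_mem_nhds h] with z hz
    rw [h0 z hz, zero_pow (by omega)]
  · have hs : 0 < s := lt_of_lt_of_le (by positivity) (not_lt.1 h)
    have h1 : HasDerivAt (fun s : ℝ => max s 0 ^ (1 / m) - k) (1 / m * max s 0 ^ (1 / m - 1)) s := by
      rw [max_eq_left hs.le]
      refine ((Real.hasDerivAt_rpow_const (p := 1 / m) (Or.inl hs.ne')).sub_const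
        k).congr_of_eventuallyEq ?_
      filter_upwards [Ioi_mem_nhds hs] with z hz
      rw [max_eq_left (le_of_lt hz)]
    exact (hasDerivAt_posPart_pow hj _).comp s h1

/-- The factor `s^(1/m - 1)` is singular at `0` when `m > 1`, but the truncation vanishes for `s <
k^m`, and `k > 0` keeps this away from `0`. -/
theorem continuous_excess_deriv (hm : 0 < m) (hk : 0 < k) {j : ℕ} (hj : 2 ≤ j) :
    Continuous fun s : ℝ =>
      j * max (max s 0 ^ (1 / m) - k) 0 ^ (j - 1) * (1 / m * max s 0 ^ (1 / m - 1)) := by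
  refine continuous_iff_continuousAt.2 fun s => ?_
  by_cases h : s < k ^ m
  · refine ContinuousAt.congr (continuousAt_const (y := (0 : ℝ))) ?_
    filter_upwards [Iio_mem_nhds h] with z hz
    rw [max_eq_right (b := (0 : ℝ)) (a := max z 0 ^ (1 / m) - k)
      (by linarith [rpow_inv_lt_of_lt hm hk hz]), zero_pow (by omega), mul_zero, zero_mul]
  · have hs : 0 < s := lt_of_lt_of_le (by positivity) (not_lt.1 h)
    have h2 : ∀ p : ℝ, ContinuousAt (fun s : ℝ => max s 0 ^ p) s := fun p =>
      (continuous_id.max continuous_const).continuousAt.rpow_const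
        (Or.inl (lt_max_of_lt_left hs).ne')
    exact (continuousAt_const.mul ((((h2 _).sub continuousAt_const).max
      continuousAt_const).pow _)).mul (continuousAt_const.mul (h2 _))

variable {n : ℕ}

/-- The excess `(r - k)₊` of a density over the level `k`. -/
noncomputable def excess (k : ℝ) (r : Space n → ℝ) (x : Space n) : ℝ := max (r x - k) 0

/-- The gradient of the excess, expressed through the gradient `V` of `r ^ m`. -/
noncomputable def excessGradient (m k : ℝ) (r : Space n → ℝ) (V : Space n → Space n)
    (x : Space n) : Space n :=
  if k < r x then (1 / m * r x ^ (1 - m)) • V x else 0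

theorem excess_nonneg (k : ℝ) (r : Space n → ℝ) (x : Space n) : 0 ≤ excess k r x := le_max_right _ _

theorem excess_of_le {r : Space n → ℝ} {x : Space n} (h : r x ≤ k) : excess k r x = 0 :=
  max_eq_right (by linarith)

theorem excess_of_lt {r : Space n → ℝ} {x : Space n} (h : k < r x) : excess k r x = r x - k :=
  max_eq_left (by linarith)

/-- Only `r ^ m` is assumed to be weakly differentiable. The excess power is a `C¹` function of it,
since `r = (r ^ m)^(1/m)`, and the chain rule for bounded functions applies. -/
theorem hasWeakGradient_excess_pow (hm : 0 < m) (hk : 0 < k) {j : ℕ} (hj : 2 ≤ j)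
    {r : Space n → ℝ} {S : ℝ} (hr : ∀ x, r x ∈ Icc 0 S) {V : Space n → Space n}
    (h : HasWeakGradient (fun x => r x ^ m) V) :
    HasWeakGradient (fun x => excess k r x ^ j)
      fun x => (j * excess k r x ^ (j - 1)) • excessGradient m k r V x := by
  have key := h.comp (a := 0) (b := S ^ m) (Eventually.of_forall fun x =>
    ⟨Real.rpow_nonneg (hr x).1 _, Real.rpow_le_rpow (hr x).1 (hr x).2 hm.le⟩)
    (hasDerivAt_excess_pow hm hk hj) (continuous_excess_deriv hm hk hj)
  have e0 : ∀ x, max (r x ^ m) 0 = r x ^ m := fun x => max_eq_left (Real.rpow_nonneg (hr x).1 _)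
  have e1 : ∀ x, (r x ^ m) ^ (1 / m) = r x := fun x => by
    rw [← Real.rpow_mul (hr x).1, mul_one_div_cancel hm.ne', Real.rpow_one]
  have e2 : ∀ x, (r x ^ m) ^ (1 / m - 1) = r x ^ (1 - m) := fun x => by
    rw [← Real.rpow_mul (hr x).1, mul_sub, mul_one_div_cancel hm.ne', mul_one]
  simp only [e0, e1, e2] at key
  refine key.congr (ae_eq_refl _) (Eventually.of_forall fun x => ?_)
  change _ = (j * excess k r x ^ (j - 1)) • excessGradient m k r V x
  simp only [excessGradient]
  split_ifs with hx
  · rw [smul_smul]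
    rfl
  · rw [max_eq_right (by linarith), zero_pow (by omega)]
    simp

end Truncation

/-! ### Spatial cutoffs. -/

section Cutoff

variable {n : ℕ}

/-- A smooth cutoff function between the balls of radii `R` and `2 R`. -/
structure IsCutoff (R c : ℝ) (ζ : Space n → ℝ) : Prop where
  smooth : ContDiff ℝ ∞ ζ
  mem_Icc : ∀ x, ζ x ∈ Icc (0 : ℝ) 1
  eq_one : ∀ x, ‖x‖ ≤ R → ζ x = 1
  eq_zero : ∀ x, 2 * R ≤ ‖x‖ → ζ x = 0
  norm_gradient_le : ∀ x, ‖gradient ζ x‖ ≤ c / R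
  gradient_eq_zero : ∀ x, ‖x‖ < R → gradient ζ x = 0
  gradient_eq_zero' : ∀ x, 2 * R ≤ ‖x‖ → gradient ζ x = 0

theorem exists_isCutoff (n : ℕ) : ∃ c : ℝ, 0 ≤ c ∧ ∀ R : ℝ, 1 ≤ R →
    ∃ ζ : Space n → ℝ, IsCutoff R c ζ := by
  -- The outer radius `3 / 2`, smaller than 2, makes the rescaled function vanish near the sphere of
  -- radius `2 R`, so its gradient is zero there too.
  let f : ContDiffBump (0 : Space n) := ⟨1, 3 / 2, by norm_num, by norm_num⟩
  have hf : ContDiff ℝ ∞ f := f.contDiff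
  have hf1 : ContDiff ℝ 1 f := f.contDiff
  obtain ⟨c, hc⟩ := (continuous_gradient hf1).bounded_above_of_compact_support
    (hasCompactSupport_gradient f.hasCompactSupport)
  refine ⟨c, (norm_nonneg _).trans (hc 0), fun R hR => ⟨fun x => f (R⁻¹ • x), ?_⟩⟩
  have hR0 : 0 < R := by linarith
  have hg : ∀ x, gradient (fun x => f (R⁻¹ • x)) x = R⁻¹ • gradient f (R⁻¹ • x) := fun x => by
    refine ext_inner_right ℝ fun v => ?_
    have e : fderiv ℝ (fun x => f (R⁻¹ • x)) x = _ :=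
      ((hf1.differentiable one_ne_zero (R⁻¹ • x)).hasFDerivAt.comp x
        ((hasFDerivAt_id x).const_smul R⁻¹)).fderiv
    rw [inner_smul_left, inner_gradient, inner_gradient, e]
    simp
  have hn : ∀ x : Space n, ‖R⁻¹ • x‖ = ‖x‖ / R := fun x => by
    rw [norm_smul, norm_inv, Real.norm_of_nonneg hR0.le, inv_mul_eq_div]
  have hloc : ∀ (x : Space n) (a : ℝ), f =ᶠ[𝓝 x] (fun _ => a) → gradient f x = 0 := fun x a h => by
    rw [h.gradient_eq]
    exact gradient_const x a
  refine ⟨hf.comp (contDiff_const_smul _), fun x => ⟨f.nonneg, f.le_one⟩, ?_, ?_, ?_, ?_, ?_⟩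
  · intro x hx
    refine f.one_of_mem_closedBall ?_
    rw [mem_closedBall_zero_iff, hn]
    exact (div_le_one hR0).2 hx
  · intro x hx
    refine f.zero_of_le_dist ?_
    rw [dist_zero_right, hn]
    change 3 / 2 ≤ _
    rw [le_div_iff₀ hR0]
    linarith
  · intro x
    rw [hg, norm_smul, norm_inv, Real.norm_of_nonneg hR0.le, inv_mul_eq_div]
    gcongr
    exact hc _
  · intro x hx
    rw [hg, hloc _ 1, smul_zero]
    refine f.eventuallyEq_one_of_mem_ball ?_
    rw [mem_ball_zero_iff, hn]
    exact (div_lt_one hR0).2 hx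
  · intro x hx
    rw [hg, hloc _ 0, smul_zero]
    have h2 : (3 : ℝ) / 2 < ‖R⁻¹ • x‖ := by
      rw [hn, lt_div_iff₀ hR0]
      linarith
    filter_upwards [(isOpen_lt continuous_const continuous_norm).mem_nhds h2] with y hy
    refine f.zero_of_le_dist ?_
    rw [dist_zero_right]
    exact le_of_lt hy

end Cutoff

/-! ### The energy estimate on a time slice. -/

variable {n : ℕ}

/-- A time slice of a solution: a bounded integrable density `r`, the weak gradient `V` of `r ^ m`
and a drift `b` of at most linear growth whose divergence is bounded from above. -/
structure IsSlice (m S M L Λ : ℝ) (r : Space n → ℝ) (V b : Space n → Space n) : Prop where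
  measurable : Measurable r
  mem_Icc : ∀ x, r x ∈ Icc 0 S
  integrable : Integrable r
  mass : ∫ x, r x ≤ M
  weak : HasWeakGradient (fun x => r x ^ m) V
  sq : ∀ R : ℝ, MemLp V 2 (volume.restrict (ball 0 R))
  drift_measurable : AEStronglyMeasurable b volume
  growth : ∀ᵐ x, ‖b x‖ ≤ L * (1 + ‖x‖)
  div : DivLE b Λ

/-- The weak gradient of `ζ² (r - k)₊²`. -/
noncomputable def testGradient (m k : ℝ) (ζ r : Space n → ℝ) (V : Space n → Space n)
    (x : Space n) : Space n :=
  (2 * ζ x ^ 2 * excess k r x) • excessGradient m k r V x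
    + (2 * ζ x * excess k r x ^ 2) • gradient ζ x

section

variable {m k S M L Λ c0 c1 R c : ℝ} {ζ r : Space n → ℝ} {V b : Space n → Space n}

theorem excess_mem_Icc (hk : 0 < k) (hr : ∀ x, r x ∈ Icc 0 S) (x : Space n) :
    excess k r x ∈ Icc 0 (r x) :=
  ⟨excess_nonneg _ _ _, max_le (by linarith) (hr x).1⟩

/-- The relation `∇(r ^ m) = m r^(m-1) ∇r` on `{k < r}`, which exhibits the diffusion coefficient
multiplying the gradient of the excess. -/
theorem eq_smul_excessGradient (hm : 0 < m) (hk : 0 < k) {x : Space n} (hx : k < r x) :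
    V x = (m * r x ^ (m - 1)) • excessGradient m k r V x := by
  rw [excessGradient, if_pos hx, smul_smul]
  have h0 : 0 < r x := hk.trans hx
  have : m * r x ^ (m - 1) * (1 / m * r x ^ (1 - m)) = 1 := by
    calc _ = (m * (1 / m)) * (r x ^ (m - 1) * r x ^ (1 - m)) := by ring
      _ = 1 := by
        rw [mul_one_div_cancel hm.ne', ← Real.rpow_add h0]
        simp
  rw [this, one_smul]

/-- Between the levels `k` and `S` the diffusion coefficient is at least `c0`, so the gradient of
the excess inherits the square integrability of `V`. -/
theorem norm_excessGradient_le (hm : 0 < m) (hk : 0 < k) (hr : ∀ x, r x ∈ Icc 0 S) (hc0 : 0 < c0)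
    (ha : ∀ ρ, k ≤ ρ → ρ ≤ S → c0 ≤ m * ρ ^ (m - 1)) (x : Space n) :
    ‖excessGradient m k r V x‖ ≤ ‖V x‖ / c0 := by
  rw [le_div_iff₀ hc0]
  by_cases hx : k < r x
  · have h1 := ha _ hx.le (hr x).2
    conv_rhs => rw [eq_smul_excessGradient (V := V) hm hk hx]
    rw [norm_smul, Real.norm_of_nonneg (hc0.le.trans h1), mul_comm]
    gcongr
  · rw [excessGradient, if_neg hx, norm_zero, zero_mul]
    exact norm_nonneg _

theorem measurable_excess (hr : Measurable r) : Measurable (excess k r) :=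
  (hr.sub_const k).max measurable_const

theorem aestronglyMeasurable_excessGradient (hr : Measurable r)
    (hV : AEStronglyMeasurable V volume) :
    AEStronglyMeasurable (excessGradient m k r V) volume := by
  have : excessGradient m k r V = {x | k < r x}.indicator
      fun x => (1 / m * r x ^ (1 - m)) • V x := by
    ext1 x
    simp [excessGradient, indicator_apply]
  rw [this]
  exact (((hr.pow_const _).const_mul _).aestronglyMeasurable.smul hV).indicator
    (measurableSet_lt measurable_const hr)

theorem aestronglyMeasurable_testGradient (hr : Measurable r) (hζ : IsCutoff R c ζ)
    (hV : AEStronglyMeasurable V volume) :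
    AEStronglyMeasurable (testGradient m k ζ r V) volume := by
  have hζm := hζ.smooth.continuous.measurable
  have hu := measurable_excess (k := k) hr
  exact ((((hζm.pow_const 2).const_mul 2).mul hu).aestronglyMeasurable.smul
    (aestronglyMeasurable_excessGradient hr hV)).add
    (((hζm.const_mul 2).mul (hu.pow_const 2)).aestronglyMeasurable.smul
      (continuous_gradient (hζ.smooth.of_le (by simp))).aestronglyMeasurable)

theorem testGradient_eq_zero (hζ : IsCutoff R c ζ) {x : Space n} (hx : 2 * R ≤ ‖x‖) :
    testGradient m k ζ r V x = 0 := by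
  simp [testGradient, hζ.eq_zero x hx]

theorem norm_testGradient_le (hm : 0 < m) (hk : 0 < k) (hr : ∀ x, r x ∈ Icc 0 S) (hc0 : 0 < c0)
    (ha : ∀ ρ, k ≤ ρ → ρ ≤ S → c0 ≤ m * ρ ^ (m - 1)) (hζ : IsCutoff R c ζ) (x : Space n) :
    ‖testGradient m k ζ r V x‖ ≤ 2 * S / c0 * ‖V x‖ + 2 * S ^ 2 * (c / R) := by
  have hu := excess_mem_Icc hk hr x
  have hS := (hr x).1.trans (hr x).2
  have huS : excess k r x ≤ S := hu.2.trans (hr x).2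
  have hz := hζ.mem_Icc x
  have hz2 : ζ x ^ 2 ≤ 1 := pow_le_one₀ hz.1 hz.2
  refine (norm_add_le _ _).trans (add_le_add ?_ ?_)
  · rw [norm_smul, Real.norm_of_nonneg (mul_nonneg (by positivity) hu.1)]
    calc 2 * ζ x ^ 2 * excess k r x * ‖excessGradient m k r V x‖
        ≤ 2 * 1 * S * (‖V x‖ / c0) := by
          gcongr
          · exact hu.1
          · exact norm_excessGradient_le hm hk hr hc0 ha x
      _ = _ := by ring
  · rw [norm_smul, Real.norm_of_nonneg (mul_nonneg (by linarith [hz.1]) (by positivity))]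
    calc 2 * ζ x * excess k r x ^ 2 * ‖gradient ζ x‖ ≤ 2 * 1 * S ^ 2 * (c / R) := by
          gcongr
          · exact hz.2
          · exact hu.1
          · exact hζ.norm_gradient_le x
      _ = _ := by ring

/-- `ζ² (r - k)₊ ^ j` is weakly differentiable. -/
theorem hasWeakGradient_cutoff_excess_pow (hm : 0 < m) (hk : 0 < k) {j : ℕ} (hj : 2 ≤ j)
    (hr : ∀ x, r x ∈ Icc 0 S) (hV : HasWeakGradient (fun x => r x ^ m) V) (hζ : IsCutoff R c ζ) :
    HasWeakGradient (fun x => ζ x ^ 2 * excess k r x ^ j) fun x =>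
      (j * ζ x ^ 2 * excess k r x ^ (j - 1)) • excessGradient m k r V x
        + (2 * ζ x * excess k r x ^ j) • gradient ζ x := by
  have h := (hasWeakGradient_excess_pow hm hk hj hr hV).smul_contDiff (hζ.smooth.pow 2)
  refine h.congr (ae_eq_refl _) (Eventually.of_forall fun x => ?_)
  have hd : DifferentiableAt ℝ ζ x := hζ.smooth.differentiable (by simp) x
  have hg : gradient (fun x => ζ x ^ 2) x = (2 * ζ x) • gradient ζ x := by
    have := gradient_comp (hasDerivAt_pow 2 (ζ x)) hd
    simpa using this
  change ζ x ^ 2 • (j * excess k r x ^ (j - 1)) • excessGradient m k r V x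
    + excess k r x ^ j • gradient (fun x => ζ x ^ 2) x = _
  rw [hg]
  module

theorem HasWeakGradient.add {w₁ w₂ : Space n → ℝ} {g₁ g₂ : Space n → Space n}
    (h₁ : HasWeakGradient w₁ g₁) (h₂ : HasWeakGradient w₂ g₂) :
    HasWeakGradient (fun x => w₁ x + w₂ x) fun x => g₁ x + g₂ x := by
  refine ⟨h₁.1.add h₂.1, h₁.2.1.add h₂.2.1, fun ψ h1 h2 => ?_⟩
  have hψ1 : ContDiff ℝ 1 ψ := h1.of_le (by simp)
  have i : ∀ {w : Space n → ℝ}, LocallyIntegrable w volume →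
      Integrable fun x => w x • gradient ψ x := fun hw =>
    hw.integrable_smul_right_of_hasCompactSupport (continuous_gradient hψ1)
      (hasCompactSupport_gradient h2)
  have i' : ∀ {g : Space n → Space n}, LocallyIntegrable g volume →
      Integrable fun x => ψ x • g x := fun hg =>
    hg.integrable_smul_left_of_hasCompactSupport hψ1.continuous h2
  simp_rw [add_smul, smul_add]
  rw [integral_add (i h₁.1) (i h₂.1), integral_add (i' h₁.2.1) (i' h₂.2.1), h₁.2.2 ψ h1 h2,
    h₂.2.2 ψ h1 h2]
  abel

theorem HasWeakGradient.const_mul {w : Space n → ℝ} {g : Space n → Space n}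
    (h : HasWeakGradient w g) (a : ℝ) :
    HasWeakGradient (fun x => a * w x) fun x => a • g x := by
  refine ⟨h.1.smul a, h.2.1.smul a, fun ψ h1 h2 => ?_⟩
  simp_rw [smul_comm _ a, mul_smul]
  rw [integral_smul, integral_smul, h.2.2 ψ h1 h2, smul_neg]

/-- The function `ζ² P` with `P = (2/3) (r - k)₊³ + k (r - k)₊²`, for which
`∇P = 2 r (r - k)₊ ∇r`. -/
noncomputable def pressure (k : ℝ) (ζ r : Space n → ℝ) (x : Space n) : ℝ :=
  2 / 3 * (ζ x ^ 2 * excess k r x ^ 3) + k * (ζ x ^ 2 * excess k r x ^ 2)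

/-- The weak gradient of the pressure. -/
noncomputable def pressureGradient (m k : ℝ) (ζ r : Space n → ℝ) (V : Space n → Space n)
    (x : Space n) : Space n :=
  (2 * ζ x ^ 2 * (excess k r x * r x)) • excessGradient m k r V x
    + (2 * ζ x * (2 / 3 * excess k r x ^ 3 + k * excess k r x ^ 2)) • gradient ζ x

theorem hasWeakGradient_pressure (hm : 0 < m) (hk : 0 < k)
    (hr : ∀ x, r x ∈ Icc 0 S) (hV : HasWeakGradient (fun x => r x ^ m) V) (hζ : IsCutoff R c ζ) :
    HasWeakGradient (pressure k ζ r) (pressureGradient m k ζ r V) := by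
  have h3 := hasWeakGradient_cutoff_excess_pow hm hk (j := 3) (by norm_num) hr hV hζ
  have h2 := hasWeakGradient_cutoff_excess_pow hm hk (j := 2) le_rfl hr hV hζ
  refine ((h3.const_mul (2 / 3)).add (h2.const_mul k)).congr (ae_eq_refl _)
    (Eventually.of_forall fun x => ?_)
  simp only [pressureGradient, Nat.cast_ofNat, Nat.reduceSub, pow_one]
  by_cases hx : k < r x
  · rw [excess_of_lt hx]
    module
  · rw [excess_of_le (not_lt.1 hx)]
    module

theorem pressure_bounds (hk : 0 < k) (hr : ∀ x, r x ∈ Icc 0 S) (hζ : IsCutoff R c ζ)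
    (x : Space n) : pressure k ζ r x ∈ Icc 0 ({x | k < r x}.indicator (fun _ => S ^ 3) x) := by
  have hu := excess_mem_Icc hk hr x
  have hz := hζ.mem_Icc x
  have hz2 : ζ x ^ 2 ≤ 1 := pow_le_one₀ hz.1 hz.2
  refine ⟨?_, ?_⟩
  · have := hu.1
    rw [pressure]
    positivity
  by_cases hx : k < r x
  · rw [indicator_of_mem (by exact hx)]
    have e : excess k r x = r x - k := excess_of_lt hx
    have h0 : 0 < r x := hk.trans hx
    -- With `r = excess + k` on the level set, `(2/3) excess + k ≤ r`.
    calc pressure k ζ r x = ζ x ^ 2 * (excess k r x ^ 2 * (2 / 3 * excess k r x + k)) := by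
          rw [pressure]; ring
      _ ≤ 1 * (r x ^ 2 * r x) := by
          have h1 := hu.1
          have h2 := hu.2
          have h3 : 2 / 3 * excess k r x + k ≤ r x := by linarith
          gcongr
      _ ≤ S ^ 3 := by
          rw [one_mul, ← pow_succ]
          gcongr
          exact (hr x).2
  · rw [indicator_of_notMem (by exact hx), pressure, excess_of_le (not_lt.1 hx)]
    norm_num

/-- The drift pairs with `r` times the test gradient. This is an exact gradient, on which the bound
on `div b` acts, up to a term carrying `∇ζ`, which disappears as the cutoff is removed. -/
theorem testGradient_smul_eq (x : Space n) :
    r x • testGradient m k ζ r V x = pressureGradient m k ζ r V x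
      + (2 * ζ x * (r x * excess k r x ^ 2
        - (2 / 3 * excess k r x ^ 3 + k * excess k r x ^ 2))) • gradient ζ x := by
  rw [testGradient, pressureGradient]
  module

/-- On `{k < r}` one has `r = excess + k`, and the expression collapses to `excess³ / 3`. The factor
`r` kept in the upper bound lets the error be measured by mass. -/
theorem residual_bounds (hk : 0 < k) (hr : ∀ x, r x ∈ Icc 0 S) (x : Space n) :
    r x * excess k r x ^ 2 - (2 / 3 * excess k r x ^ 3 + k * excess k r x ^ 2)
      ∈ Icc 0 (S ^ 2 * r x) := by
  have hu := excess_mem_Icc hk hr x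
  have huS : excess k r x ≤ S := hu.2.trans (hr x).2
  have h2 : excess k r x ^ 2 ≤ S ^ 2 := pow_le_pow_left₀ hu.1 huS 2
  by_cases hx : k < r x
  · have e : r x = excess k r x + k := by rw [excess_of_lt hx]; ring
    constructor
    · have : r x * excess k r x ^ 2 - (2 / 3 * excess k r x ^ 3 + k * excess k r x ^ 2)
        = 1 / 3 * excess k r x ^ 3 := by
        linear_combination excess k r x ^ 2 * e
      rw [this]
      have := hu.1
      positivity
    · have h3 : 0 ≤ 2 / 3 * excess k r x ^ 3 + k * excess k r x ^ 2 := by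
        have := hu.1
        positivity
      nlinarith [mul_le_mul_of_nonneg_left h2 (hr x).1]
  · rw [excess_of_le (not_lt.1 hx)]
    have := (hr x).1
    norm_num
    positivity

/-- The diffusive part of the energy estimate. -/
theorem inner_testGradient_ge (hm : 0 < m) (hk : 0 < k) (hr : ∀ x, r x ∈ Icc 0 S) (hc0 : 0 < c0)
    (hc1 : 0 ≤ c1)
    (ha : ∀ ρ, k ≤ ρ → ρ ≤ S → c0 ≤ m * ρ ^ (m - 1) ∧ m * ρ ^ (m - 1) ≤ c1)
    (hζ : IsCutoff R c ζ) (x : Space n) :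
    c0 * (ζ x ^ 2 * excess k r x * ‖excessGradient m k r V x‖ ^ 2)
      - c1 * S ^ 2 * (c / R) ^ 2 * r x ≤ inner ℝ (testGradient m k ζ r V x) (V x) := by
  have hu := excess_mem_Icc hk hr x
  have huS : excess k r x ≤ S := hu.2.trans (hr x).2
  have hz := hζ.mem_Icc x
  by_cases hx : k < r x
  · obtain ⟨a0, a1⟩ := ha _ hx.le (hr x).2
    set a := m * r x ^ (m - 1) with ha_def
    set q := excessGradient m k r V x
    set u := excess k r x
    have hV : V x = a • q := eq_smul_excessGradient hm hk hx
    have h1 : |inner ℝ (gradient ζ x) q| ≤ c / R * ‖q‖ :=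
      (abs_real_inner_le_norm _ _).trans (by gcongr; exact hζ.norm_gradient_le x)
    have h2 := (abs_le.1 h1).1
    have e : inner ℝ (testGradient m k ζ r V x) (V x) =
        a * (2 * ζ x ^ 2 * u * ‖q‖ ^ 2 + 2 * ζ x * u ^ 2 * inner ℝ (gradient ζ x) q) := by
      rw [hV, testGradient, inner_add_left, inner_smul_left, inner_smul_left, inner_smul_right,
        inner_smul_right, real_inner_self_eq_norm_sq]
      simp only [conj_trivial]
      ring
    have h3 : 2 * ζ x * u ^ 2 * -(c / R * ‖q‖) ≤ 2 * ζ x * u ^ 2 * inner ℝ (gradient ζ x) q :=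
      mul_le_mul_of_nonneg_left h2 (mul_nonneg (by linarith [hz.1]) (by positivity))
    -- Completing this square absorbs the cross term with `∇ζ` into half of the gradient term,
    -- leaving an error `u³ (c / R)²`.
    have h4 : 0 ≤ u * (ζ x * ‖q‖ - u * (c / R)) ^ 2 := mul_nonneg hu.1 (sq_nonneg _)
    have h5 : ζ x ^ 2 * u * ‖q‖ ^ 2 - u ^ 3 * (c / R) ^ 2 ≤
        2 * ζ x ^ 2 * u * ‖q‖ ^ 2 + 2 * ζ x * u ^ 2 * inner ℝ (gradient ζ x) q := by
      nlinarith
    have h6 : u ^ 3 * (c / R) ^ 2 ≤ S ^ 2 * (c / R) ^ 2 * r x := by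
      calc u ^ 3 * (c / R) ^ 2 = u ^ 2 * u * (c / R) ^ 2 := by ring
        _ ≤ S ^ 2 * r x * (c / R) ^ 2 := by
          have := hu.1
          gcongr
          exact hu.2
        _ = _ := by ring
    have hD : 0 ≤ ζ x ^ 2 * u * ‖q‖ ^ 2 := by have := hu.1; positivity
    have h7 : 0 ≤ S ^ 2 * (c / R) ^ 2 * r x := by have := (hr x).1; positivity
    rw [e]
    have ha0 : 0 < a := hc0.trans_le a0
    -- The coefficient `a` is bounded below in front of the dissipation and above in front of the
    -- error.
    calc c0 * (ζ x ^ 2 * u * ‖q‖ ^ 2) - c1 * S ^ 2 * (c / R) ^ 2 * r x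
        ≤ a * (ζ x ^ 2 * u * ‖q‖ ^ 2) - a * (S ^ 2 * (c / R) ^ 2 * r x) := by
          nlinarith [mul_le_mul_of_nonneg_right a0 hD, mul_le_mul_of_nonneg_right a1 h7]
      _ = a * (ζ x ^ 2 * u * ‖q‖ ^ 2 - S ^ 2 * (c / R) ^ 2 * r x) := by ring
      _ ≤ _ := by
          refine mul_le_mul_of_nonneg_left ?_ ha0.le
          linarith
  · have e : excess k r x = 0 := excess_of_le (not_lt.1 hx)
    have hS := (hr x).1
    have hc1 : 0 ≤ c1 * S ^ 2 * (c / R) ^ 2 * r x := by positivity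
    simp only [testGradient, e]
    norm_num
    exact hc1

/-- The integrands of the energy estimate are supported in the ball of radius `2 R`, where `1 +
‖V‖²` is integrable; a pointwise bound by a multiple of it is enough. -/
theorem IsSlice.integrable_of_le (h : IsSlice m S M L Λ r V b) {F : Type*} [NormedAddCommGroup F]
    {f : Space n → F} (hf : AEStronglyMeasurable f volume) {K : ℝ}
    (h0 : ∀ x, 2 * R ≤ ‖x‖ → f x = 0) (hK : ∀ᵐ x, ‖x‖ < 2 * R → ‖f x‖ ≤ K * (1 + ‖V x‖ ^ 2)) :
    Integrable f := by
  rw [← integrableOn_iff_integrable_of_support_subset (s := ball 0 (2 * R))]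
  · have hV := (memLp_two_iff_integrable_sq_norm (h.sq (2 * R)).1).1 (h.sq (2 * R))
    have h1 : Integrable (fun _ : Space n => (1 : ℝ)) (volume.restrict (ball 0 (2 * R))) :=
      integrableOn_const measure_ball_lt_top.ne
    refine Integrable.mono' ((h1.add hV).const_mul K) hf.restrict ?_
    filter_upwards [ae_restrict_of_ae hK, ae_restrict_mem measurableSet_ball] with x hx hx'
    exact hx (by simpa using hx')
  · intro x hx
    by_contra hx'
    exact hx (h0 x (by simpa using hx'))

theorem le_one_add_sq (y : ℝ) : y ≤ 1 + y ^ 2 := by nlinarith [sq_nonneg (y - 1)]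

theorem IsSlice.integrable_dissipation (h : IsSlice m S M L Λ r V b) (hm : 0 < m) (hk : 0 < k)
    (hc0 : 0 < c0) (ha : ∀ ρ, k ≤ ρ → ρ ≤ S → c0 ≤ m * ρ ^ (m - 1)) (hζ : IsCutoff R c ζ) :
    Integrable fun x => ζ x ^ 2 * excess k r x * ‖excessGradient m k r V x‖ ^ 2 := by
  have hζm := hζ.smooth.continuous.measurable
  have hu := measurable_excess (k := k) h.measurable
  have hVm := h.weak.2.1.aestronglyMeasurable
  refine h.integrable_of_le (R := R) (K := S / c0 ^ 2) (((hζm.pow_const 2).mul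
    hu).aestronglyMeasurable.mul
    ((aestronglyMeasurable_excessGradient h.measurable hVm).norm.pow 2))
    (fun x hx => by simp [hζ.eq_zero x hx]) (Eventually.of_forall fun x _ => ?_)
  have hu := excess_mem_Icc hk h.mem_Icc x
  have huS : excess k r x ≤ S := hu.2.trans (h.mem_Icc x).2
  have hz := hζ.mem_Icc x
  have hz2 : ζ x ^ 2 ≤ 1 := pow_le_one₀ hz.1 hz.2
  have hu1 := hu.1
  have hS : 0 ≤ S := hu1.trans huS
  have hq := norm_excessGradient_le (V := V) hm hk h.mem_Icc hc0 ha x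
  rw [Real.norm_of_nonneg (by positivity)]
  calc ζ x ^ 2 * excess k r x * ‖excessGradient m k r V x‖ ^ 2
      ≤ 1 * S * (‖V x‖ / c0) ^ 2 := by gcongr
    _ = S / c0 ^ 2 * ‖V x‖ ^ 2 := by ring
    _ ≤ _ := by gcongr; linarith

/-- The Sobolev part of the energy estimate. -/
theorem IsSlice.integral_le_dissipation (hn : 2 ≤ n) (h : IsSlice m S M L Λ r V b) (hm : 0 < m)
    (hk : 0 < k) (hc0 : 0 < c0) (ha : ∀ ρ, k ≤ ρ → ρ ≤ S → c0 ≤ m * ρ ^ (m - 1))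
    (hζ : IsCutoff R c ζ) {μ : ℝ} (hμ : 0 ≤ μ) (hsμ : volume {x | k < r x} ≤ ENNReal.ofReal μ)
    {σ : ℝ} (hσ : sobolevConst n * μ ^ (1 / (n : ℝ)) ≤ σ) :
    ∫ x, ζ x ^ 2 * excess k r x ^ 3 ≤
      9 * σ ^ 2 * (∫ x, ζ x ^ 2 * excess k r x * ‖excessGradient m k r V x‖ ^ 2)
        + 4 * σ * S ^ 2 * (c / R) * M := by
  have hσ0 : 0 ≤ σ := le_trans (mul_nonneg (sobolevConst_nonneg n) (by positivity)) hσ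
  have hζm := hζ.smooth.continuous.measurable
  have hum := measurable_excess (k := k) h.measurable
  have hVm := h.weak.2.1.aestronglyMeasurable
  have hqm := aestronglyMeasurable_excessGradient (m := m) (k := k) h.measurable hVm
  have hw := hasWeakGradient_cutoff_excess_pow hm hk (j := 3) (by norm_num) h.mem_Icc h.weak hζ
  set v := fun x => ζ x ^ 2 * excess k r x ^ 3 with hv
  set g := fun x => ((3 : ℕ) * ζ x ^ 2 * excess k r x ^ (3 - 1)) • excessGradient m k r V x
        + (2 * ζ x * excess k r x ^ 3) • gradient ζ x with hg
  have hS0 : 0 ≤ S := (h.mem_Icc 0).1.trans (h.mem_Icc 0).2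
  have basic : ∀ x, 0 ≤ excess k r x ∧ excess k r x ≤ S ∧ excess k r x ≤ r x ∧ 0 ≤ ζ x ∧ ζ x ≤ 1 ∧
      ζ x ^ 2 ≤ 1 := fun x => by
    have hu := excess_mem_Icc hk h.mem_Icc x
    have hz := hζ.mem_Icc x
    exact ⟨hu.1, hu.2.trans (h.mem_Icc x).2, hu.2, hz.1, hz.2, pow_le_one₀ hz.1 hz.2⟩
  have hgx : ∀ x, ‖g x‖ ≤ 3 * (ζ x ^ 2 * excess k r x ^ 2 * ‖excessGradient m k r V x‖)
      + 2 * S ^ 2 * (c / R) * r x := fun x => by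
    obtain ⟨b1, b2, b3, b4, b5, b6⟩ := basic x
    refine (norm_add_le _ _).trans (add_le_add (le_of_eq ?_) ?_)
    · rw [norm_smul, Real.norm_of_nonneg (by positivity)]
      norm_num
      ring
    · rw [norm_smul, Real.norm_of_nonneg (by positivity)]
      have hcR : 0 ≤ c / R := (norm_nonneg _).trans (hζ.norm_gradient_le x)
      have hr0 := (h.mem_Icc x).1
      calc 2 * ζ x * excess k r x ^ 3 * ‖gradient ζ x‖
          = 2 * ζ x * (excess k r x ^ 2 * excess k r x) * ‖gradient ζ x‖ := by ring
        _ ≤ 2 * 1 * (S ^ 2 * r x) * (c / R) := by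
          gcongr
          exact hζ.norm_gradient_le x
        _ = _ := by ring
  have hvi : Integrable v := by
    refine h.integrable_of_le (R := R) (K := S ^ 3)
      ((hζm.pow_const 2).mul (hum.pow_const 3)).aestronglyMeasurable
      (fun x hx => by simp [hv, hζ.eq_zero x hx]) (Eventually.of_forall fun x _ => ?_)
    obtain ⟨b1, b2, b3, b4, b5, b6⟩ := basic x
    rw [Real.norm_of_nonneg (by positivity)]
    calc ζ x ^ 2 * excess k r x ^ 3 ≤ 1 * S ^ 3 := by gcongr
      _ ≤ S ^ 3 * (1 + ‖V x‖ ^ 2) := by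
        have : 0 ≤ S ^ 3 * ‖V x‖ ^ 2 := by positivity
        linarith
  have hgi : Integrable g := by
    refine h.integrable_of_le (R := R) (K := 3 * S ^ 2 / c0 + 2 * S ^ 2 * (c / R) * S)
      (((((hζm.pow_const 2).const_mul _).mul (hum.pow_const _)).aestronglyMeasurable.smul hqm).add
        (((hζm.const_mul 2).mul (hum.pow_const 3)).aestronglyMeasurable.smul
          (continuous_gradient (hζ.smooth.of_le (by simp))).aestronglyMeasurable))
      (fun x hx => by simp [hg, hζ.eq_zero x hx]) (Eventually.of_forall fun x _ => ?_)
    obtain ⟨b1, b2, b3, b4, b5, b6⟩ := basic x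
    refine (hgx x).trans ?_
    have hq := norm_excessGradient_le (V := V) hm hk h.mem_Icc hc0 ha x
    have hcR : 0 ≤ c / R := (norm_nonneg _).trans (hζ.norm_gradient_le x)
    calc 3 * (ζ x ^ 2 * excess k r x ^ 2 * ‖excessGradient m k r V x‖)
          + 2 * S ^ 2 * (c / R) * r x
        ≤ 3 * (1 * S ^ 2 * (‖V x‖ / c0)) + 2 * S ^ 2 * (c / R) * S := by
          gcongr
          exact (h.mem_Icc x).2
      _ = 3 * S ^ 2 / c0 * ‖V x‖ + 2 * S ^ 2 * (c / R) * S * 1 := by ring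
      _ ≤ 3 * S ^ 2 / c0 * (1 + ‖V x‖ ^ 2) + 2 * S ^ 2 * (c / R) * S * (1 + ‖V x‖ ^ 2) := by
          gcongr
          · exact le_one_add_sq _
          · nlinarith [sq_nonneg ‖V x‖]
      _ = _ := by ring
  have key := hw.lintegral_le hn hvi hgi (R := 2 * R) (fun x hx => by simp [hv, hζ.eq_zero x hx])
    hμ hsμ
  -- The cube of the excess lives on the level set, so the Faber–Krahn inequality on that set
  -- controls its full integral.
  have e1 : ∫⁻ x in {x | k < r x}, ‖v x‖ₑ = ∫⁻ x, ‖v x‖ₑ := by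
    refine setLIntegral_eq_of_support_subset ?_
    intro x hx
    by_contra hx'
    exact hx (by simp [hv, excess_of_le (not_lt.1 hx')])
  rw [e1, ← ofReal_integral_norm_eq_lintegral_enorm hvi,
    ← ofReal_integral_norm_eq_lintegral_enorm hgi, ← ENNReal.ofReal_mul
    (mul_nonneg (sobolevConst_nonneg n) (by positivity)), ENNReal.ofReal_le_ofReal_iff
    (mul_nonneg (mul_nonneg (sobolevConst_nonneg n) (by positivity))
      (integral_nonneg fun x => norm_nonneg _))] at key
  have e2 : ∫ x, ‖v x‖ = ∫ x, v x := by
    congr 1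
    ext1 x
    have := (basic x).1
    exact Real.norm_of_nonneg (by positivity)
  rw [e2] at key
  have hDi := h.integrable_dissipation hm hk hc0 ha hζ
  -- Young's inequality, through the square in `h2`: `3 σ u² |q| ≤ u³ / 2 + (9/2) σ² u |q|²`. The
  -- half cube is absorbed on the left, and doubling gives the constants `9 σ²` and `4 σ`.
  have hp : ∫ x, σ * ‖g x‖ ≤ ∫ x, (1 / 2 * v x +
      9 / 2 * σ ^ 2 * (ζ x ^ 2 * excess k r x * ‖excessGradient m k r V x‖ ^ 2)
      + 2 * σ * S ^ 2 * (c / R) * r x) := by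
    refine integral_mono (hgi.norm.const_mul σ)
      (((hvi.const_mul _).add (hDi.const_mul _)).add (h.integrable.const_mul _)) fun x => ?_
    obtain ⟨b1, b2, b3, b4, b5, b6⟩ := basic x
    have h1 := mul_le_mul_of_nonneg_left (hgx x) hσ0
    have h2 : 0 ≤ ζ x ^ 2 * excess k r x * (excess k r x
      - 3 * σ * ‖excessGradient m k r V x‖) ^ 2 := by positivity
    simp only [hv]
    nlinarith
  have i2 : Integrable fun x => 1 / 2 * v x +
      9 / 2 * σ ^ 2 * (ζ x ^ 2 * excess k r x * ‖excessGradient m k r V x‖ ^ 2) :=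
    (hvi.const_mul _).add (hDi.const_mul _)
  rw [integral_const_mul, integral_add i2 (h.integrable.const_mul _),
    integral_add (hvi.const_mul _) (hDi.const_mul _),
    integral_const_mul, integral_const_mul, integral_const_mul] at hp
  have h3 : sobolevConst n * μ ^ (1 / (n : ℝ)) * ∫ x, ‖g x‖ ≤ σ * ∫ x, ‖g x‖ :=
    mul_le_mul_of_nonneg_right hσ (integral_nonneg fun x => norm_nonneg _)
  have hcR : 0 ≤ c / R := (norm_nonneg _).trans (hζ.norm_gradient_le 0)
  have h4 : 2 * σ * S ^ 2 * (c / R) * ∫ x, r x ≤ 2 * σ * S ^ 2 * (c / R) * M :=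
    mul_le_mul_of_nonneg_left h.mass (by positivity)
  linarith

theorem IsSlice.integrable_inner_testGradient (h : IsSlice m S M L Λ r V b) (hm : 0 < m)
    (hk : 0 < k) (hc0 : 0 < c0) (ha : ∀ ρ, k ≤ ρ → ρ ≤ S → c0 ≤ m * ρ ^ (m - 1))
    (hζ : IsCutoff R c ζ) : Integrable fun x => inner ℝ (testGradient m k ζ r V x) (V x) := by
  have hVm := h.weak.2.1.aestronglyMeasurable
  have htm := aestronglyMeasurable_testGradient (m := m) (k := k) h.measurable hζ hVm
  have hS0 : 0 ≤ S := (h.mem_Icc 0).1.trans (h.mem_Icc 0).2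
  refine h.integrable_of_le (R := R) (K := 2 * S / c0 + 2 * S ^ 2 * (c / R)) (htm.inner hVm)
    (fun x hx => by rw [testGradient_eq_zero hζ hx, inner_zero_left])
    (Eventually.of_forall fun x _ => ?_)
  have h1 := norm_testGradient_le (V := V) hm hk h.mem_Icc hc0 ha hζ x
  have hcR : 0 ≤ c / R := (norm_nonneg _).trans (hζ.norm_gradient_le x)
  calc ‖inner ℝ (testGradient m k ζ r V x) (V x)‖
      ≤ (2 * S / c0 * ‖V x‖ + 2 * S ^ 2 * (c / R)) * ‖V x‖ :=
        (norm_inner_le_norm _ _).trans (by gcongr)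
    _ = 2 * S / c0 * ‖V x‖ ^ 2 + 2 * S ^ 2 * (c / R) * ‖V x‖ := by ring
    _ ≤ 2 * S / c0 * (1 + ‖V x‖ ^ 2) + 2 * S ^ 2 * (c / R) * (1 + ‖V x‖ ^ 2) := by
        gcongr
        · linarith
        · exact le_one_add_sq _
    _ = _ := by ring

/-- The energy estimate on a time slice. -/
theorem IsSlice.energy (hn : 2 ≤ n) (h : IsSlice m S M L Λ r V b) (hm : 0 < m) (hk : 0 < k)
    (hc0 : 0 < c0) (hc1 : 0 ≤ c1) (hc : 0 ≤ c) (hL : 0 ≤ L) (hΛ : 0 ≤ Λ) (hR : 1 ≤ R)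
    (ha : ∀ ρ, k ≤ ρ → ρ ≤ S → c0 ≤ m * ρ ^ (m - 1) ∧ m * ρ ^ (m - 1) ≤ c1)
    (hζ : IsCutoff R c ζ) {μ : ℝ} (hμ : 0 ≤ μ) (hsμ : volume {x | k < r x} ≤ ENNReal.ofReal μ)
    {σ : ℝ} (hσ0 : 0 < σ) (hσ : sobolevConst n * μ ^ (1 / (n : ℝ)) ≤ σ) :
    - ∫ x, inner ℝ (testGradient m k ζ r V x) (V x + r x • b x) ≤
      - (c0 / (9 * σ ^ 2)) * (∫ x, ζ x ^ 2 * excess k r x ^ 3) + Λ * S ^ 3 * μ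
      + (c0 / (9 * σ ^ 2) * (4 * σ * S ^ 2 * c * M) / R + c1 * S ^ 2 * c ^ 2 * M / R ^ 2
        + 6 * L * c * S ^ 2 * ∫ x in {x | R ≤ ‖x‖}, r x) := by
  have ha' : ∀ ρ, k ≤ ρ → ρ ≤ S → c0 ≤ m * ρ ^ (m - 1) := fun ρ h1 h2 => (ha ρ h1 h2).1
  have hR0 : 0 < R := by linarith
  have hS0 : 0 ≤ S := (h.mem_Icc 0).1.trans (h.mem_Icc 0).2
  have hζm := hζ.smooth.continuous.measurable
  have hum := measurable_excess (k := k) h.measurable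
  have hVm := h.weak.2.1.aestronglyMeasurable
  have hqm := aestronglyMeasurable_excessGradient (m := m) (k := k) h.measurable hVm
  have hgζ : Continuous (gradient ζ) := continuous_gradient (hζ.smooth.of_le (by simp))
  have hX := h.integral_le_dissipation hn hm hk hc0 ha' hζ hμ hsμ hσ
  have hDi := h.integrable_dissipation hm hk hc0 ha' hζ
  have hTi := h.integrable_inner_testGradient hm hk hc0 ha' hζ
  set D := ∫ x, ζ x ^ 2 * excess k r x * ‖excessGradient m k r V x‖ ^ 2 with hD
  set X := ∫ x, ζ x ^ 2 * excess k r x ^ 3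
  have hT : c0 * D - c1 * S ^ 2 * (c / R) ^ 2 * M ≤
      ∫ x, inner ℝ (testGradient m k ζ r V x) (V x) := by
    have h1 : ∫ x, (c0 * (ζ x ^ 2 * excess k r x * ‖excessGradient m k r V x‖ ^ 2)
        - c1 * S ^ 2 * (c / R) ^ 2 * r x) ≤ ∫ x, inner ℝ (testGradient m k ζ r V x) (V x) :=
      integral_mono ((hDi.const_mul _).sub (h.integrable.const_mul _)) hTi
        fun x => inner_testGradient_ge hm hk h.mem_Icc hc0 hc1 ha hζ x
    rw [integral_sub (hDi.const_mul _) (h.integrable.const_mul _), integral_const_mul,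
      integral_const_mul] at h1
    have h2 : c1 * S ^ 2 * (c / R) ^ 2 * ∫ x, r x ≤ c1 * S ^ 2 * (c / R) ^ 2 * M :=
      mul_le_mul_of_nonneg_left h.mass (by positivity)
    linarith
  -- For `R ≥ 1` one has `1 + 2 R ≤ 3 R`.
  have hgrow : ∀ᵐ x, ‖x‖ < 2 * R → ‖b x‖ ≤ 3 * L * R := by
    filter_upwards [h.growth] with x hx hx'
    refine hx.trans ?_
    nlinarith
  have hgrow' : ∀ᵐ x, ‖x‖ < 2 * R + 1 → ‖b x‖ ≤ L * (2 * R + 2) := by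
    filter_upwards [h.growth] with x hx hx'
    exact hx.trans (mul_le_mul_of_nonneg_left (by linarith) hL)
  have hPb := pressure_bounds hk h.mem_Icc hζ
  set res := fun x => r x * excess k r x ^ 2
    - (2 / 3 * excess k r x ^ 3 + k * excess k r x ^ 2) with hres
  have hrb : ∀ x, res x ∈ Icc 0 (S ^ 2 * r x) := residual_bounds hk h.mem_Icc
  have hrm : Measurable res :=
    (h.measurable.mul (hum.pow_const 2)).sub (((hum.pow_const 3).const_mul _).add
      ((hum.pow_const 2).const_mul _))
  have hPw := hasWeakGradient_pressure hm hk h.mem_Icc h.weak hζ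
  have hPgx : ∀ x, ‖pressureGradient m k ζ r V x‖ ≤ (2 * S ^ 2 / c0 + 2 * S ^ 3 * (c / R)) *
      (1 + ‖V x‖ ^ 2) := fun x => by
    have hu := excess_mem_Icc hk h.mem_Icc x
    have hz := hζ.mem_Icc x
    have hz2 : ζ x ^ 2 ≤ 1 := pow_le_one₀ hz.1 hz.2
    have hu1 := hu.1
    have hr0 := (h.mem_Icc x).1
    have hrS := (h.mem_Icc x).2
    have hq := norm_excessGradient_le (V := V) hm hk h.mem_Icc hc0 ha' x
    have hcR : 0 ≤ c / R := (norm_nonneg _).trans (hζ.norm_gradient_le x)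
    have hP3 : 2 / 3 * excess k r x ^ 3 + k * excess k r x ^ 2 ≤ S ^ 3 := by
      have h1 := (hrb x).1
      simp only [hres] at h1
      have h2 : r x * excess k r x ^ 2 ≤ S * S ^ 2 := by
        gcongr
        exact hu.2.trans hrS
      nlinarith
    have hP0 : 0 ≤ 2 / 3 * excess k r x ^ 3 + k * excess k r x ^ 2 := by positivity
    rw [pressureGradient, add_mul]
    refine (norm_add_le _ _).trans (add_le_add ?_ ?_)
    · rw [norm_smul, Real.norm_of_nonneg (by positivity)]
      calc 2 * ζ x ^ 2 * (excess k r x * r x) * ‖excessGradient m k r V x‖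
          ≤ 2 * 1 * (S * S) * (‖V x‖ / c0) := by
            gcongr
            exact hu.2.trans hrS
        _ = 2 * S ^ 2 / c0 * ‖V x‖ := by ring
        _ ≤ _ := by
            gcongr
            exact le_one_add_sq _
    · rw [norm_smul, Real.norm_of_nonneg (mul_nonneg (by linarith [hz.1]) hP0)]
      calc 2 * ζ x * (2 / 3 * excess k r x ^ 3 + k * excess k r x ^ 2) * ‖gradient ζ x‖
          ≤ 2 * 1 * S ^ 3 * (c / R) := by
            gcongr
            · exact hz.2
            · exact hζ.norm_gradient_le x
        _ = 2 * S ^ 3 * (c / R) * 1 := by ring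
        _ ≤ _ := by
            gcongr
            nlinarith [sq_nonneg ‖V x‖]
  have hPm : AEStronglyMeasurable (pressureGradient m k ζ r V) volume :=
    ((((hζm.pow_const 2).const_mul 2).mul (hum.mul h.measurable)).aestronglyMeasurable.smul
      hqm).add (((hζm.const_mul 2).mul (((hum.pow_const 3).const_mul _).add
      ((hum.pow_const 2).const_mul _))).aestronglyMeasurable.smul hgζ.aestronglyMeasurable)
  have hP0 : ∀ x, 2 * R ≤ ‖x‖ → pressure k ζ r x = 0 := fun x hx => by
    simp [pressure, hζ.eq_zero x hx]
  have hPg0 : ∀ x, 2 * R ≤ ‖x‖ → pressureGradient m k ζ r V x = 0 := fun x hx => by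
    simp [pressureGradient, hζ.eq_zero x hx]
  have hPgi : Integrable (pressureGradient m k ζ r V) :=
    h.integrable_of_le hPm hPg0 (Eventually.of_forall fun x _ => hPgx x)
  have hset : MeasurableSet {x | k < r x} := measurableSet_lt measurable_const h.measurable
  have hPi : Integrable (pressure k ζ r) := by
    refine h.integrable_of_le (R := R) (K := S ^ 3) hPw.1.aestronglyMeasurable hP0
      (Eventually.of_forall fun x _ => ?_)
    rw [Real.norm_of_nonneg (hPb x).1]
    refine (hPb x).2.trans ((indicator_le_self' (fun _ _ => by positivity) x).trans ?_)
    have : 0 ≤ S ^ 3 * ‖V x‖ ^ 2 := by positivity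
    linarith
  have hPint : ∫ x, pressure k ζ r x ≤ S ^ 3 * μ := by
    have hfin : volume {x | k < r x} ≠ ⊤ := ne_top_of_le_ne_top ENNReal.ofReal_ne_top hsμ
    calc ∫ x, pressure k ζ r x ≤ ∫ x, {x | k < r x}.indicator (fun _ => S ^ 3) x :=
          integral_mono hPi ((integrable_indicator_iff hset).2 (integrableOn_const hfin))
            fun x => (hPb x).2
      _ = volume.real {x | k < r x} * S ^ 3 := by
          rw [integral_indicator hset, setIntegral_const, smul_eq_mul]
      _ ≤ μ * S ^ 3 := by
          gcongr
          exact ENNReal.toReal_le_of_le_ofReal hμ hsμ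
      _ = _ := mul_comm _ _
  -- The main part of the drift term. A one-sided bound on the divergence suffices because the
  -- pressure is nonnegative.
  have hdiv := h.div.weak h.drift_measurable hPw (fun x => (hPb x).1) hPi hPgi hgrow' hP0 hPg0
  have hdiv' : - ∫ x, inner ℝ (b x) (pressureGradient m k ζ r V x) ≤ Λ * S ^ 3 * μ :=
    hdiv.trans (by rw [mul_assoc]; exact mul_le_mul_of_nonneg_left hPint hΛ)
  have hi3 : Integrable fun x => inner ℝ (b x) (pressureGradient m k ζ r V x) := by
    refine h.integrable_of_le (R := R)
      (K := 3 * L * R * (2 * S ^ 2 / c0 + 2 * S ^ 3 * (c / R))) (h.drift_measurable.inner hPm)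
      (fun x hx => by rw [hPg0 x hx, inner_zero_right]) ?_
    filter_upwards [hgrow] with x hx hx'
    refine (norm_inner_le_norm _ _).trans ?_
    rw [mul_assoc]
    exact mul_le_mul (hx hx') (hPgx x) (norm_nonneg _) (by positivity)
  -- On `R ≤ |x| < 2 R` the drift is at most `3 L R` and `|∇ζ| ≤ c / R`. The radii cancel and only
  -- the tail of the mass remains; linear growth is the most that this tolerates.
  have hb4 : ∀ᵐ x, ‖inner ℝ (b x) ((2 * ζ x * res x) • gradient ζ x)‖ ≤
      {x | R ≤ ‖x‖}.indicator (fun x => 6 * L * c * S ^ 2 * r x) x := by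
    filter_upwards [hgrow] with x hx
    by_cases h1 : ‖x‖ < R
    · rw [hζ.gradient_eq_zero x h1, smul_zero, inner_zero_right, norm_zero]
      refine indicator_nonneg (fun x _ => ?_) x
      have := (h.mem_Icc x).1
      positivity
    by_cases h2 : 2 * R ≤ ‖x‖
    · rw [hζ.gradient_eq_zero' x h2, smul_zero, inner_zero_right, norm_zero]
      refine indicator_nonneg (fun x _ => ?_) x
      have := (h.mem_Icc x).1
      positivity
    rw [indicator_of_mem (by exact not_lt.1 h1)]
    refine (norm_inner_le_norm _ _).trans ?_
    have hz := hζ.mem_Icc x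
    have hr0 := (h.mem_Icc x).1
    have hrb' := hrb x
    rw [norm_smul, Real.norm_of_nonneg (mul_nonneg (by linarith [hz.1]) (hrb x).1)]
    calc ‖b x‖ * (2 * ζ x * res x * ‖gradient ζ x‖)
        ≤ (3 * L * R) * (2 * 1 * (S ^ 2 * r x) * (c / R)) := by
          gcongr
          · exact mul_nonneg (mul_nonneg (by linarith [hz.1]) hrb'.1) (norm_nonneg _)
          · exact hx (not_le.1 h2)
          · exact hrb'.1
          · exact hz.2
          · exact hrb'.2
          · exact hζ.norm_gradient_le x
      _ = 6 * L * c * S ^ 2 * r x := by field_simp; ring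
  have htail : MeasurableSet {x : Space n | R ≤ ‖x‖} :=
    measurableSet_le measurable_const measurable_norm
  have hi4' : Integrable ({x : Space n | R ≤ ‖x‖}.indicator
      fun x => 6 * L * c * S ^ 2 * r x) :=
    (h.integrable.const_mul _).indicator htail
  have hi4 : Integrable fun x => inner ℝ (b x) ((2 * ζ x * res x) • gradient ζ x) :=
    Integrable.mono' hi4' (h.drift_measurable.inner
      (((hζm.const_mul 2).mul hrm).aestronglyMeasurable.smul hgζ.aestronglyMeasurable)) hb4
  have h4 : - ∫ x, inner ℝ (b x) ((2 * ζ x * res x) • gradient ζ x) ≤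
      6 * L * c * S ^ 2 * ∫ x in {x | R ≤ ‖x‖}, r x := by
    rw [← integral_const_mul, ← integral_indicator htail, ← integral_neg]
    refine integral_mono_ae hi4.neg hi4' ?_
    filter_upwards [hb4] with x hx
    exact (neg_le_abs _).trans hx
  have hsplit : ∫ x, inner ℝ (testGradient m k ζ r V x) (V x + r x • b x) =
      (∫ x, inner ℝ (testGradient m k ζ r V x) (V x))
      + ((∫ x, inner ℝ (b x) (pressureGradient m k ζ r V x))
        + ∫ x, inner ℝ (b x) ((2 * ζ x * res x) • gradient ζ x)) := by
    have hi34 : Integrable fun x => inner ℝ (b x) (pressureGradient m k ζ r V x)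
        + inner ℝ (b x) ((2 * ζ x * res x) • gradient ζ x) := hi3.add hi4
    rw [← integral_add hi3 hi4, ← integral_add hTi hi34]
    congr 1
    ext1 x
    rw [inner_add_right, inner_smul_right, ← inner_add_right, ← testGradient_smul_eq,
      inner_smul_right, real_inner_comm (b x)]
  rw [hsplit]
  -- The Sobolev estimate multiplied by `c0 / (9 σ²)` turns the whole dissipation `c0 D` into
  -- damping of the cubic integral.
  have hfin : c0 / (9 * σ ^ 2) * X ≤ c0 * D + c0 / (9 * σ ^ 2) * (4 * σ * S ^ 2 * c * M) / R := by
    have h5 := mul_le_mul_of_nonneg_left hX (by positivity : 0 ≤ c0 / (9 * σ ^ 2))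
    refine h5.trans (le_of_eq ?_)
    field_simp
  have e6 : c1 * S ^ 2 * (c / R) ^ 2 * M = c1 * S ^ 2 * c ^ 2 * M / R ^ 2 := by ring
  rw [e6] at hT
  linarith

end

/-! ### Mollification and correlations in `L²`. -/

section L2

variable {G : Type*} [NormedAddCommGroup G] [NormedSpace ℝ G] [FiniteDimensional ℝ G]
  [MeasureSpace G] [BorelSpace G] [(volume : Measure G).IsAddHaarMeasure]
  {F : Type*} [NormedAddCommGroup F] [NormedSpace ℝ F] [CompleteSpace F]

/-- Jensen's inequality for a probability density, obtained from Cauchy–Schwarz by splitting the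
kernel into two square roots. -/
theorem lintegral_kernel_mul_sq_le (j : ℕ) {D : G → ℝ≥0∞} (hD : AEMeasurable D volume) :
    (∫⁻ z : G, ‖kernel j z‖ₑ * D z) ^ 2 ≤ ∫⁻ z : G, ‖kernel j z‖ₑ * D z ^ 2 := by
  have hκ : Measurable fun z : G => ‖kernel j z‖ₑ := (continuous_kernel j).measurable.enorm
  have h1 := ENNReal.lintegral_mul_le_Lp_mul_Lq volume Real.HolderConjugate.two_two
    (f := fun z : G => ‖kernel j z‖ₑ ^ (1 / 2 : ℝ)) (g := fun z => ‖kernel j z‖ₑ ^ (1 / 2 : ℝ) * D z)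
    (hκ.pow_const _).aemeasurable ((hκ.pow_const _).aemeasurable.mul hD)
  have e1 : ∀ a : ℝ≥0∞, a ^ (1 / 2 : ℝ) * a ^ (1 / 2 : ℝ) = a := fun a => by
    rw [← ENNReal.rpow_add_of_nonneg _ _ (by norm_num) (by norm_num)]
    norm_num
  have e2 : ∀ a : ℝ≥0∞, (a ^ (1 / 2 : ℝ)) ^ (2 : ℝ) = a := fun a => by
    rw [← ENNReal.rpow_mul]
    norm_num
  simp only [Pi.mul_apply, ← mul_assoc, e1, e2, lintegral_kernel, ENNReal.one_rpow, one_mul,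
    ENNReal.mul_rpow_of_nonneg _ _ (by norm_num : (0 : ℝ) ≤ 2)] at h1
  calc (∫⁻ z : G, ‖kernel j z‖ₑ * D z) ^ 2
      ≤ ((∫⁻ z : G, ‖kernel j z‖ₑ * D z ^ (2 : ℝ)) ^ (1 / 2 : ℝ)) ^ 2 := by gcongr
    _ = _ := by
      rw [← ENNReal.rpow_natCast, Nat.cast_ofNat, e2]
      simp only [ENNReal.rpow_ofNat]

/-- Mollifications of a square integrable function converge in `L²`. -/
theorem tendsto_mollify_L2 {f : G → F} (hf : MemLp f 2 volume) :
    Tendsto (fun j => eLpNorm (fun x => mollify j f x - f x) 2 volume) atTop (𝓝 0) := by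
  have ht := tendsto_eLpNorm_translate_sub (by norm_num) (by simp) hf 0
  rw [ENNReal.tendsto_nhds_zero] at ht ⊢
  intro ε hε
  obtain ⟨δ, hδ, hb⟩ := Metric.eventually_nhds_iff.1 (ht ε hε)
  filter_upwards [(bump_rOut_tendsto G).eventually_lt_const hδ] with j hj
  have hfl : LocallyIntegrable f volume := hf.locallyIntegrable (by norm_num)
  have hmeas : AEStronglyMeasurable (fun p : G × G => f (p.1 - p.2) - f p.1)
      (volume.prod volume) := by
    refine AEStronglyMeasurable.sub ?_ hf.1.comp_fst
    exact hf.1.comp_quasiMeasurePreserving (quasiMeasurePreserving_sub_of_right_invariant _ _)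
  have e : ∀ g : G → F, eLpNorm g 2 volume ^ 2 = ∫⁻ x, ‖g x‖ₑ ^ 2 := fun g => by
    have := eLpNorm_nnreal_pow_eq_lintegral (f := g) (μ := volume) (p := 2) (by norm_num)
    simpa using this
  have key : eLpNorm (fun x => mollify j f x - f x) 2 volume ^ 2 ≤ ε ^ 2 := by
    calc _ = ∫⁻ x, ‖mollify j f x - f x‖ₑ ^ 2 := e _
      _ ≤ ∫⁻ x, ∫⁻ z, ‖kernel j z‖ₑ * ‖f (x - z) - f x‖ₑ ^ 2 := by
        have hae : ∀ᵐ x, AEStronglyMeasurable (fun z => f (x - z) - f x) volume :=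
          hmeas.prodMk_left
        refine lintegral_mono_ae ?_
        filter_upwards [hae] with x hx
        refine le_trans ?_ (lintegral_kernel_mul_sq_le j hx.enorm)
        gcongr
        rw [mollify_sub_apply j hfl]
        refine (enorm_integral_le_lintegral_enorm _).trans (lintegral_mono fun z => ?_)
        rw [enorm_smul]
      _ = ∫⁻ z, ∫⁻ x, ‖kernel j z‖ₑ * ‖f (x - z) - f x‖ₑ ^ 2 := by
        refine lintegral_lintegral_swap ?_
        exact ((continuous_kernel j).aestronglyMeasurable.comp_snd.enorm).mul
          (hmeas.enorm.pow_const 2)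
      _ ≤ ∫⁻ z : G, ‖kernel j z‖ₑ * ε ^ 2 := by
        refine lintegral_mono fun z => ?_
        rw [lintegral_const_mul' _ _ enorm_ne_top]
        by_cases hz : (bump G j).rOut ≤ ‖z‖
        · simp [kernel_eq_zero hz]
        · rw [← e]
          gcongr
          have := hb (y := z) (by rw [dist_zero_right]; exact (not_le.1 hz).trans hj)
          simpa using this
      _ = ε ^ 2 := by
        rw [lintegral_mul_const _ (continuous_kernel j).measurable.enorm, lintegral_kernel, one_mul]
  exact (ENNReal.pow_le_pow_left_iff two_ne_zero).1 key

theorem abs_integral_inner_le {α H : Type*} [MeasurableSpace α] {μ : Measure α}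
    [NormedAddCommGroup H] [InnerProductSpace ℝ H] {f g : α → H} (hf : MemLp f 2 μ)
    (hg : MemLp g 2 μ) :
    ‖∫ x, inner ℝ (f x) (g x) ∂μ‖ₑ ≤ eLpNorm f 2 μ * eLpNorm g 2 μ := by
  refine (enorm_integral_le_lintegral_enorm _).trans ?_
  rw [← eLpNorm_one_eq_lintegral_enorm]
  have h := eLpNorm_le_eLpNorm_mul_eLpNorm_of_nnnorm (p := 2) (q := 2) (r := 1) hf.1 hg.1
    (fun a b => inner ℝ a b) 1 (Eventually.of_forall fun x => by
      rw [one_mul]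
      exact nnnorm_inner_le_nnnorm _ _)
  simpa using h

theorem integrable_inner_of_memLp {α H : Type*} [MeasurableSpace α] {μ : Measure α}
    [NormedAddCommGroup H] [InnerProductSpace ℝ H] {f g : α → H} (hf : MemLp f 2 μ)
    (hg : MemLp g 2 μ) : Integrable (fun x => inner ℝ (f x) (g x)) μ := by
  have h : Integrable (fun x => ‖f x‖ ^ 2 + ‖g x‖ ^ 2) μ :=
    ((memLp_two_iff_integrable_sq_norm hf.1).1 hf).add
      ((memLp_two_iff_integrable_sq_norm hg.1).1 hg)
  refine h.mono' (hf.1.inner hg.1) (Eventually.of_forall fun x => ?_)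
  refine (norm_inner_le_norm _ _).trans ?_
  nlinarith [sq_nonneg (‖f x‖ - ‖g x‖), sq_nonneg ‖f x‖, sq_nonneg ‖g x‖]

/-- The correlation of two square integrable functions is continuous. -/
theorem continuous_integral_inner_translate {H : Type*} [NormedAddCommGroup H]
    [InnerProductSpace ℝ H] {f g : G → H} (hf : MemLp f 2 volume) (hg : MemLp g 2 volume) :
    Continuous fun z => ∫ x, inner ℝ (f x) (g (x - z)) := by
  have hgz : ∀ z, MemLp (fun x => g (x - z)) 2 volume := fun z =>
    hg.comp_measurePreserving (measurePreserving_sub_right volume z)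
  refine continuous_iff_continuousAt.2 fun z₀ => ?_
  rw [ContinuousAt, tendsto_iff_edist_tendsto_0]
  have h := ENNReal.Tendsto.const_mul (a := eLpNorm f 2 volume)
    (tendsto_eLpNorm_translate_sub (by norm_num) (by simp) hg z₀) (Or.inr hf.2.ne)
  rw [mul_zero] at h
  refine tendsto_of_tendsto_of_tendsto_of_le_of_le tendsto_const_nhds h (fun _ => zero_le)
    fun z => ?_
  change edist (∫ x, inner ℝ (f x) (g (x - z))) (∫ x, inner ℝ (f x) (g (x - z₀))) ≤
    eLpNorm f 2 volume * eLpNorm (fun x => g (x - z) - g (x - z₀)) 2 volume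
  rw [edist_eq_enorm_sub, ← integral_sub (integrable_inner_of_memLp hf (hgz z))
    (integrable_inner_of_memLp hf (hgz z₀))]
  simp_rw [← inner_sub_right]
  exact abs_integral_inner_le hf ((hgz z).sub (hgz z₀))

end L2

/-! ### Mollification in space-time. -/

section SpaceTime

variable {n : ℕ}

instance : (volume : Measure (ℝ × Space n)).IsAddHaarMeasure :=
  inferInstanceAs ((volume : Measure ℝ).prod (volume : Measure (Space n))).IsAddHaarMeasure

/-- Mollifying in space and time a function that is weakly differentiable in space. -/
theorem gradient_mollify_slice {φ : ℝ × Space n → ℝ} {Φ : ℝ × Space n → Space n}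
    (hφ : Integrable φ) (hΦ : Integrable Φ)
    (h : ∀ᵐ t, HasWeakGradient (fun x => φ (t, x)) fun x => Φ (t, x)) (j : ℕ) (t : ℝ)
    (x : Space n) :
    gradient (fun y => mollify j φ (t, y)) x = mollify j Φ (t, x) := by
  have hk : ContDiff ℝ 1 (kernel j : ℝ × Space n → ℝ) := (contDiff_kernel j).of_le (by simp)
  have hd := (hasCompactSupport_kernel j).hasFDerivAt_convolution_right (mul ℝ ℝ)
    hφ.locallyIntegrable hk (t, x)
  have hmul : mollify j φ = φ ⋆[mul ℝ ℝ, volume] kernel j := by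
    ext x
    rw [mollify_apply', convolution_mul]
    simp [mul_comm]
  rw [← hmul] at hd
  have hd2 := hd.comp x ((hasFDerivAt_const t x).prodMk (hasFDerivAt_id x))
  have hik : Integrable fun z => kernel j ((t, x) - z) • Φ z := by
    obtain ⟨C, hC⟩ := (continuous_kernel j).bounded_above_of_compact_support
      (hasCompactSupport_kernel (G := ℝ × Space n) j)
    exact hΦ.bdd_smul C ((continuous_kernel j).comp
      (continuous_const.sub continuous_id)).aestronglyMeasurable
      (Eventually.of_forall fun z => hC _)
  refine ext_inner_right ℝ fun w => ?_
  have e : fderiv ℝ (fun y => mollify j φ (t, y)) x = _ := hd2.fderiv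
  have hcf : Continuous fun a : ℝ × Space n => fderiv ℝ (kernel j) a (0, w) :=
    (hk.continuous_fderiv one_ne_zero).clm_apply continuous_const
  have hif : Integrable fun z => φ z * fderiv ℝ (kernel j) ((t, x) - z) (0, w) := by
    obtain ⟨C, hC⟩ := hcf.bounded_above_of_compact_support
      (((hasCompactSupport_kernel (G := ℝ × Space n) j).fderiv (𝕜 := ℝ)).comp_left
        (g := fun L : (ℝ × Space n) →L[ℝ] ℝ => L (0, w)) rfl)
    exact hφ.mul_bdd (c := C) (hcf.comp (continuous_const.sub continuous_id)).aestronglyMeasurable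
      (Eventually.of_forall fun z => hC _)
  rw [inner_gradient, e, ContinuousLinearMap.comp_apply]
  have e3 : ((0 : Space n →L[ℝ] ℝ).prod (ContinuousLinearMap.id ℝ (Space n))) w = (0, w) := rfl
  rw [e3, convolution_precompR_apply _ hφ.locallyIntegrable
    ((hasCompactSupport_kernel j).fderiv (𝕜 := ℝ)) (hk.continuous_fderiv one_ne_zero),
    convolution_mul, mollify_apply', real_inner_comm, ← integral_inner hik]
  have hik' := Integrable.const_inner (𝕜 := ℝ) w hik
  -- By Fubini the identity reduces to almost every time slice, where the space-time kernel at fixed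
  -- time is an admissible spatial test function.
  rw [Measure.volume_eq_prod] at hif hik' ⊢
  rw [integral_prod _ hif, integral_prod _ hik']
  refine integral_congr_ae ?_
  filter_upwards [h] with s hs
  have hc : HasCompactSupport fun y : Space n => kernel j (t - s, x - y) := by
    refine HasCompactSupport.intro (isCompact_closedBall x (bump (ℝ × Space n) j).rOut)
      fun y hy => kernel_eq_zero ?_
    have : (bump (ℝ × Space n) j).rOut < ‖x - y‖ := by
      rw [mem_closedBall, not_le, dist_comm, dist_eq_norm] at hy
      exact hy
    exact this.le.trans (le_max_right _ _)
  have hsm : ContDiff ℝ ∞ fun y : Space n => kernel j (t - s, x - y) :=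
    (contDiff_kernel j).comp (contDiff_const.prodMk (contDiff_const.sub contDiff_id))
  have hsm1 : ContDiff ℝ 1 fun y : Space n => kernel j (t - s, x - y) := hsm.of_le (by simp)
  have key := hs.2.2 _ hsm hc
  have i1 : Integrable fun y => φ (s, y) • gradient (fun y : Space n => kernel j (t - s, x - y)) y :=
    hs.1.integrable_smul_right_of_hasCompactSupport (continuous_gradient hsm1)
      (hasCompactSupport_gradient hc)
  have i2 : Integrable fun y => kernel j (t - s, x - y) • Φ (s, y) :=
    hs.2.1.integrable_smul_left_of_hasCompactSupport hsm.continuous hc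
  have key2 := congrArg (fun v => inner ℝ w v) key
  simp only [inner_neg_right] at key2
  rw [← integral_inner i1, ← integral_inner i2] at key2
  have e4 : ∀ y, gradient (fun y : Space n => kernel j (t - s, x - y)) y = _ := fun y => rfl
  have e5 : ∀ y, inner ℝ w (φ (s, y) • gradient (fun y : Space n => kernel j (t - s, x - y)) y) =
      - (φ (s, y) * fderiv ℝ (kernel j) ((t, x) - (s, y)) (0, w)) := fun y => by
    have hin : HasFDerivAt (fun y : Space n => (t - s, x - y)) ((0 : Space n →L[ℝ] ℝ).prod
        (-ContinuousLinearMap.id ℝ (Space n))) y :=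
      (hasFDerivAt_const (t - s) y).prodMk ((hasFDerivAt_id y).const_sub x)
    have hd3 := HasFDerivAt.comp (f := fun y : Space n => (t - s, x - y)) y
      (hk.differentiable one_ne_zero (t - s, x - y)).hasFDerivAt hin
    have e6 : fderiv ℝ (fun y : Space n => kernel j (t - s, x - y)) y = _ := hd3.fderiv
    rw [inner_smul_right, real_inner_comm, inner_gradient, e6]
    have : ((0 : Space n →L[ℝ] ℝ).prod
        (-ContinuousLinearMap.id ℝ (Space n))) w = -((0 : ℝ), w) := by
      ext <;> simp
    rw [ContinuousLinearMap.comp_apply, this, map_neg]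
    simp
  simp_rw [e5, integral_neg, neg_inj] at key2
  exact key2

end SpaceTime

/-! ### Flows on space-time and their increments in time. -/

variable {n : ℕ}

/-- A solution on `(-∞, T) × ℝⁿ` of `∂ₜ r = div (V + r b)` in the sense of distributions, where
`V` is the gradient of `r ^ m`, and where `V`, `b` vanish for negative times, so that `r` is
stationary there. -/
structure IsFlow (m S M L Λ K T : ℝ) (r : ℝ × Space n → ℝ) (V b : ℝ × Space n → Space n) :
    Prop where
  measurable : Measurable r
  measurable_V : Measurable V
  measurable_b : Measurable b
  mem_Icc : ∀ z, r z ∈ Icc 0 S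
  initial : ∀ z : ℝ × Space n, z.1 ≤ 0 → r z ≤ K
  V_eq_zero : ∀ z : ℝ × Space n, z.1 ∉ Ioo 0 T → V z = 0
  b_eq_zero : ∀ z : ℝ × Space n, z.1 ∉ Ioo 0 T → b z = 0
  growth : ∀ z, ‖b z‖ ≤ L * (1 + ‖z.2‖)
  slice : ∀ᵐ t, t ∈ Ioo 0 T → IsSlice m S M L Λ (fun x => r (t, x)) (fun x => V (t, x))
    fun x => b (t, x)
  V_sq : ∀ R : ℝ, MemLp V 2 (volume.restrict (univ ×ˢ ball 0 R))
  eqn : ∀ ψ : ℝ × Space n → ℝ, ContDiff ℝ ∞ ψ → HasCompactSupport ψ →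
    (∀ z : ℝ × Space n, T ≤ z.1 → ψ z = 0) →
    ∫ z, r z * deriv (fun s => ψ (s, z.2)) z.1 =
      ∫ z, inner ℝ (V z + r z • b z) (gradient (fun y => ψ (z.1, y)) z.2)

variable {m S M L Λ K T : ℝ} {r : ℝ × Space n → ℝ} {V b : ℝ × Space n → Space n}

theorem IsFlow.memLp_flux (h : IsFlow m S M L Λ K T r V b) (R : ℝ) :
    MemLp (fun z => V z + r z • b z) 2 (volume.restrict (univ ×ˢ ball 0 R)) := by
  refine (h.V_sq R).add ?_
  have hrb : Measurable fun z => r z • b z := h.measurable.smul h.measurable_b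
  have hms : MeasurableSet (Ioo 0 T ×ˢ ball (0 : Space n) R) :=
    measurableSet_Ioo.prod measurableSet_ball
  have hfin : volume (Ioo 0 T ×ˢ ball (0 : Space n) R) ≠ ⊤ := by
    rw [Measure.volume_eq_prod, Measure.prod_prod]
    exact ENNReal.mul_ne_top (by simp) measure_ball_lt_top.ne
  have e : (fun z => r z • b z) = (Ioo 0 T ×ˢ (univ : Set (Space n))).indicator
      fun z => r z • b z := by
    ext1 z
    by_cases hz : z.1 ∈ Ioo 0 T
    · rw [indicator_of_mem (by exact ⟨hz, mem_univ _⟩)]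
    · rw [indicator_of_notMem (fun h' => hz h'.1), h.b_eq_zero z hz, smul_zero]
  rw [e, memLp_indicator_iff_restrict (measurableSet_Ioo.prod MeasurableSet.univ),
    Measure.restrict_restrict (measurableSet_Ioo.prod MeasurableSet.univ), prod_inter_prod,
    inter_univ, univ_inter]
  have : IsFiniteMeasure (volume.restrict (Ioo 0 T ×ˢ ball (0 : Space n) R)) :=
    ⟨by rw [Measure.restrict_apply_univ]; exact lt_top_iff_ne_top.2 hfin⟩
  refine MemLp.of_bound hrb.aestronglyMeasurable (S * (L * (1 + R))) ?_
  filter_upwards [ae_restrict_mem hms] with z hz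
  have hz2 : ‖z.2‖ < R := by simpa using hz.2
  have hr := h.mem_Icc z
  have hL : 0 ≤ L := by
    have := (norm_nonneg _).trans (h.growth 0)
    simpa using this
  rw [norm_smul, Real.norm_of_nonneg hr.1]
  exact mul_le_mul hr.2 ((h.growth z).trans (by gcongr)) (norm_nonneg _) (hr.1.trans hr.2)

theorem shift_eq_sub (z : ℝ × Space n) (s : ℝ) : (z.1 + s, z.2) = z - (-s, 0) := by
  ext <;> simp

/-- The equation is tested with the translates `η (t + s, x)`, which vanish for `t ≥ T` because `s ≥
0`, and the result is integrated over `s` in `(0, δ)`. The increment of `η` contains no time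
derivative, so the identity extends to test functions that are rough in time. -/
theorem IsFlow.increment_smooth (h : IsFlow m S M L Λ K T r V b) {η : ℝ × Space n → ℝ}
    (hη : ContDiff ℝ ∞ η) (hc : HasCompactSupport η) (hT : ∀ z : ℝ × Space n, T ≤ z.1 → η z = 0)
    {δ : ℝ} (hδ : 0 ≤ δ) :
    ∫ z, r z * (η (z.1 + δ, z.2) - η z) =
      ∫ s in 0..δ, ∫ z, inner ℝ (V z + r z • b z) (gradient (fun y => η (z.1 + s, y)) z.2) := by
  have hη1 : ContDiff ℝ 1 η := hη.of_le (by simp)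
  set D : ℝ × Space n → ℝ := fun z => fderiv ℝ η z (1, 0) with hD
  have hDc : Continuous D := (hη1.continuous_fderiv one_ne_zero).clm_apply continuous_const
  have hDs : HasCompactSupport D :=
    (hc.fderiv (𝕜 := ℝ)).comp_left (g := fun L : (ℝ × Space n) →L[ℝ] ℝ => L (1, 0)) rfl
  have hder : ∀ (t : ℝ) (x : Space n), HasDerivAt (fun s => η (s, x)) (D (t, x)) t := fun t x => by
    have hin : HasFDerivAt (fun s : ℝ => (s, x)) ((ContinuousLinearMap.id ℝ ℝ).prod
        (0 : ℝ →L[ℝ] Space n)) t := (hasFDerivAt_id t).prodMk (hasFDerivAt_const x t)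
    have := (HasFDerivAt.comp (f := fun s : ℝ => (s, x)) t
      (hη1.differentiable one_ne_zero (t, x)).hasFDerivAt hin).hasDerivAt
    have e : ((fderiv ℝ η (t, x)).comp ((ContinuousLinearMap.id ℝ ℝ).prod
        (0 : ℝ →L[ℝ] Space n))) 1 = D (t, x) := by simp [hD]
    rw [e] at this
    exact this
  have hder' : ∀ (t s : ℝ) (x : Space n), HasDerivAt (fun s => η (t + s, x)) (D (t + s, x)) s :=
    fun t s x => by
      have := (hder (t + s) x).comp_const_add t s
      simpa using this
  obtain ⟨ρ, hρ⟩ := hDs.isCompact.isBounded.subset_closedBall (0 : ℝ × Space n)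
  obtain ⟨C, hC⟩ := hDc.bounded_above_of_compact_support hDs
  have h1 : ∀ z : ℝ × Space n, η (z.1 + δ, z.2) - η z = ∫ s in 0..δ, D (z.1 + s, z.2) := fun z => by
    rw [intervalIntegral.integral_eq_sub_of_hasDerivAt (fun s _ => hder' z.1 s z.2)
      ((by fun_prop : Continuous fun s => D (z.1 + s, z.2)).intervalIntegrable _ _)]
    simp
  have h2 : ∀ s ∈ Ioc 0 δ, ∫ z, inner ℝ (V z + r z • b z)
      (gradient (fun y => η (z.1 + s, y)) z.2) = ∫ z, r z * D (z.1 + s, z.2) := fun s hs => by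
    have key := h.eqn (fun z => η (z.1 + s, z.2)) (hη.comp
      ((contDiff_fst.add contDiff_const).prodMk contDiff_snd)) ?_
      (fun z hz => hT _ (by change T ≤ z.1 + s; linarith [hs.1]))
    · rw [← key]
      congr 1
      ext1 z
      congr 1
      have := (hder (z.1 + s) z.2).comp_add_const z.1 s
      exact this.deriv
    · have := hc.comp_homeomorph (Homeomorph.addRight ((s, 0) : ℝ × Space n))
      have e : (fun z : ℝ × Space n => η (z.1 + s, z.2)) =
          η ∘ Homeomorph.addRight ((s, 0) : ℝ × Space n) := by
        ext z
        simp [Prod.add_def]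
      rw [e]
      exact this
  rw [intervalIntegral.integral_of_le hδ, setIntegral_congr_fun measurableSet_Ioc h2,
    integral_integral_swap]
  · congr 1
    ext1 z
    rw [h1, integral_const_mul, intervalIntegral.integral_of_le hδ]
  · have hi : Integrable ((closedBall (0 : ℝ × Space n) (ρ + δ)).indicator fun _ => S * C) :=
      (integrable_indicator_iff measurableSet_closedBall).2
        (integrableOn_const measure_closedBall_lt_top.ne)
    refine Integrable.mono' (hi.comp_snd (volume.restrict (Ioc 0 δ))) ?_ ?_
    · refine Measurable.aestronglyMeasurable ?_
      exact (h.measurable.comp measurable_snd).mul (hDc.measurable.comp (by fun_prop))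
    · have : ∀ᵐ p ∂((volume.restrict (Ioc 0 δ)).prod (volume : Measure (ℝ × Space n))),
          p.1 ∈ Ioc 0 δ :=
        Measure.quasiMeasurePreserving_fst.ae (ae_restrict_mem measurableSet_Ioc)
      filter_upwards [this] with p hp
      have hr := h.mem_Icc p.2
      by_cases hz : p.2 ∈ closedBall (0 : ℝ × Space n) (ρ + δ)
      · rw [indicator_of_mem hz, Function.uncurry, norm_mul, Real.norm_of_nonneg hr.1]
        exact mul_le_mul hr.2 (hC _) (norm_nonneg _) (hr.1.trans hr.2)
      · rw [indicator_of_notMem hz, Function.uncurry]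
        have : D (p.2.1 + p.1, p.2.2) = 0 := by
          refine image_eq_zero_of_notMem_tsupport fun hmem => hz ?_
          have h3 := hρ hmem
          rw [mem_closedBall_zero_iff] at h3 ⊢
          have e : p.2 = (p.2.1 + p.1, p.2.2) - (p.1, 0) := by ext <;> simp
          have e2 : ‖((p.1, 0) : ℝ × Space n)‖ = p.1 := by
            simp [Prod.norm_def, abs_of_pos hp.1, hp.1.le]
          rw [e]
          refine (norm_sub_le _ _).trans ?_
          rw [e2]
          linarith [hp.2]
        rw [this]
        simp

variable {n : ℕ}

variable {m S M L Λ K T : ℝ} {r : ℝ × Space n → ℝ} {V b : ℝ × Space n → Space n}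

/-- The flux `V + r b`, restricted to the points whose space coordinate lies in a ball. -/
noncomputable def localFlux (r : ℝ × Space n → ℝ) (V b : ℝ × Space n → Space n) (R : ℝ) :
    ℝ × Space n → Space n :=
  (univ ×ˢ ball 0 R).indicator fun z => V z + r z • b z

theorem IsFlow.memLp_localFlux (h : IsFlow m S M L Λ K T r V b) (R : ℝ) :
    MemLp (localFlux r V b R) 2 volume :=
  (memLp_indicator_iff_restrict (MeasurableSet.univ.prod measurableSet_ball)).2 (h.memLp_flux R)

theorem inner_localFlux {R : ℝ} {Ψ : ℝ × Space n → Space n}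
    (hΨ : ∀ z : ℝ × Space n, R ≤ ‖z.2‖ → Ψ z = 0) (z : ℝ × Space n) :
    inner ℝ (localFlux r V b R z) (Ψ z) = inner ℝ (V z + r z • b z) (Ψ z) := by
  by_cases hz : ‖z.2‖ < R
  · rw [localFlux, indicator_of_mem (by exact ⟨mem_univ _, by simpa using hz⟩)]
  · rw [hΨ z (not_lt.1 hz), inner_zero_right, inner_zero_right]

/-- Square integrability alone makes the pairing continuous in the time shift, so its primitive can
be differentiated at zero although the test function has no regularity in time. -/
theorem continuous_pairing_shift {f g : ℝ × Space n → Space n} (hf : MemLp f 2 volume)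
    (hg : MemLp g 2 volume) :
    Continuous fun s : ℝ => ∫ z, inner ℝ (f z) (g (z.1 + s, z.2)) := by
  have h := (continuous_integral_inner_translate hf hg).comp
    (by fun_prop : Continuous fun s : ℝ => ((-s, 0) : ℝ × Space n))
  refine h.congr fun s => ?_
  simp only [Function.comp_apply, shift_eq_sub]

theorem eLpNorm_shift {F : Type*} [NormedAddCommGroup F] {g : ℝ × Space n → F} {p : ℝ≥0∞}
    (hg : AEStronglyMeasurable g volume) (s : ℝ) :
    eLpNorm (fun z : ℝ × Space n => g (z.1 + s, z.2)) p volume = eLpNorm g p volume := by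
  simp_rw [shift_eq_sub]
  exact eLpNorm_comp_measurePreserving hg (measurePreserving_sub_right volume _)

theorem memLp_shift {F : Type*} [NormedAddCommGroup F] {g : ℝ × Space n → F} {p : ℝ≥0∞}
    (hg : MemLp g p volume) (s : ℝ) :
    MemLp (fun z : ℝ × Space n => g (z.1 + s, z.2)) p volume := by
  simp_rw [shift_eq_sub]
  exact hg.comp_measurePreserving (measurePreserving_sub_right volume _)

theorem integrable_shift {F : Type*} [NormedAddCommGroup F] {g : ℝ × Space n → F}
    (hg : Integrable g) (s : ℝ) : Integrable (fun z : ℝ × Space n => g (z.1 + s, z.2)) :=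
  memLp_one_iff_integrable.1 (memLp_shift (memLp_one_iff_integrable.2 hg) s)

/-- A function that vanishes after `T' < T` remains admissible after mollification at a scale below
the gap `T - T'`. -/
theorem mollify_eq_zero_of_time {F : Type*} [NormedAddCommGroup F] [NormedSpace ℝ F]
    {φ : ℝ × Space n → F} {T' : ℝ} (hT : ∀ z : ℝ × Space n, T' ≤ z.1 → φ z = 0)
    {j : ℕ} (hj : (bump (ℝ × Space n) j).rOut < T - T') (z : ℝ × Space n) (hz : T ≤ z.1) :
    mollify j φ z = 0 := by
  rw [mollify_apply]
  refine integral_eq_zero_of_ae (Eventually.of_forall fun y => ?_)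
  by_cases hy : (bump (ℝ × Space n) j).rOut ≤ ‖y‖
  · simp [kernel_eq_zero hy]
  · have h1 : |y.1| ≤ ‖y‖ := norm_fst_le y
    have h2 := le_abs_self y.1
    simp only [Pi.zero_apply]
    rw [hT (z - y) (by simp only [Prod.fst_sub]; linarith), smul_zero]

/-- The equation, integrated over a time interval, tested against a weakly differentiable
function. -/
theorem IsFlow.increment (h : IsFlow m S M L Λ K T r V b) {φ : ℝ × Space n → ℝ}
    {Φ : ℝ × Space n → Space n} {R T' : ℝ} (hφ : Integrable φ) (hφc : HasCompactSupport φ)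
    (hΦ : Integrable Φ) (hΦ2 : MemLp Φ 2 volume) (hΦc : HasCompactSupport Φ)
    (hw : ∀ᵐ t, HasWeakGradient (fun x => φ (t, x)) fun x => Φ (t, x))
    (hR : ∀ z : ℝ × Space n, R ≤ ‖z.2‖ → Φ z = 0)
    (hT' : T' < T) (hT : ∀ z : ℝ × Space n, T' ≤ z.1 → φ z = 0) {δ : ℝ} (hδ : 0 ≤ δ) :
    ∫ z, r z * (φ (z.1 + δ, z.2) - φ z) =
      ∫ s in 0..δ, ∫ z, inner ℝ (localFlux r V b (R + 1) z) (Φ (z.1 + s, z.2)) := by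
  have hJ := h.memLp_localFlux (R + 1)
  have hmR : ∀ j (z : ℝ × Space n), R + 1 ≤ ‖z.2‖ → mollify j Φ z = 0 := fun j z hz => by
    rw [mollify_congr_ball (g := fun _ => 0), mollify_apply]
    · simp
    · intro y hy
      refine hR y ?_
      have h1 := norm_sub_norm_le z.2 y.2
      have h2 : ‖z.2 - y.2‖ ≤ ‖z - y‖ := norm_snd_le (z - y)
      rw [dist_comm, dist_eq_norm] at hy
      linarith
  have hm2 : ∀ j, MemLp (mollify j Φ) 2 volume := fun j =>
    (contDiff_mollify j hΦ.locallyIntegrable).continuous.memLp_of_hasCompactSupport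
      (hasCompactSupport_mollify j hΦc)
  -- For fine mollifications the smooth identity applies. The left side then passes to the limit by
  -- `L¹` convergence against the bounded `r`, the right side by `L²` convergence uniformly in the
  -- shift.
  have hsm : ∀ᶠ j in atTop, ∫ z, r z * (mollify j φ (z.1 + δ, z.2) - mollify j φ z) =
      ∫ s in 0..δ, ∫ z, inner ℝ (localFlux r V b (R + 1) z) (mollify j Φ (z.1 + s, z.2)) := by
    filter_upwards [(bump_rOut_tendsto (ℝ × Space n)).eventually_lt_const (sub_pos.2 hT')]
      with j hj
    rw [h.increment_smooth (contDiff_mollify j hφ.locallyIntegrable)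
      (hasCompactSupport_mollify j hφc) (mollify_eq_zero_of_time hT hj) hδ]
    congr 1
    ext1 s
    congr 1
    ext1 z
    rw [gradient_mollify_slice hφ hΦ hw,
      inner_localFlux (Ψ := fun z => mollify j Φ (z.1 + s, z.2)) (fun z hz => hmR j _ hz)]
  have hL : Tendsto (fun j => ∫ z, r z * (mollify j φ (z.1 + δ, z.2) - mollify j φ z)) atTop
      (𝓝 (∫ z, r z * (φ (z.1 + δ, z.2) - φ z))) := by
    have := tendsto_integral_bilin_of_L1 (mul ℝ ℝ) (s := univ) (a := r) (C := S)
      h.measurable.aestronglyMeasurable MeasurableSet.univ (Eventually.of_forall fun z _ => by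
        rw [Real.norm_of_nonneg (h.mem_Icc z).1]; exact (h.mem_Icc z).2)
      (fun j z => mollify j φ (z.1 + δ, z.2) - mollify j φ z)
      (fun z => φ (z.1 + δ, z.2) - φ z)
      (fun j => ((integrable_shift (integrable_mollify j hφ) δ).sub
        (integrable_mollify j hφ)).integrableOn)
      ((integrable_shift hφ δ).sub hφ).integrableOn ?_
    · simpa using this
    · have h0 := tendsto_mollify_L1 hφ
      refine tendsto_of_tendsto_of_tendsto_of_le_of_le tendsto_const_nhds
        (by simpa using h0.add h0) (fun _ => zero_le) fun j => ?_
      have hmeas : AEStronglyMeasurable (fun z => mollify j φ z - φ z) volume :=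
        ((integrable_mollify j hφ).sub hφ).1
      have e := eLpNorm_shift (p := 1) hmeas δ
      rw [eLpNorm_one_eq_lintegral_enorm, eLpNorm_one_eq_lintegral_enorm] at e
      simp only [Measure.restrict_univ]
      nth_rewrite 1 [← e]
      rw [← lintegral_add_right' _ hmeas.enorm]
      refine lintegral_mono fun z => ?_
      have : mollify j φ (z.1 + δ, z.2) - mollify j φ z - (φ (z.1 + δ, z.2) - φ z) =
          (mollify j φ (z.1 + δ, z.2) - φ (z.1 + δ, z.2)) - (mollify j φ z - φ z) := by ring
      rw [this]
      exact enorm_sub_le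
  refine tendsto_nhds_unique (hL.congr' hsm) ?_
  rw [tendsto_iff_edist_tendsto_0]
  have h0 := ENNReal.Tendsto.const_mul (a := ENNReal.ofReal δ * eLpNorm (localFlux r V b (R + 1)) 2 volume)
    (tendsto_mollify_L2 hΦ2) (Or.inr (ENNReal.mul_ne_top ENNReal.ofReal_ne_top hJ.2.ne))
  rw [mul_zero] at h0
  refine tendsto_of_tendsto_of_tendsto_of_le_of_le tendsto_const_nhds h0 (fun _ => zero_le)
    fun j => ?_
  simp only
  rw [edist_eq_enorm_sub, ← intervalIntegral.integral_sub
    ((continuous_pairing_shift hJ (hm2 j)).intervalIntegrable _ _)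
    ((continuous_pairing_shift hJ hΦ2).intervalIntegrable _ _),
    intervalIntegral.integral_of_le hδ]
  refine (enorm_integral_le_lintegral_enorm _).trans ?_
  refine (lintegral_mono (g := fun _ => eLpNorm (localFlux r V b (R + 1)) 2 volume *
    eLpNorm (fun z => mollify j Φ z - Φ z) 2 volume) fun s => ?_).trans ?_
  · rw [← integral_sub (integrable_inner_of_memLp hJ (memLp_shift (hm2 j) s))
      (integrable_inner_of_memLp hJ (memLp_shift hΦ2 s))]
    simp_rw [← inner_sub_right]
    refine (abs_integral_inner_le hJ ((memLp_shift (hm2 j) s).sub (memLp_shift hΦ2 s))).trans ?_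
    have := eLpNorm_shift (p := 2) ((hm2 j).sub hΦ2).1 s
    simp only [Pi.sub_apply] at this
    exact (mul_le_mul_right this.le _)
  · rw [setLIntegral_const, Real.volume_Ioc, sub_zero]
    exact le_of_eq (by ring)

/-! ### Testing the equation with a truncation of the solution. -/

variable {n : ℕ}

variable {m k S M L Λ K T T' R c c0 : ℝ} {r : ℝ × Space n → ℝ} {V b : ℝ × Space n → Space n}
  {ζ : Space n → ℝ} {θ θ' : ℝ → ℝ}

/-- The test function `θ ζ² (r - k)₊²` in space-time. -/
noncomputable def spaceTimeTest (k : ℝ) (θ : ℝ → ℝ) (ζ : Space n → ℝ) (r : ℝ × Space n → ℝ)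
    (z : ℝ × Space n) : ℝ :=
  θ z.1 * (ζ z.2 ^ 2 * max (r z - k) 0 ^ 2)

/-- The spatial gradient of `spaceTimeTest`. -/
noncomputable def spaceTimeGradient (m k : ℝ) (θ : ℝ → ℝ) (ζ : Space n → ℝ)
    (r : ℝ × Space n → ℝ) (V : ℝ × Space n → Space n) (z : ℝ × Space n) : Space n :=
  θ z.1 • testGradient m k ζ (fun x => r (z.1, x)) (fun x => V (z.1, x)) z.2

/-- Time weights: nonnegative, continuously differentiable, vanishing for late times. -/
structure IsTimeWeight (T' : ℝ) (θ θ' : ℝ → ℝ) : Prop where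
  hasDerivAt : ∀ t, HasDerivAt θ (θ' t) t
  continuous_deriv : Continuous θ'
  nonneg : ∀ t, 0 ≤ θ t
  eq_zero : ∀ t, T' ≤ t → θ t = 0

theorem IsTimeWeight.continuous (hθ : IsTimeWeight T' θ θ') : Continuous θ :=
  continuous_iff_continuousAt.2 fun t => (hθ.hasDerivAt t).continuousAt

theorem IsTimeWeight.deriv_eq_zero (hθ : IsTimeWeight T' θ θ') {t : ℝ} (ht : T' < t) :
    θ' t = 0 := by
  have h1 : θ =ᶠ[𝓝 t] fun _ => 0 := by
    filter_upwards [lt_mem_nhds ht] with s hs using hθ.eq_zero s hs.le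
  rw [← (hθ.hasDerivAt t).deriv, h1.deriv_eq, deriv_const]

/-- Truncating above the initial datum removes every contribution from nonpositive times, so no
initial term appears in the energy inequality. -/
theorem IsFlow.excess_eq_zero (h : IsFlow m S M L Λ K T r V b) (hKk : K ≤ k) {z : ℝ × Space n}
    (hz : z.1 ≤ 0) : max (r z - k) 0 = 0 :=
  max_eq_right (by linarith [h.initial z hz])

theorem IsFlow.spaceTimeTest_eq_zero (h : IsFlow m S M L Λ K T r V b) (hKk : K ≤ k)
    (hζ : IsCutoff R c ζ) (hθ : IsTimeWeight T' θ θ') {z : ℝ × Space n}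
    (hz : z ∉ Icc 0 T' ×ˢ closedBall (0 : Space n) (2 * R)) : spaceTimeTest k θ ζ r z = 0 := by
  rw [spaceTimeTest]
  by_cases h1 : z.1 ≤ 0
  · simp [h.excess_eq_zero hKk h1]
  by_cases h2 : T' ≤ z.1
  · simp [hθ.eq_zero _ h2]
  have h3 : 2 * R ≤ ‖z.2‖ := by
    by_contra h3
    exact hz ⟨⟨by linarith, by linarith⟩, by simpa using (not_le.1 h3).le⟩
  simp [hζ.eq_zero _ h3]

theorem IsFlow.spaceTimeGradient_eq_zero (h : IsFlow m S M L Λ K T r V b) (hKk : K ≤ k)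
    (hζ : IsCutoff R c ζ) (hθ : IsTimeWeight T' θ θ') {z : ℝ × Space n}
    (hz : z ∉ Ioo 0 T' ×ˢ ball (0 : Space n) (2 * R)) : spaceTimeGradient m k θ ζ r V z = 0 := by
  rw [spaceTimeGradient]
  by_cases h1 : z.1 ≤ 0
  · have : excess k (fun x => r (z.1, x)) z.2 = 0 := h.excess_eq_zero hKk h1
    simp [testGradient, this]
  by_cases h2 : T' ≤ z.1
  · simp [hθ.eq_zero _ h2]
  have h3 : 2 * R ≤ ‖z.2‖ := by
    by_contra h3
    exact hz ⟨⟨by linarith, by linarith⟩, by simpa using h3⟩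
  rw [testGradient_eq_zero hζ h3, smul_zero]

theorem IsFlow.measurable_spaceTimeTest (h : IsFlow m S M L Λ K T r V b) (hζ : IsCutoff R c ζ)
    (hθ : IsTimeWeight T' θ θ') : Measurable (spaceTimeTest k θ ζ r) :=
  (hθ.continuous.measurable.comp measurable_fst).mul
    (((hζ.smooth.continuous.measurable.comp measurable_snd).pow_const 2).mul
      (((h.measurable.sub_const k).max measurable_const).pow_const 2))

theorem IsFlow.measurable_spaceTimeGradient (h : IsFlow m S M L Λ K T r V b)
    (hζ : IsCutoff R c ζ) (hθ : IsTimeWeight T' θ θ') :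
    Measurable (spaceTimeGradient m k θ ζ r V) := by
  have hu : Measurable fun z : ℝ × Space n => max (r z - k) 0 :=
    (h.measurable.sub_const k).max measurable_const
  have hz : Measurable fun z : ℝ × Space n => ζ z.2 :=
    hζ.smooth.continuous.measurable.comp measurable_snd
  have hg : Measurable fun z : ℝ × Space n => gradient ζ z.2 :=
    (continuous_gradient (hζ.smooth.of_le (by simp))).measurable.comp measurable_snd
  have hq : Measurable fun z : ℝ × Space n =>
      if k < r z then (1 / m * r z ^ (1 - m)) • V z else 0 :=
    Measurable.ite (measurableSet_lt measurable_const h.measurable)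
      (((h.measurable.pow_const _).const_mul _).smul h.measurable_V) measurable_const
  exact (hθ.continuous.measurable.comp measurable_fst).smul
    ((((hz.pow_const 2).const_mul 2).mul hu).smul hq |>.add
      (((hz.const_mul 2).mul (hu.pow_const 2)).smul hg))

theorem IsTimeWeight.exists_bound (hθ : Continuous θ) (a b : ℝ) :
    ∃ C, 0 ≤ C ∧ ∀ t ∈ Icc a b, ‖θ t‖ ≤ C := by
  obtain ⟨C, hC⟩ := isCompact_Icc.exists_bound_of_continuousOn (s := Icc a b) hθ.continuousOn
  exact ⟨max C 0, le_max_right _ _, fun t ht => (hC t ht).trans (le_max_left _ _)⟩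

theorem volume_slab_ne_top (a b R : ℝ) :
    volume (Ioo a b ×ˢ ball (0 : Space n) R) ≠ ⊤ := by
  rw [Measure.volume_eq_prod, Measure.prod_prod]
  exact ENNReal.mul_ne_top (by simp) measure_ball_lt_top.ne

theorem volume_closed_slab_ne_top (a b R : ℝ) :
    volume (Icc a b ×ˢ closedBall (0 : Space n) R) ≠ ⊤ :=
  (isCompact_Icc.prod (isCompact_closedBall _ _)).measure_lt_top.ne

theorem IsFlow.memLp_spaceTimeGradient (h : IsFlow m S M L Λ K T r V b) (hm : 0 < m)
    (hk : 0 < k) (hc0 : 0 < c0) (ha : ∀ ρ, k ≤ ρ → ρ ≤ S → c0 ≤ m * ρ ^ (m - 1))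
    (hKk : K ≤ k) (hζ : IsCutoff R c ζ) (hθ : IsTimeWeight T' θ θ') :
    MemLp (spaceTimeGradient m k θ ζ r V) 2 volume := by
  set s := Ioo 0 T' ×ˢ ball (0 : Space n) (2 * R) with hs
  have hsm : MeasurableSet s := measurableSet_Ioo.prod measurableSet_ball
  obtain ⟨C, hC0, hC⟩ := IsTimeWeight.exists_bound hθ.continuous 0 T'
  have e : spaceTimeGradient m k θ ζ r V = s.indicator (spaceTimeGradient m k θ ζ r V) :=
    (indicator_eq_self.2 fun z hz => by
      by_contra hzs
      exact hz (h.spaceTimeGradient_eq_zero hKk hζ hθ hzs)).symm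
  rw [e, memLp_indicator_iff_restrict hsm]
  have hfin : IsFiniteMeasure (volume.restrict s) :=
    ⟨by rw [Measure.restrict_apply_univ]; exact lt_top_iff_ne_top.2 (volume_slab_ne_top _ _ _)⟩
  have hV : MemLp V 2 (volume.restrict s) :=
    (h.V_sq (2 * R)).mono_measure (Measure.restrict_mono (prod_mono_left (subset_univ _)) le_rfl)
  have hb : MemLp (fun z => C * (2 * S / c0 * ‖V z‖ + 2 * S ^ 2 * (c / R))) 2
      (volume.restrict s) :=
    ((hV.norm.const_mul _).add (memLp_const _)).const_mul _
  refine hb.mono (h.measurable_spaceTimeGradient hζ hθ).aestronglyMeasurable ?_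
  filter_upwards [ae_restrict_mem hsm] with z hz
  have h1 := norm_testGradient_le (V := fun x => V (z.1, x)) hm hk
    (fun x => h.mem_Icc (z.1, x)) hc0 ha hζ z.2
  rw [spaceTimeGradient, norm_smul]
  refine (mul_le_mul (hC _ (Ioo_subset_Icc_self hz.1)) h1 (norm_nonneg _) hC0).trans ?_
  exact le_abs_self _

theorem integrable_of_eq_zero_off {α F : Type*} [MeasurableSpace α] [NormedAddCommGroup F]
    {μ : Measure α} {f : α → F} {s : Set α} (hs : MeasurableSet s) (hfin : μ s ≠ ⊤)
    (hf : AEStronglyMeasurable f μ) {C : ℝ} (hC : ∀ x ∈ s, ‖f x‖ ≤ C) (h0 : ∀ x ∉ s, f x = 0) :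
    Integrable f μ := by
  have hi : Integrable (s.indicator fun _ => C) μ :=
    (integrable_indicator_iff hs).2 (integrableOn_const hfin)
  refine hi.mono' hf (Eventually.of_forall fun x => ?_)
  by_cases hx : x ∈ s
  · rw [indicator_of_mem hx]
    exact hC x hx
  · rw [indicator_of_notMem hx, h0 x hx, norm_zero]

theorem IsFlow.excess_mem_Icc (h : IsFlow m S M L Λ K T r V b) (hk : 0 < k) (z : ℝ × Space n) :
    max (r z - k) 0 ∈ Icc 0 S :=
  ⟨le_max_right _ _, max_le (by linarith [(h.mem_Icc z).2]) ((h.mem_Icc z).1.trans (h.mem_Icc z).2)⟩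

theorem hasWeakGradient_zero : HasWeakGradient (fun _ : Space n => (0 : ℝ)) fun _ => 0 :=
  ⟨locallyIntegrable_zero, locallyIntegrable_zero, fun ψ _ _ => by simp⟩

theorem IsFlow.hasWeakGradient_spaceTime (h : IsFlow m S M L Λ K T r V b) (hm : 0 < m)
    (hk : 0 < k) (hKk : K ≤ k) (hT' : T' < T) (hζ : IsCutoff R c ζ) (hθ : IsTimeWeight T' θ θ') :
    ∀ᵐ t, HasWeakGradient (fun x => spaceTimeTest k θ ζ r (t, x))
      fun x => spaceTimeGradient m k θ ζ r V (t, x) := by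
  filter_upwards [h.slice] with t ht
  by_cases h1 : t ∈ Ioo 0 T
  · have hw := (hasWeakGradient_cutoff_excess_pow hm hk le_rfl (ht h1).mem_Icc (ht h1).weak
      hζ).const_mul (θ t)
    refine hw.congr (ae_eq_refl _) (Eventually.of_forall fun x => ?_)
    simp [spaceTimeGradient, testGradient]
  · have e1 : (fun x => spaceTimeTest k θ ζ r (t, x)) = fun _ => 0 := by
      ext x
      rw [spaceTimeTest]
      rcases le_or_gt t 0 with h2 | h2
      · simp [h.excess_eq_zero hKk (z := (t, x)) h2]
      · have h3 : T ≤ t := by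
          by_contra h3
          exact h1 ⟨h2, not_le.1 h3⟩
        simp [hθ.eq_zero t (by linarith)]
    have e2 : (fun x => spaceTimeGradient m k θ ζ r V (t, x)) = fun _ => 0 := by
      ext1 x
      exact h.spaceTimeGradient_eq_zero hKk hζ hθ fun hz => h1 ⟨hz.1.1, hz.1.2.trans hT'⟩
    rw [e1, e2]
    exact hasWeakGradient_zero

/-- `(u³(a) - u³(b)) / 3` is bounded below by the tangent of the convex function `u³ / 3` at `b`. -/
theorem cube_excess_tangent (a b k : ℝ) :
    max (b - k) 0 ^ 2 * (a - b) ≤ (max (a - k) 0 ^ 3 - max (b - k) 0 ^ 3) / 3 := by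
  have key : ∀ x y : ℝ, 0 ≤ x → 0 ≤ y → y ^ 2 * (x - y) ≤ (x ^ 3 - y ^ 3) / 3 := fun x y hx hy => by
    -- The identity behind this is `x³ - 3 x y² + 2 y³ = (x + 2 y)(x - y)²`.
    nlinarith [mul_nonneg (by linarith : (0 : ℝ) ≤ x + 2 * y) (sq_nonneg (x - y))]
  refine le_trans ?_ (key _ _ (le_max_right _ _) (le_max_right _ _))
  rcases le_total b k with hb | hb
  · rw [max_eq_right (by linarith : b - k ≤ 0)]
    simp
  · rw [max_eq_left (by linarith : 0 ≤ b - k)]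
    refine mul_le_mul_of_nonneg_left ?_ (sq_nonneg _)
    linarith [le_max_left (a - k) 0]

/-- The pairing of the flux with the test function is controlled by the time derivative of the
weight. -/
theorem IsFlow.pairing_le (h : IsFlow m S M L Λ K T r V b) (hm : 0 < m)
    (hk : 0 < k) (hc0 : 0 < c0) (ha : ∀ ρ, k ≤ ρ → ρ ≤ S → c0 ≤ m * ρ ^ (m - 1))
    (hKk : K ≤ k) (hT' : T' < T) (hζ : IsCutoff R c ζ) (hθ : IsTimeWeight T' θ θ') :
    ∫ z, inner ℝ (V z + r z • b z) (spaceTimeGradient m k θ ζ r V z) ≤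
      (1 / 3) * ∫ z : ℝ × Space n, ζ z.2 ^ 2 * max (r z - k) 0 ^ 3 * θ' z.1 := by
  set φ := spaceTimeTest k θ ζ r with hφd
  set Φ := spaceTimeGradient m k θ ζ r V with hΦd
  set w : ℝ × Space n → ℝ := fun z => ζ z.2 ^ 2 * max (r z - k) 0 ^ 3 with hw
  have hS0 : 0 ≤ S := (h.mem_Icc 0).1.trans (h.mem_Icc 0).2
  have hζm : Measurable fun z : ℝ × Space n => ζ z.2 :=
    hζ.smooth.continuous.measurable.comp measurable_snd
  have hwm : Measurable w := (hζm.pow_const 2).mul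
    (((h.measurable.sub_const k).max measurable_const).pow_const 3)
  have hζ1 : ∀ x, ‖ζ x ^ 2‖ ≤ 1 := fun x => by
    rw [Real.norm_of_nonneg (sq_nonneg _)]
    exact pow_le_one₀ (hζ.mem_Icc x).1 (hζ.mem_Icc x).2
  have hwb : ∀ z, ‖w z‖ ≤ S ^ 3 := fun z => by
    have hu := h.excess_mem_Icc hk z
    rw [hw, norm_mul, Real.norm_of_nonneg (pow_nonneg hu.1 3)]
    exact (mul_le_mul (hζ1 _) (pow_le_pow_left₀ hu.1 hu.2 3) (pow_nonneg hu.1 3)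
      zero_le_one).trans (one_mul _).le
  have hw0 : ∀ z : ℝ × Space n, z.1 ≤ 0 → w z = 0 := fun z hz => by
    simp [hw, h.excess_eq_zero hKk hz]
  have hw0' : ∀ z : ℝ × Space n, 2 * R ≤ ‖z.2‖ → w z = 0 := fun z hz => by
    simp [hw, hζ.eq_zero _ hz]
  obtain ⟨C, hC0, hC⟩ := IsTimeWeight.exists_bound hθ.continuous 0 T'
  have hms : MeasurableSet (Icc 0 T' ×ˢ closedBall (0 : Space n) (2 * R)) :=
    measurableSet_Icc.prod measurableSet_closedBall
  have hφ0 := fun z => h.spaceTimeTest_eq_zero (z := z) hKk hζ hθ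
  have hφi : Integrable φ := by
    refine integrable_of_eq_zero_off hms (volume_closed_slab_ne_top _ _ _)
      (h.measurable_spaceTimeTest hζ hθ).aestronglyMeasurable (C := C * S ^ 2) (fun z hz => ?_) hφ0
    have hu := h.excess_mem_Icc hk z
    rw [hφd, spaceTimeTest, norm_mul, norm_mul, Real.norm_of_nonneg (pow_nonneg hu.1 2)]
    refine mul_le_mul (hC _ hz.1) ?_ (by positivity) hC0
    exact (mul_le_mul (hζ1 _) (pow_le_pow_left₀ hu.1 hu.2 2) (pow_nonneg hu.1 2)
      zero_le_one).trans (one_mul _).le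
  have hK : IsCompact (Icc 0 T' ×ˢ closedBall (0 : Space n) (2 * R)) :=
    isCompact_Icc.prod (isCompact_closedBall _ _)
  have hφc : HasCompactSupport φ := HasCompactSupport.intro hK hφ0
  have hΦ0 := fun z => h.spaceTimeGradient_eq_zero (z := z) hKk hζ hθ
  have hΦc : HasCompactSupport Φ := HasCompactSupport.intro hK fun z hz => hΦ0 z fun hz' =>
    hz ⟨Ioo_subset_Icc_self hz'.1, ball_subset_closedBall hz'.2⟩
  have hΦ2 : MemLp Φ 2 volume := h.memLp_spaceTimeGradient hm hk hc0 ha hKk hζ hθ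
  have hΦi : Integrable Φ := by
    have hl := (hΦ2.locallyIntegrable (by norm_num)).integrableOn_isCompact hK
    refine (integrableOn_iff_integrable_of_support_subset fun z hz => ?_).1 hl
    by_contra hz'
    exact hz (hΦ0 z fun h' => hz' ⟨Ioo_subset_Icc_self h'.1, ball_subset_closedBall h'.2⟩)
  have hΦR : ∀ z : ℝ × Space n, 2 * R ≤ ‖z.2‖ → Φ z = 0 := fun z hz => hΦ0 z fun h' => by
    have := h'.2
    simp only [mem_ball_zero_iff] at this
    linarith
  have hφT : ∀ z : ℝ × Space n, T' ≤ z.1 → φ z = 0 := fun z hz => by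
    simp [hφd, spaceTimeTest, hθ.eq_zero _ hz]
  set Θ : ℝ → ℝ := fun s => ∫ z, inner ℝ (localFlux r V b (2 * R + 1) z) (Φ (z.1 + s, z.2))
    with hΘ
  have hΘc : Continuous Θ := continuous_pairing_shift (h.memLp_localFlux _) hΦ2
  -- The gap before `T` is the room available for shifting the weight in time.
  set ε := T - T' with hε
  have hε0 : 0 < ε := sub_pos.2 hT'
  -- the weighted integral and its derivative
  obtain ⟨C', hC'0, hC'⟩ := IsTimeWeight.exists_bound hθ.continuous_deriv (-ε) (T + ε)
  have hwθi : ∀ δ ∈ ball (0 : ℝ) ε, Integrable fun z : ℝ × Space n => w z * θ (z.1 + δ) :=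
    fun δ hδ => by
      rw [mem_ball_zero_iff, Real.norm_eq_abs, abs_lt] at hδ
      obtain ⟨C2, hC20, hC2⟩ := IsTimeWeight.exists_bound hθ.continuous (-ε) (T + ε)
      refine integrable_of_eq_zero_off (s := Icc 0 T ×ˢ closedBall (0 : Space n) (2 * R))
        (measurableSet_Icc.prod measurableSet_closedBall)
        (volume_closed_slab_ne_top _ _ _) ((hwm.mul (hθ.continuous.measurable.comp
          (measurable_fst.add_const δ))).aestronglyMeasurable) (C := S ^ 3 * C2)
          (fun z hz => ?_) fun z hz => ?_
      · rw [norm_mul]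
        exact mul_le_mul (hwb z) (hC2 _ ⟨by linarith [hz.1.1], by linarith [hz.1.2]⟩)
          (norm_nonneg _) (by positivity)
      · by_cases h1 : z.1 ≤ 0
        · rw [hw0 z h1, zero_mul]
        by_cases h2 : T ≤ z.1
        · rw [hθ.eq_zero _ (by linarith), mul_zero]
        rw [hw0' z, zero_mul]
        by_contra h3
        exact hz ⟨⟨by linarith, by linarith⟩, by simpa using (not_le.1 h3).le⟩
  have hG : HasDerivAt (fun δ => ∫ z : ℝ × Space n, w z * θ (z.1 + δ))
      (∫ z : ℝ × Space n, w z * θ' (z.1 + 0)) 0 := by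
    refine (hasDerivAt_integral_of_dominated_loc_of_deriv_le (μ := volume)
      (F := fun δ (z : ℝ × Space n) => w z * θ (z.1 + δ))
      (F' := fun δ (z : ℝ × Space n) => w z * θ' (z.1 + δ))
      (bound := (Icc 0 T ×ˢ closedBall (0 : Space n) (2 * R)).indicator fun _ => S ^ 3 * C')
      (s := ball 0 ε) (ball_mem_nhds _ hε0) ?_ ?_ ?_ ?_ ?_ ?_).2
    · exact Eventually.of_forall fun δ => (hwm.mul (hθ.continuous.measurable.comp
          (measurable_fst.add_const δ))).aestronglyMeasurable
    · exact hwθi 0 (mem_ball_self hε0)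
    · exact (hwm.mul (hθ.continuous_deriv.measurable.comp
          (measurable_fst.add_const 0))).aestronglyMeasurable
    · refine Eventually.of_forall fun z δ hδ => ?_
      rw [mem_ball_zero_iff, Real.norm_eq_abs, abs_lt] at hδ
      by_cases hz : z ∈ Icc 0 T ×ˢ closedBall (0 : Space n) (2 * R)
      · rw [indicator_of_mem hz, norm_mul]
        exact mul_le_mul (hwb z) (hC' _ ⟨by linarith [hz.1.1], by linarith [hz.1.2]⟩)
          (norm_nonneg _) (by positivity)
      · rw [indicator_of_notMem hz]
        refine (norm_eq_zero.2 ?_).le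
        by_cases h1 : z.1 ≤ 0
        · rw [hw0 z h1, zero_mul]
        by_cases h2 : T ≤ z.1
        · rw [hθ.deriv_eq_zero (by linarith), mul_zero]
        rw [hw0' z, zero_mul]
        by_contra h3
        exact hz ⟨⟨by linarith, by linarith⟩, by simpa using (not_le.1 h3).le⟩
    · exact (integrable_indicator_iff (measurableSet_Icc.prod measurableSet_closedBall)).2
        (integrableOn_const (volume_closed_slab_ne_top _ _ _))
    · exact Eventually.of_forall fun z δ _ =>
        ((hθ.hasDerivAt (z.1 + δ)).comp_const_add z.1 δ).const_mul (w z)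
  have hI : HasDerivAt (fun δ => ∫ s in 0..δ, Θ s) (Θ 0) 0 :=
    intervalIntegral.integral_hasDerivAt_right (hΘc.intervalIntegrable _ _)
      (hΘc.stronglyMeasurableAtFilter _ _) hΘc.continuousAt
  -- This replaces the chain rule in time: convexity gives the inequality at every finite forward
  -- increment, without a time derivative of `r`.
  have hineq : ∀ δ, 0 ≤ δ → δ < ε → ∫ s in 0..δ, Θ s ≤
      (1 / 3) * ((∫ z : ℝ × Space n, w z * θ (z.1 + δ)) - ∫ z : ℝ × Space n, w z * θ (z.1 + 0)) := by
    intro δ hδ hδε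
    rw [← h.increment hφi hφc hΦi hΦ2 hΦc (h.hasWeakGradient_spaceTime hm hk hKk hT' hζ hθ)
      hΦR hT' hφT hδ]
    have hbm : ∀ z : ℝ × Space n, ‖r z‖ ≤ S := fun z => by
      rw [Real.norm_of_nonneg (h.mem_Icc z).1]; exact (h.mem_Icc z).2
    have i1 : Integrable fun z : ℝ × Space n => r z * φ (z.1 + δ, z.2) :=
      (integrable_shift hφi δ).bdd_mul (c := S) h.measurable.aestronglyMeasurable
        (Eventually.of_forall hbm)
    have i2 : Integrable fun z : ℝ × Space n => r z * φ z :=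
      hφi.bdd_mul (c := S) h.measurable.aestronglyMeasurable (Eventually.of_forall hbm)
    have i3 := hwθi δ (by rw [mem_ball_zero_iff, Real.norm_of_nonneg hδ]; exact hδε)
    have i4 := hwθi 0 (mem_ball_self hε0)
    -- Translation invariance moves the shift from the test function to `r`, so that values of `r`
    -- at two times are compared against the same weight.
    have inv : ∀ f : ℝ × Space n → ℝ, ∫ z : ℝ × Space n, f (z.1 + -δ, z.2) = ∫ z, f z := fun f => by
      simp_rw [shift_eq_sub]
      exact integral_sub_right_eq_self f _
    have e1 : ∫ z : ℝ × Space n, r z * φ (z.1 + δ, z.2) =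
        ∫ z : ℝ × Space n, r (z.1 + -δ, z.2) * φ z := by
      rw [← inv]
      simp
    have e3 : ∫ z : ℝ × Space n, w z * θ (z.1 + δ) =
        ∫ z : ℝ × Space n, w (z.1 + -δ, z.2) * θ z.1 := by
      rw [← inv]
      simp
    have i1' : Integrable fun z : ℝ × Space n => r (z.1 + -δ, z.2) * φ z := by
      simpa using integrable_shift i1 (-δ)
    have i3' : Integrable fun z : ℝ × Space n => w (z.1 + -δ, z.2) * θ z.1 := by
      simpa using integrable_shift i3 (-δ)
    have i4' : Integrable fun z : ℝ × Space n => w z * θ z.1 := by simpa using i4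
    simp_rw [mul_sub]
    rw [integral_sub i1 i2, e1, ← integral_sub i1' i2, e3]
    simp only [add_zero]
    rw [← mul_sub, ← integral_sub i3' i4', ← integral_const_mul]
    refine integral_mono (i1'.sub i2) ((i3'.sub i4').const_mul _) fun z => ?_
    have hc3 := mul_le_mul_of_nonneg_left (cube_excess_tangent (r (z.1 + -δ, z.2)) (r z) k)
      (mul_nonneg (hθ.nonneg z.1) (sq_nonneg (ζ z.2)))
    simp only [hφd, hw, spaceTimeTest]
    linarith
  -- Both sides of `hineq` vanish at `δ = 0`, so the inequality passes to their right derivatives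
  -- there.
  have hfin : Θ 0 ≤ (1 / 3) * ∫ z : ℝ × Space n, w z * θ' (z.1 + 0) := by
    have hd := (hI.sub ((hG.sub_const (∫ z : ℝ × Space n, w z * θ (z.1 + 0))).const_mul
      (1 / 3 : ℝ))).tendsto_slope_zero_right
    refine sub_nonpos.1 (le_of_tendsto hd ?_)
    filter_upwards [Ioo_mem_nhdsGT hε0] with δ hδ
    have h1 := hineq δ hδ.1.le hδ.2
    simp only [zero_add, Pi.sub_apply, intervalIntegral.integral_same, sub_self, mul_zero, sub_zero,
      smul_eq_mul]
    exact mul_nonpos_of_nonneg_of_nonpos (inv_nonneg.2 hδ.1.le) (by linarith)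
  simp only [add_zero, hΘ] at hfin
  refine le_trans (le_of_eq ?_) hfin
  congr 1
  ext1 z
  rw [inner_localFlux (fun z hz => hΦR z (by linarith))]

/-! ### Gronwall's inequality by duality. -/

variable {n : ℕ}

variable {m k S M L Λ K T T' R c c0 c1 : ℝ} {r : ℝ × Space n → ℝ} {V b : ℝ × Space n → Space n}
  {ζ : Space n → ℝ} {θ θ' : ℝ → ℝ}

/-- The weight solves `θ' = a θ - g` backwards from zero final value, by variation of constants, and
is therefore nonnegative. Integrating the equation over `(0, T')` and dropping `θ 0 ≥ 0` bounds its
integral. Testing with this weight plays the role of Gronwall's inequality. -/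
theorem exists_isTimeWeight {a : ℝ} {g : ℝ → ℝ} (hg : Continuous g)
    (hg0 : ∀ t, 0 ≤ g t) (hgT : ∀ t, T' ≤ t → g t = 0) :
    ∃ θ : ℝ → ℝ, IsTimeWeight T' θ (fun t => a * θ t - g t) ∧
      a * ∫ t in 0..T', θ t ≤ ∫ t in 0..T', g t := by
  have hi : Continuous fun τ => Real.exp (-a * τ) * g τ := by fun_prop
  set θ : ℝ → ℝ := fun t => Real.exp (a * t) * ∫ τ in t..T', Real.exp (-a * τ) * g τ with hθ
  have hd : ∀ t, HasDerivAt θ (a * θ t - g t) t := fun t => by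
    have h1 : HasDerivAt (fun t => Real.exp (a * t)) (Real.exp (a * t) * a) t := by
      simpa using ((hasDerivAt_id t).const_mul a).exp
    have h2 : HasDerivAt (fun t => ∫ τ in t..T', Real.exp (-a * τ) * g τ)
        (-(Real.exp (-a * t) * g t)) t :=
      intervalIntegral.integral_hasDerivAt_left (hi.intervalIntegrable _ _)
        (hi.stronglyMeasurableAtFilter _ _) hi.continuousAt
    refine (h1.mul h2).congr_deriv ?_
    have : Real.exp (a * t) * Real.exp (-a * t) = 1 := by rw [← Real.exp_add]; simp
    simp only [hθ]
    linear_combination (-g t) * this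
  have hz : ∀ t, T' ≤ t → θ t = 0 := fun t ht => by
    have : ∫ τ in t..T', Real.exp (-a * τ) * g τ = 0 := by
      rw [intervalIntegral.integral_symm, neg_eq_zero]
      refine intervalIntegral.integral_zero_ae (Eventually.of_forall fun τ hτ => ?_)
      rw [uIoc_of_le ht] at hτ
      rw [hgT τ hτ.1.le, mul_zero]
    simp only [hθ, this, mul_zero]
  have h0 : ∀ t, 0 ≤ θ t := fun t => by
    rcases le_total T' t with ht | ht
    · exact (hz t ht).ge
    · exact mul_nonneg (Real.exp_pos _).le (intervalIntegral.integral_nonneg ht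
        fun τ _ => mul_nonneg (Real.exp_pos _).le (hg0 τ))
  have hc : Continuous θ := continuous_iff_continuousAt.2 fun t => (hd t).continuousAt
  refine ⟨θ, ⟨hd, (hc.const_mul a).sub hg, h0, hz⟩, ?_⟩
  have h3 := intervalIntegral.integral_eq_sub_of_hasDerivAt (a := 0) (b := T') (fun t _ => hd t)
    (((hc.const_mul a).sub hg).intervalIntegrable _ _)
  rw [intervalIntegral.integral_sub ((hc.const_mul a).intervalIntegrable _ _)
    (hg.intervalIntegrable _ _), intervalIntegral.integral_const_mul, hz T' le_rfl] at h3
  linarith [h0 0]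

theorem integral_eq_integral_slices {F : ℝ × Space n → ℝ} (hF : Integrable F)
    (h0 : ∀ z : ℝ × Space n, z.1 ∉ Ioo 0 T → F z = 0) :
    ∫ z, F z = ∫ t in Ioo 0 T, ∫ x, F (t, x) := by
  rw [Measure.volume_eq_prod, integral_prod _ hF]
  refine (setIntegral_eq_integral_of_forall_compl_eq_zero fun t ht => ?_).symm
  simp [h0 (t, _) ht]

theorem IsFlow.integrable_slab (h : IsFlow m S M L Λ K T r V b) :
    Integrable r ((volume.restrict (Ioo 0 T)).prod volume) := by
  rw [integrable_prod_iff h.measurable.aestronglyMeasurable]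
  have hs : ∀ᵐ t ∂(volume.restrict (Ioo 0 T)), IsSlice m S M L Λ (fun x => r (t, x))
      (fun x => V (t, x)) fun x => b (t, x) :=
    (ae_restrict_iff' measurableSet_Ioo).2 h.slice
  refine ⟨hs.mono fun t ht => ht.integrable, ?_⟩
  refine (integrable_const M).mono'
    h.measurable.aestronglyMeasurable.norm.integral_prod_right' ?_
  filter_upwards [hs] with t ht
  rw [Real.norm_of_nonneg (integral_nonneg fun _ => norm_nonneg _)]
  refine le_trans (le_of_eq ?_) ht.mass
  congr 1
  ext1 x
  exact Real.norm_of_nonneg (ht.mem_Icc x).1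

theorem IsFlow.integrable_excess_mul (h : IsFlow m S M L Λ K T r V b) (hk : 0 < k) (hKk : K ≤ k)
    {g : ℝ → ℝ} (hg : Continuous g) (hgT : ∀ t, T ≤ t → g t = 0) {a : Space n → ℝ}
    (ha : Measurable a) {C : ℝ} (haC : ∀ x, ‖a x‖ ≤ C) {ρ : ℝ} (ha0 : ∀ x, ρ ≤ ‖x‖ → a x = 0) :
    Integrable fun z : ℝ × Space n => a z.2 * max (r z - k) 0 ^ 3 * g z.1 := by
  have hS0 : 0 ≤ S := (h.mem_Icc 0).1.trans (h.mem_Icc 0).2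
  have hC0 : 0 ≤ C := (norm_nonneg _).trans (haC 0)
  obtain ⟨D, hD0, hD⟩ := IsTimeWeight.exists_bound hg 0 T
  refine integrable_of_eq_zero_off (s := Icc 0 T ×ˢ closedBall (0 : Space n) ρ)
    (measurableSet_Icc.prod measurableSet_closedBall)
    (volume_closed_slab_ne_top _ _ _) (C := C * S ^ 3 * D) ?_
    (fun z hz => ?_) fun z hz => ?_
  · exact (((ha.comp measurable_snd).mul
      (((h.measurable.sub_const k).max measurable_const).pow_const 3)).mul
      (hg.measurable.comp measurable_fst)).aestronglyMeasurable
  · have hu := h.excess_mem_Icc hk z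
    rw [norm_mul, norm_mul, Real.norm_of_nonneg (pow_nonneg hu.1 3)]
    exact mul_le_mul (mul_le_mul (haC _) (pow_le_pow_left₀ hu.1 hu.2 3) (pow_nonneg hu.1 3) hC0)
      (hD _ hz.1) (norm_nonneg _) (by positivity)
  · by_cases h1 : z.1 ≤ 0
    · simp [h.excess_eq_zero hKk h1]
    by_cases h2 : T ≤ z.1
    · rw [hgT _ h2, mul_zero]
    rw [ha0 z.2, zero_mul, zero_mul]
    by_contra h3
    exact hz ⟨⟨by linarith, by linarith⟩, by simpa using (not_le.1 h3).le⟩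

/-- The energy inequality, integrated against a weight in time. -/
theorem IsFlow.weighted_energy (hn : 2 ≤ n) (h : IsFlow m S M L Λ K T r V b) (hm : 0 < m)
    (hk : 0 < k) (hc0 : 0 < c0) (hc1 : 0 ≤ c1) (hc : 0 ≤ c) (hL : 0 ≤ L) (hΛ : 0 ≤ Λ)
    (hR : 1 ≤ R) (ha : ∀ ρ, k ≤ ρ → ρ ≤ S → c0 ≤ m * ρ ^ (m - 1) ∧ m * ρ ^ (m - 1) ≤ c1)
    (hKk : K ≤ k) (hT' : T' < T) (hζ : IsCutoff R c ζ) {μ σ : ℝ} (hμ : 0 ≤ μ)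
    (hsμ : ∀ᵐ t, t ∈ Ioo 0 T → volume {x | k < r (t, x)} ≤ ENNReal.ofReal μ) (hσ0 : 0 < σ)
    (hσ : sobolevConst n * μ ^ (1 / (n : ℝ)) ≤ σ) {g : ℝ → ℝ} (hg : Continuous g)
    (hgT : ∀ t, T' ≤ t → g t = 0)
    (hθ : IsTimeWeight T' θ fun t => 3 * (c0 / (9 * σ ^ 2)) * θ t - g t) :
    (1 / 3) * ∫ z : ℝ × Space n, ζ z.2 ^ 2 * max (r z - k) 0 ^ 3 * g z.1 ≤
      ∫ t in Ioo 0 T, θ t * (Λ * S ^ 3 * μ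
        + (c0 / (9 * σ ^ 2) * (4 * σ * S ^ 2 * c * M) / R + c1 * S ^ 2 * c ^ 2 * M / R ^ 2
        + 6 * L * c * S ^ 2 * ∫ x in {x | R ≤ ‖x‖}, r (t, x))) := by
  set N := c0 / (9 * σ ^ 2) with hN
  have hζm : Measurable fun x => ζ x ^ 2 := hζ.smooth.continuous.measurable.pow_const 2
  have hζ1 : ∀ x, ‖ζ x ^ 2‖ ≤ 1 := fun x => by
    rw [Real.norm_of_nonneg (sq_nonneg _)]
    exact pow_le_one₀ (hζ.mem_Icc x).1 (hζ.mem_Icc x).2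
  have hζ0 : ∀ x, 2 * R ≤ ‖x‖ → ζ x ^ 2 = 0 := fun x hx => by simp [hζ.eq_zero x hx]
  have hθT : ∀ t, T ≤ t → θ t = 0 := fun t ht => hθ.eq_zero t (by linarith)
  have hgi := h.integrable_excess_mul hk hKk hg (fun t ht => hgT t (by linarith)) hζm hζ1 hζ0
  have hθi := h.integrable_excess_mul hk hKk hθ.continuous hθT hζm hζ1 hζ0
  have hp := h.pairing_le hm hk hc0 (fun ρ h1 h2 => (ha ρ h1 h2).1) hKk hT' hζ hθ
  -- One third of `θ' = 3 N θ - g` reproduces the damping `N θ` of the energy estimate. The two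
  -- cancel and only the term with `g` survives.
  have e1 : ∀ z : ℝ × Space n, ζ z.2 ^ 2 * max (r z - k) 0 ^ 3 * (3 * N * θ z.1 - g z.1) =
      3 * N * (ζ z.2 ^ 2 * max (r z - k) 0 ^ 3 * θ z.1)
        - ζ z.2 ^ 2 * max (r z - k) 0 ^ 3 * g z.1 := fun z => by ring
  simp_rw [e1] at hp
  rw [integral_sub (hθi.const_mul _) hgi, integral_const_mul] at hp
  have hΦ2 := h.memLp_spaceTimeGradient (θ := θ) (ζ := ζ) hm hk hc0
    (fun ρ h1 h2 => (ha ρ h1 h2).1) hKk hζ hθ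
  have hI : Integrable fun z => inner ℝ (V z + r z • b z) (spaceTimeGradient m k θ ζ r V z) := by
    refine (integrable_inner_of_memLp (h.memLp_localFlux (2 * R)) hΦ2).congr
      (Eventually.of_forall fun z => ?_)
    exact inner_localFlux (Ψ := spaceTimeGradient m k θ ζ r V) (fun z hz => h.spaceTimeGradient_eq_zero hKk hζ hθ fun h' => by
      have := h'.2
      simp only [mem_ball_zero_iff] at this
      linarith) z
  have hI0 : ∀ z : ℝ × Space n, z.1 ∉ Ioo 0 T →
      inner ℝ (V z + r z • b z) (spaceTimeGradient m k θ ζ r V z) = 0 := fun z hz => by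
    rw [h.spaceTimeGradient_eq_zero hKk hζ hθ fun h' => hz ⟨h'.1.1, h'.1.2.trans hT'⟩,
      inner_zero_right]
  have hθ0 : ∀ z : ℝ × Space n, z.1 ∉ Ioo 0 T →
      ζ z.2 ^ 2 * max (r z - k) 0 ^ 3 * θ z.1 = 0 := fun z hz => by
    by_cases h1 : z.1 ≤ 0
    · simp [h.excess_eq_zero hKk h1]
    · rw [hθT z.1 (by
        by_contra h2
        exact hz ⟨by linarith, by linarith⟩), mul_zero]
  have hIt : Integrable (fun t => ∫ x, inner ℝ (V (t, x) + r (t, x) • b (t, x))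
      (spaceTimeGradient m k θ ζ r V (t, x))) := hI.integral_prod_left
  have hθt : Integrable (fun t => ∫ x, ζ x ^ 2 * max (r (t, x) - k) 0 ^ 3 * θ t) :=
    hθi.integral_prod_left
  have hs : ∀ᵐ t ∂(volume.restrict (Ioo 0 T)), IsSlice m S M L Λ (fun x => r (t, x))
      (fun x => V (t, x)) fun x => b (t, x) :=
    (ae_restrict_iff' measurableSet_Ioo).2 h.slice
  set κ := N * (4 * σ * S ^ 2 * c * M) / R + c1 * S ^ 2 * c ^ 2 * M / R ^ 2 with hκ
  have htail : Integrable (fun t => ∫ x in {x | R ≤ ‖x‖}, r (t, x)) (volume.restrict (Ioo 0 T)) := by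
    have := h.integrable_slab.mono_measure
      (Measure.prod_mono (le_refl (volume.restrict (Ioo 0 T)))
        (Measure.restrict_le_self (μ := (volume : Measure (Space n))) (s := {x | R ≤ ‖x‖})))
    exact this.integral_prod_left
  have herr : Integrable (fun t => θ t * (Λ * S ^ 3 * μ + (κ + 6 * L * c * S ^ 2 *
      ∫ x in {x | R ≤ ‖x‖}, r (t, x)))) (volume.restrict (Ioo 0 T)) := by
    obtain ⟨D, hD0, hD⟩ := IsTimeWeight.exists_bound hθ.continuous 0 T
    refine Integrable.bdd_mul (c := D) ((integrable_const _).add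
      ((integrable_const _).add (htail.const_mul _))) hθ.continuous.aestronglyMeasurable ?_
    filter_upwards [ae_restrict_mem measurableSet_Ioo] with t ht
    exact hD t (Ioo_subset_Icc_self ht)
  rw [integral_eq_integral_slices hI hI0, integral_eq_integral_slices hθi hθ0] at hp
  have hmain : N * (∫ t in Ioo 0 T, ∫ x, ζ x ^ 2 * max (r (t, x) - k) 0 ^ 3 * θ t)
      - (∫ t in Ioo 0 T, θ t * (Λ * S ^ 3 * μ + (κ + 6 * L * c * S ^ 2 *
      ∫ x in {x | R ≤ ‖x‖}, r (t, x)))) ≤ ∫ t in Ioo 0 T, ∫ x, inner ℝ (V (t, x) + r (t, x) • b (t, x))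
      (spaceTimeGradient m k θ ζ r V (t, x)) := by
    rw [← integral_const_mul, ← integral_sub (hθt.integrableOn.const_mul N) herr]
    refine integral_mono_ae ((hθt.integrableOn.const_mul N).sub herr) hIt.integrableOn ?_
    filter_upwards [hs, (ae_restrict_iff' measurableSet_Ioo).2 hsμ] with t ht hμt
    have h1 := mul_le_mul_of_nonneg_left (ht.energy hn hm hk hc0 hc1 hc hL hΛ hR ha hζ hμ hμt
      hσ0 hσ) (hθ.nonneg t)
    have e2 : ∫ x, inner ℝ (V (t, x) + r (t, x) • b (t, x))
        (spaceTimeGradient m k θ ζ r V (t, x)) = θ t * ∫ x, inner ℝ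
        (testGradient m k ζ (fun x => r (t, x)) (fun x => V (t, x)) x)
        (V (t, x) + r (t, x) • b (t, x)) := by
      rw [← integral_const_mul]
      congr 1
      ext1 x
      rw [spaceTimeGradient, inner_smul_right, real_inner_comm]
    have e3 : ∫ x, ζ x ^ 2 * max (r (t, x) - k) 0 ^ 3 * θ t =
        θ t * ∫ x, ζ x ^ 2 * excess k (fun x => r (t, x)) x ^ 3 := by
      rw [integral_mul_const, mul_comm]
      rfl
    change N * _ - _ ≤ _
    rw [e2, e3]
    rw [← hN] at h1
    linarith
  have hp' : ∫ t in Ioo 0 T, ∫ x, inner ℝ (V (t, x) + r (t, x) • b (t, x))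
      (spaceTimeGradient m k θ ζ r V (t, x)) ≤
      N * (∫ t in Ioo 0 T, ∫ x, ζ x ^ 2 * max (r (t, x) - k) 0 ^ 3 * θ t) -
        (1 / 3) * ∫ z : ℝ × Space n, ζ z.2 ^ 2 * max (r z - k) 0 ^ 3 * g z.1 := by
    refine hp.trans (le_of_eq ?_)
    ring
  linarith

/-! ### Removal of the cutoff and comparison of level sets. -/

variable {n : ℕ}

variable {m k k' S M L Λ K T T' R c c0 c1 : ℝ} {r : ℝ × Space n → ℝ}
  {V b : ℝ × Space n → Space n}

theorem tendsto_tail {f : Space n → ℝ} (hf : Integrable f) :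
    Tendsto (fun j : ℕ => ∫ x in {x | (j : ℝ) + 1 ≤ ‖x‖}, f x) atTop (𝓝 0) := by
  have h := Antitone.tendsto_setIntegral (μ := volume) (f := f)
    (s := fun j : ℕ => {x : Space n | (j : ℝ) + 1 ≤ ‖x‖})
    (fun j => measurableSet_le measurable_const measurable_norm)
    (fun i j hij x hx => by
      have : (i : ℝ) ≤ j := by exact_mod_cast hij
      simp only [mem_ofPred_eq] at hx ⊢
      linarith) hf.integrableOn
  have e : ⋂ j : ℕ, {x : Space n | (j : ℝ) + 1 ≤ ‖x‖} = ∅ := by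
    refine eq_empty_of_forall_notMem fun x hx => ?_
    obtain ⟨j, hj⟩ := exists_nat_gt ‖x‖
    have := mem_iInter.1 hx j
    simp only [mem_ofPred_eq] at this
    linarith
  rw [e] at h
  simpa using h

/-- The cutoff radius tends to infinity: the errors are of order `1 / R` or controlled by the tail
of the mass, and dominated convergence removes them. What remains is `Λ S³ μ` times `∫ θ`, which the
dual equation bounds by `(3 N)⁻¹ ∫ g`. -/
theorem IsFlow.integral_excess_weight_le (hn : 2 ≤ n) (h : IsFlow m S M L Λ K T r V b) (hm : 0 < m)
    (hk : 0 < k) (hc0 : 0 < c0) (hc1 : 0 ≤ c1) (hL : 0 ≤ L) (hΛ : 0 ≤ Λ) (hM : 0 ≤ M)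
    (ha : ∀ ρ, k ≤ ρ → ρ ≤ S → c0 ≤ m * ρ ^ (m - 1) ∧ m * ρ ^ (m - 1) ≤ c1)
    (hKk : K ≤ k) (hT0 : 0 ≤ T') (hT' : T' < T) {μ σ : ℝ} (hμ : 0 ≤ μ)
    (hsμ : ∀ᵐ t, t ∈ Ioo 0 T → volume {x | k < r (t, x)} ≤ ENNReal.ofReal μ) (hσ0 : 0 < σ)
    (hσ : sobolevConst n * μ ^ (1 / (n : ℝ)) ≤ σ) {g : ℝ → ℝ} (hg : Continuous g)
    (hg0 : ∀ t, 0 ≤ g t) (hgT : ∀ t, T' ≤ t → g t = 0) (R : ℝ) :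
    ∫ z : ℝ × Space n, (ball 0 R).indicator (fun _ => (1 : ℝ)) z.2 * max (r z - k) 0 ^ 3 * g z.1 ≤
      Λ * S ^ 3 * μ / (c0 / (9 * σ ^ 2)) * ∫ t in 0..T', g t := by
  have hS0 : 0 ≤ S := (h.mem_Icc 0).1.trans (h.mem_Icc 0).2
  set N := c0 / (9 * σ ^ 2) with hN
  have hN0 : 0 < N := by positivity
  obtain ⟨c, hc, hcut⟩ := exists_isCutoff n
  obtain ⟨θ, hθ, hθg⟩ := exists_isTimeWeight (a := 3 * N) hg hg0 hgT
  obtain ⟨D, hD0, hD⟩ := IsTimeWeight.exists_bound hθ.continuous 0 T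
  have hR1 : ∀ j : ℕ, (1 : ℝ) ≤ j + 1 := fun j => by linarith [(Nat.cast_nonneg j : (0 : ℝ) ≤ j)]
  choose ζ hζ using fun j : ℕ => hcut (j + 1) (hR1 j)
  have hs : ∀ᵐ t ∂(volume.restrict (Ioo 0 T)), IsSlice m S M L Λ (fun x => r (t, x))
      (fun x => V (t, x)) fun x => b (t, x) :=
    (ae_restrict_iff' measurableSet_Ioo).2 h.slice
  set κ1 := N * (4 * σ * S ^ 2 * c * M) with hκ1
  set κ2 := c1 * S ^ 2 * c ^ 2 * M with hκ2
  have hκ1' : 0 ≤ κ1 := by positivity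
  have hκ2' : 0 ≤ κ2 := by positivity
  set κ3 := 6 * L * c * S ^ 2 with hκ3
  have hκ3' : 0 ≤ κ3 := by positivity
  set E : ℕ → ℝ → ℝ := fun j t => θ t * (Λ * S ^ 3 * μ + (κ1 / ((j : ℝ) + 1)
    + κ2 / ((j : ℝ) + 1) ^ 2 + κ3 * ∫ x in {x | (j : ℝ) + 1 ≤ ‖x‖}, r (t, x))) with hE
  have hen := fun j => h.weighted_energy hn hm hk hc0 hc1 hc hL hΛ (hR1 j) ha hKk hT' (hζ j) hμ hsμ
    hσ0 hσ hg hgT hθ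
  have htm : ∀ j : ℕ, Measurable fun t => ∫ x in {x | (j : ℝ) + 1 ≤ ‖x‖}, r (t, x) := fun j =>
    (h.measurable.stronglyMeasurable.integral_prod_right'
      (ν := volume.restrict {x : Space n | (j : ℝ) + 1 ≤ ‖x‖})).measurable
  have hlim : Tendsto (fun j => ∫ t in Ioo 0 T, E j t) atTop
      (𝓝 (∫ t in Ioo 0 T, θ t * (Λ * S ^ 3 * μ))) := by
    refine tendsto_integral_of_dominated_convergence
      (fun _ => D * (Λ * S ^ 3 * μ + (κ1 + κ2 + κ3 * M))) (fun j => ?_) (integrable_const _)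
      (fun j => ?_) ?_
    · exact (hθ.continuous.measurable.mul
        (((htm j).const_mul _).const_add _ |>.const_add _)).aestronglyMeasurable
    · filter_upwards [hs, ae_restrict_mem measurableSet_Ioo] with t ht htT
      have hr0 : ∀ x, 0 ≤ r (t, x) := fun x => (ht.mem_Icc x).1
      have ht0 : 0 ≤ ∫ x in {x | (j : ℝ) + 1 ≤ ‖x‖}, r (t, x) :=
        integral_nonneg fun x => hr0 x
      have htM : ∫ x in {x | (j : ℝ) + 1 ≤ ‖x‖}, r (t, x) ≤ M :=
        (setIntegral_le_integral ht.integrable (Eventually.of_forall hr0)).trans ht.mass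
      have hj := hR1 j
      have hj2 : (1 : ℝ) ≤ ((j : ℝ) + 1) ^ 2 := one_le_pow₀ hj
      rw [hE, norm_mul]
      refine mul_le_mul (hD t (Ioo_subset_Icc_self htT)) ?_ (norm_nonneg _) hD0
      rw [Real.norm_of_nonneg (by positivity)]
      gcongr
      · exact div_le_self hκ1' hj
      · exact div_le_self hκ2' hj2
    · filter_upwards [hs] with t ht
      have l1 : Tendsto (fun j : ℕ => κ1 / ((j : ℝ) + 1)) atTop (𝓝 0) :=
        tendsto_const_nhds.div_atTop
          (tendsto_atTop_add_const_right _ _ tendsto_natCast_atTop_atTop)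
      have l2 : Tendsto (fun j : ℕ => κ2 / ((j : ℝ) + 1) ^ 2) atTop (𝓝 0) :=
        tendsto_const_nhds.div_atTop ((tendsto_pow_atTop two_ne_zero).comp
          (tendsto_atTop_add_const_right _ _ tendsto_natCast_atTop_atTop))
      have := ((((l1.add l2).add ((tendsto_tail ht.integrable).const_mul κ3)).const_add
        (Λ * S ^ 3 * μ)).const_mul (θ t))
      simpa using this
  -- Once the cutoff radius exceeds `R`, the cutoff equals 1 on the ball and dominates its
  -- indicator.
  have hle : ∀ᶠ j : ℕ in atTop, (1 / 3) * ∫ z : ℝ × Space n,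
      (ball 0 R).indicator (fun _ => (1 : ℝ)) z.2 * max (r z - k) 0 ^ 3 * g z.1 ≤
      ∫ t in Ioo 0 T, E j t := by
    obtain ⟨j0, hj0⟩ := exists_nat_ge R
    filter_upwards [eventually_ge_atTop j0] with j hj
    refine le_trans ?_ (hen j)
    have hgT' : ∀ t, T ≤ t → g t = 0 := fun t ht => hgT t (by linarith)
    gcongr ?_ * ?_
    have hζ1 : ∀ x, ‖ζ j x ^ 2‖ ≤ 1 := fun x => by
      rw [Real.norm_of_nonneg (sq_nonneg _)]
      exact pow_le_one₀ ((hζ j).mem_Icc x).1 ((hζ j).mem_Icc x).2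
    refine integral_mono (h.integrable_excess_mul hk hKk hg hgT'
      (measurable_const.indicator measurableSet_ball) (C := 1) (ρ := R) (fun x => ?_)
      (fun x hx => ?_)) (h.integrable_excess_mul hk hKk hg hgT'
      ((hζ j).smooth.continuous.measurable.pow_const 2) hζ1 (ρ := 2 * (j + 1)) (fun x hx => ?_))
      fun z => ?_
    · exact (norm_indicator_le_norm_self _ _).trans (by simp)
    · exact indicator_of_notMem (by simpa using hx) _
    · simp [(hζ j).eq_zero x hx]
    · have hu := h.excess_mem_Icc hk z
      refine mul_le_mul_of_nonneg_right (mul_le_mul_of_nonneg_right ?_ (pow_nonneg hu.1 3)) (hg0 _)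
      by_cases hz : z.2 ∈ ball (0 : Space n) R
      · have hj' : (j0 : ℝ) ≤ j := by exact_mod_cast hj
        rw [mem_ball_zero_iff] at hz
        rw [(hζ j).eq_one z.2 (by linarith)]
        simpa using indicator_le_self' (fun _ _ => zero_le_one) _
      · rw [indicator_of_notMem hz]
        positivity
  have hfin := ge_of_tendsto hlim hle
  have e : ∫ t in Ioo 0 T, θ t * (Λ * S ^ 3 * μ) = (∫ t in 0..T', θ t) * (Λ * S ^ 3 * μ) := by
    rw [integral_mul_const, intervalIntegral.integral_of_le hT0]
    congr 1
    refine setIntegral_eq_of_subset_of_forall_sdiff_eq_zero measurableSet_Ioo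
      (fun t ht => ⟨ht.1, lt_of_le_of_lt ht.2 hT'⟩) fun t ht => hθ.eq_zero t ?_
    by_contra h1
    exact ht.2 ⟨ht.1.1, (not_le.1 h1).le⟩
  rw [e] at hfin
  have hQ : 0 ≤ Λ * S ^ 3 * μ := by positivity
  have h4 := mul_le_mul_of_nonneg_right hθg hQ
  rw [div_mul_eq_mul_div, le_div_iff₀ hN0]
  nlinarith [mul_le_mul_of_nonneg_left hfin hN0.le]

/-- The weight `g` is specialised to mollifying kernels concentrating at `t`. Since mollifications
converge almost everywhere, the time-averaged bound becomes a bound at almost every time. -/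
theorem IsFlow.ae_integral_excess_le (hn : 2 ≤ n) (h : IsFlow m S M L Λ K T r V b) (hm : 0 < m)
    (hk : 0 < k) (hc0 : 0 < c0) (hc1 : 0 ≤ c1) (hL : 0 ≤ L) (hΛ : 0 ≤ Λ) (hM : 0 ≤ M)
    (ha : ∀ ρ, k ≤ ρ → ρ ≤ S → c0 ≤ m * ρ ^ (m - 1) ∧ m * ρ ^ (m - 1) ≤ c1)
    (hKk : K ≤ k) {μ σ : ℝ} (hμ : 0 ≤ μ)
    (hsμ : ∀ᵐ t, t ∈ Ioo 0 T → volume {x | k < r (t, x)} ≤ ENNReal.ofReal μ) (hσ0 : 0 < σ)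
    (hσ : sobolevConst n * μ ^ (1 / (n : ℝ)) ≤ σ) (R : ℝ) :
    ∀ᵐ t, t ∈ Ioo 0 T →
      ∫ x, (ball 0 R).indicator (fun _ => (1 : ℝ)) x * max (r (t, x) - k) 0 ^ 3 ≤
        Λ * S ^ 3 * μ / (c0 / (9 * σ ^ 2)) := by
  have hS0 : 0 ≤ S := (h.mem_Icc 0).1.trans (h.mem_Icc 0).2
  set I : Space n → ℝ := (ball 0 R).indicator fun _ => (1 : ℝ) with hI
  set f : ℝ → ℝ := (Ioo 0 T).indicator fun t => ∫ x, I x * max (r (t, x) - k) 0 ^ 3 with hf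
  have hIm : Measurable I := measurable_const.indicator measurableSet_ball
  have hI1 : ∀ x, ‖I x‖ ≤ 1 := fun x => (norm_indicator_le_norm_self _ _).trans (by simp)
  have hIi : Integrable I := (integrable_indicator_iff measurableSet_ball).2
    (integrableOn_const measure_ball_lt_top.ne)
  have hfm : Measurable f := by
    have hm' : Measurable fun z : ℝ × Space n => I z.2 * max (r z - k) 0 ^ 3 :=
      (hIm.comp measurable_snd).mul (((h.measurable.sub_const k).max measurable_const).pow_const 3)
    exact (hm'.stronglyMeasurable.integral_prod_right' (ν := volume)).measurable.indicator
      measurableSet_Ioo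
  have hfi : Integrable f := by
    refine integrable_of_eq_zero_off (s := Ioo 0 T) measurableSet_Ioo (by simp)
      hfm.aestronglyMeasurable (C := ∫ x, ‖I x‖ * S ^ 3) (fun t ht => ?_)
      fun t ht => indicator_of_notMem ht _
    rw [hf, indicator_of_mem ht]
    refine norm_integral_le_of_norm_le (hIi.norm.mul_const _) (Eventually.of_forall fun x => ?_)
    have hu := h.excess_mem_Icc hk (t, x)
    rw [norm_mul, Real.norm_of_nonneg (pow_nonneg hu.1 3)]
    exact mul_le_mul_of_nonneg_left (pow_le_pow_left₀ hu.1 hu.2 3) (norm_nonneg _)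
  filter_upwards [ae_tendsto_mollify hfi.locallyIntegrable] with t ht htT
  have e : f t = ∫ x, I x * max (r (t, x) - k) 0 ^ 3 := indicator_of_mem htT _
  rw [← e]
  refine le_of_tendsto ht ?_
  -- The support of the kernel centred at `t` must end before `T`.
  filter_upwards [(bump_rOut_tendsto ℝ).eventually_lt_const (sub_pos.2 htT.2)] with j hj
  set g : ℝ → ℝ := fun τ => kernel j (t - τ) with hg
  have hgc : Continuous g := (continuous_kernel j).comp (by fun_prop)
  have hg0 : ∀ τ, 0 ≤ g τ := fun τ => kernel_nonneg j _
  have hrpos : 0 < (bump ℝ j).rOut := (bump ℝ j).rOut_pos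
  set T' := t + (bump ℝ j).rOut with hT'
  have hT'0 : 0 ≤ T' := by linarith [htT.1]
  have hgT : ∀ τ, T' ≤ τ → g τ = 0 := fun τ hτ => kernel_eq_zero (by
    rw [Real.norm_eq_abs, abs_of_nonpos (by linarith)]
    linarith)
  have hgi : Integrable g := (integrable_kernel j).comp_sub_left t
  have hmain := h.integral_excess_weight_le hn hm hk hc0 hc1 hL hΛ hM ha hKk hT'0
    (by linarith : T' < T) hμ hsμ hσ0 hσ hgc hg0 hgT R
  have hgint : ∫ τ in 0..T', g τ ≤ 1 := by
    rw [intervalIntegral.integral_of_le hT'0]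
    refine (setIntegral_le_integral hgi (Eventually.of_forall hg0)).trans (le_of_eq ?_)
    rw [hg, integral_sub_left_eq_self (fun τ => kernel j τ), integral_kernel]
  have hi := h.integrable_excess_mul hk hKk hgc (fun τ hτ => hgT τ (by linarith)) hIm hI1
    (ρ := R) (fun x hx => indicator_of_notMem (by simpa using hx) _)
  rw [integral_eq_integral_slices (T := T) hi] at hmain
  · have e2 : mollify j f t = ∫ τ in Ioo 0 T, ∫ x, I x * max (r (τ, x) - k) 0 ^ 3 * g τ := by
      rw [mollify_apply', ← integral_indicator measurableSet_Ioo]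
      congr 1
      ext1 τ
      by_cases hτ : τ ∈ Ioo 0 T
      · rw [hf, indicator_of_mem hτ, indicator_of_mem hτ, integral_mul_const, smul_eq_mul,
          mul_comm]
      · rw [hf, indicator_of_notMem hτ, indicator_of_notMem hτ, smul_zero]
    rw [e2]
    refine hmain.trans ?_
    refine (mul_le_mul_of_nonneg_left hgint (by positivity)).trans (mul_one _).le
  · intro z hz
    by_cases h1 : z.1 ≤ 0
    · simp [h.excess_eq_zero hKk h1]
    · rw [hgT z.1 (by
        by_contra h2
        exact hz ⟨by linarith, by linarith⟩), mul_zero]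

/-- The measure of a higher level set is controlled by the measure of a lower one. -/
theorem IsFlow.volume_superlevel_le (hn : 2 ≤ n) (h : IsFlow m S M L Λ K T r V b) (hm : 0 < m)
    (hk : 0 < k) (hkk' : k < k') (hc0 : 0 < c0) (hc1 : 0 ≤ c1) (hL : 0 ≤ L) (hΛ : 0 ≤ Λ)
    (hM : 0 ≤ M)
    (ha : ∀ ρ, k ≤ ρ → ρ ≤ S → c0 ≤ m * ρ ^ (m - 1) ∧ m * ρ ^ (m - 1) ≤ c1)
    (hKk : K ≤ k) {μ σ : ℝ} (hμ : 0 ≤ μ)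
    (hsμ : ∀ᵐ t, t ∈ Ioo 0 T → volume {x | k < r (t, x)} ≤ ENNReal.ofReal μ) (hσ0 : 0 < σ)
    (hσ : sobolevConst n * μ ^ (1 / (n : ℝ)) ≤ σ) :
    ∀ᵐ t, t ∈ Ioo 0 T → volume {x | k' < r (t, x)} ≤
      ENNReal.ofReal (Λ * S ^ 3 * μ / (c0 / (9 * σ ^ 2)) / (k' - k) ^ 3) := by
  have hall : ∀ᵐ t, ∀ R : ℕ, t ∈ Ioo 0 T →
      ∫ x, (ball 0 (R : ℝ)).indicator (fun _ => (1 : ℝ)) x * max (r (t, x) - k) 0 ^ 3 ≤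
        Λ * S ^ 3 * μ / (c0 / (9 * σ ^ 2)) :=
    ae_all_iff.2 fun R => h.ae_integral_excess_le hn hm hk hc0 hc1 hL hΛ hM ha hKk hμ hsμ hσ0 hσ R
  filter_upwards [hall] with t ht htT
  have hd : 0 < (k' - k) ^ 3 := pow_pos (sub_pos.2 hkk') 3
  have hmeas : Measurable fun x => r (t, x) := h.measurable.comp (by fun_prop)
  have hset : MeasurableSet {x | k' < r (t, x)} := measurableSet_lt measurable_const hmeas
  -- The cubic bound is available on balls, uniformly in the radius. Chebyshev's inequality is
  -- applied on each ball and the measures increase to that of the whole level set.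
  have hU : {x | k' < r (t, x)} = ⋃ R : ℕ, {x | k' < r (t, x)} ∩ ball 0 (R : ℝ) := by
    rw [← inter_iUnion, iUnion_ball_nat, inter_univ]
  have hmono : Monotone fun R : ℕ => {x | k' < r (t, x)} ∩ ball (0 : Space n) (R : ℝ) :=
    fun i j hij => inter_subset_inter_right _ (ball_subset_ball (by exact_mod_cast hij))
  rw [hU, hmono.measure_iUnion]
  refine iSup_le fun R => ?_
  set s := {x | k' < r (t, x)} ∩ ball (0 : Space n) (R : ℝ) with hs
  have hsm : MeasurableSet s := hset.inter measurableSet_ball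
  have hsfin : volume s ≠ ⊤ := ((measure_mono inter_subset_right).trans_lt measure_ball_lt_top).ne
  rw [← ofReal_measureReal hsfin]
  refine ENNReal.ofReal_le_ofReal ?_
  rw [le_div_iff₀ hd]
  refine le_trans ?_ (ht R htT)
  have e : volume.real s * (k' - k) ^ 3 = ∫ x, s.indicator (fun _ => (k' - k) ^ 3) x := by
    rw [integral_indicator hsm, setIntegral_const, smul_eq_mul]
  rw [e]
  refine integral_mono ((integrable_indicator_iff hsm).2 (integrableOn_const hsfin)) ?_ fun x => ?_
  · have hb : Integrable ((ball (0 : Space n) (R : ℝ)).indicator fun _ => (1 : ℝ)) :=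
      (integrable_indicator_iff measurableSet_ball).2 (integrableOn_const measure_ball_lt_top.ne)
    refine hb.mul_bdd (c := S ^ 3)
      ((((hmeas.sub_const k).max measurable_const).pow_const 3).aestronglyMeasurable)
      (Eventually.of_forall fun x => ?_)
    have hu := h.excess_mem_Icc hk (t, x)
    rw [Real.norm_of_nonneg (pow_nonneg hu.1 3)]
    exact pow_le_pow_left₀ hu.1 hu.2 3
  · by_cases hx : x ∈ s
    · rw [indicator_of_mem hx, indicator_of_mem hx.2, one_mul]
      have hx1 : k' < r (t, x) := hx.1
      exact pow_le_pow_left₀ (by linarith) ((by linarith : k' - k ≤ r (t, x) - k).trans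
        (le_max_left _ _)) 3
    · rw [indicator_of_notMem hx]
      exact mul_nonneg (indicator_nonneg (fun _ _ => zero_le_one) _)
        (pow_nonneg (le_max_right _ _) 3)

/-! ### The De Giorgi iteration. -/

variable {n : ℕ}

variable {m S M L Λ K T : ℝ} {r : ℝ × Space n → ℝ} {V b : ℝ × Space n → Space n}

/-- Chebyshev's inequality with the mass; it starts the iteration. -/
theorem IsSlice.volume_superlevel_le {r : Space n → ℝ} {V b : Space n → Space n} {k : ℝ}
    (h : IsSlice m S M L Λ r V b) (hk : 0 < k) :
    volume {x | k < r x} ≤ ENNReal.ofReal (M / k) := by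
  have h1 := mul_meas_ge_le_integral_of_nonneg (μ := volume)
    (Eventually.of_forall fun x => (h.mem_Icc x).1) h.integrable k
  have hfin : volume {x | k ≤ r x} ≠ ⊤ := by
    have := h.integrable.measure_ge_lt_top hk
    exact this.ne
  refine (measure_mono (t := {x | k ≤ r x}) fun x (hx : k < r x) => hx.le).trans ?_
  rw [← ofReal_measureReal hfin]
  refine ENNReal.ofReal_le_ofReal ((le_div_iff₀ hk).2 ?_)
  rw [mul_comm]
  exact h1.trans h.mass

/-- Between `S / 4` and `S` the diffusion coefficient is comparable to `S^(m-1)`. The minimum and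
maximum treat slow and fast diffusion together, since the monotonicity of the power depends on the
sign of `m - 1`. -/
theorem rpow_sub_one_bounds (hm : 0 < m) (hS : 0 < S) {ρ : ℝ} (h1 : S / 4 ≤ ρ) (h2 : ρ ≤ S) :
    m * min 1 ((1 / 4 : ℝ) ^ (m - 1)) * S ^ (m - 1) ≤ m * ρ ^ (m - 1) ∧
      m * ρ ^ (m - 1) ≤ m * max 1 ((1 / 4 : ℝ) ^ (m - 1)) * S ^ (m - 1) := by
  have e : (S / 4) ^ (m - 1) = (1 / 4 : ℝ) ^ (m - 1) * S ^ (m - 1) := by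
    rw [← Real.mul_rpow (by norm_num) hS.le]
    congr 1
    ring
  have hS' : 0 < S ^ (m - 1) := Real.rpow_pos_of_pos hS _
  have hρ : 0 < ρ := by linarith
  rw [mul_assoc, mul_assoc]
  rcases le_total 1 m with h | h
  · have l1 := Real.rpow_le_rpow (by linarith) h1 (sub_nonneg.2 h)
    have l2 := Real.rpow_le_rpow hρ.le h2 (sub_nonneg.2 h)
    rw [e] at l1
    constructor
    · gcongr
      exact (mul_le_mul_of_nonneg_right (min_le_right _ _) hS'.le).trans l1
    · gcongr
      exact l2.trans (le_mul_of_one_le_left hS'.le (le_max_left _ _))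
  · have l1 := Real.rpow_le_rpow_of_nonpos (by linarith) h1 (sub_nonpos.2 h)
    have l2 := Real.rpow_le_rpow_of_nonpos hρ h2 (sub_nonpos.2 h)
    rw [e] at l1
    constructor
    · gcongr
      exact (mul_le_of_le_one_left hS'.le (min_le_left _ _)).trans l2
    · gcongr
      exact l1.trans (mul_le_mul_of_nonneg_right (le_max_right _ _) hS'.le)

/-- The fast geometric decay of the level sets in the iteration. -/
theorem level_step {s c' a q Λ X : ℝ} (hS : 0 < S) (hc' : 0 < c') (hX : 0 < X)
    (hq : 4608 * Λ * s ^ 2 / c' / X * a ^ 2 ≤ q) {μ : ℝ} (hμ : 0 ≤ μ) {p : ℝ} (hp : p ^ 2 = 1 / 8)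
    (j : ℕ) :
    Λ * S ^ 3 * μ / (c' * X / (9 * (s * (a * p ^ j)) ^ 2)) / (S / 4 * (1 / 2) ^ (j + 1)) ^ 3 ≤
      q * μ := by
  -- The cubed level gap contributes `8^j`, and `σ²` contributes `p^(2j) = 8^(-j)`; they cancel, so
  -- the ratio does not depend on `j`. The constant is `4608 = 9 · 4³ · 8`.
  have hpj : (p ^ j) ^ 2 = (1 / 8) ^ j := by rw [← pow_mul, mul_comm, pow_mul, hp]
  have h8 : ((1 / 2 : ℝ) ^ (j + 1)) ^ 3 = (1 / 8) ^ j / 8 := by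
    rw [← pow_mul, mul_comm, pow_mul, pow_succ]
    norm_num [div_eq_mul_inv]
  have hpos : (0 : ℝ) < (1 / 8) ^ j := by positivity
  refine le_trans (le_of_eq ?_) (mul_le_mul_of_nonneg_right hq hμ)
  have e1 : (s * (a * p ^ j)) ^ 2 = s ^ 2 * a ^ 2 * (1 / 8) ^ j := by
    rw [mul_pow, mul_pow, hpj]
    ring
  rw [e1, mul_pow, h8]
  generalize (1 / 8 : ℝ) ^ j = w at hpos
  rw [div_div_eq_mul_div]
  field_simp
  ring

/-- A bounded flow which is bounded by a sufficiently large constant obeys the bound with half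
that constant. -/
theorem exists_halving_threshold (hn : 2 ≤ n) (hm : 1 - 2 / (n : ℝ) < m) (hM : 0 ≤ M)
    (hΛ : 0 ≤ Λ) :
    ∃ S₀ : ℝ, 0 < S₀ ∧ ∀ S, S₀ ≤ S → ∀ K L T : ℝ, 4 * K ≤ S → 0 ≤ L →
      ∀ (r : ℝ × Space n → ℝ) (V b : ℝ × Space n → Space n), IsFlow m S M L Λ K T r V b →
        ∀ᵐ t, t ∈ Ioo 0 T → ∀ᵐ x, r (t, x) ≤ S / 2 := by
  have hn0 : (0 : ℝ) < n := by positivity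
  have hn2 : (2 : ℝ) ≤ n := by exact_mod_cast hn
  have hm0 : 0 < m := by
    have : 2 / (n : ℝ) ≤ 1 := (div_le_one hn0).2 hn2
    linarith
  -- Adding 1 makes `σ` strictly positive whatever the Sobolev constant is.
  set s := sobolevConst n + 1 with hs
  have hsn : 0 ≤ sobolevConst n := sobolevConst_nonneg n
  set c' := m * min 1 ((1 / 4 : ℝ) ^ (m - 1)) with hc'
  have hc'0 : 0 < c' := mul_pos hm0 (lt_min one_pos (by positivity))
  -- The decay rate is fixed by `q^(2/n) = 1 / 8`: the gain `μ^(2/n)` from the Sobolev inequality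
  -- must offset the factor 8 lost when the level gap is halved.
  set q : ℝ := (1 / 8 : ℝ) ^ ((n : ℝ) / 2) with hq
  have hq0 : 0 < q := by positivity
  have hq1 : q < 1 := Real.rpow_lt_one (by norm_num) (by norm_num) (by positivity)
  set p : ℝ := q ^ (1 / (n : ℝ)) with hp
  have hp2 : p ^ 2 = 1 / 8 := by
    rw [hp, ← Real.rpow_natCast, ← Real.rpow_mul hq0.le, hq, ← Real.rpow_mul (by norm_num)]
    have : (n : ℝ) / 2 * (1 / n * ((2 : ℕ) : ℝ)) = 1 := by
      push_cast
      field_simp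
    rw [this, Real.rpow_one]
  -- A positive majorant of the mass keeps all the measures `μ j` positive, also when `M = 0`.
  set M₀ := M + 1 with hM₀
  -- The place where `m > 1 - 2 / n` is decisive: diffusion of size `S^(m-1)` together with the
  -- level-set gain `S^(-2/n)` beats the drift for large `S`.
  have hα : 0 < m - 1 + 2 / n := by linarith
  have hlim : Tendsto (fun S : ℝ => 4608 * Λ * s ^ 2 / c' * (4 * M₀) ^ (2 / (n : ℝ)) *
      S ^ (-(m - 1 + 2 / (n : ℝ)))) atTop (𝓝 0) := by
    have := (tendsto_rpow_neg_atTop hα).const_mul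
      (4608 * Λ * s ^ 2 / c' * (4 * M₀) ^ (2 / (n : ℝ)))
    rwa [mul_zero] at this
  obtain ⟨S₁, hS₁⟩ := eventually_atTop.1 (hlim.eventually_lt_const hq0)
  refine ⟨max S₁ 1, by positivity, fun S hSS K L T hK hL r V b h => ?_⟩
  have hS : 0 < S := lt_of_lt_of_le one_pos ((le_max_right _ _).trans hSS)
  have hqS := hS₁ S ((le_max_left _ _).trans hSS)
  set a := (4 * M₀ / S) ^ (1 / (n : ℝ)) with ha
  have ha2 : a ^ 2 = (4 * M₀) ^ (2 / (n : ℝ)) * S ^ (-(2 / (n : ℝ))) := by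
    have hM4 : 0 ≤ 4 * M₀ := by positivity
    rw [ha, ← Real.rpow_natCast, ← Real.rpow_mul (by positivity), Real.rpow_neg hS.le,
      ← div_eq_mul_inv, ← Real.div_rpow hM4 hS.le]
    congr 1
    push_cast
    ring
  set X := S ^ (m - 1) with hX
  have hX0 : 0 < X := Real.rpow_pos_of_pos hS _
  have hqX : 4608 * Λ * s ^ 2 / c' / X * a ^ 2 ≤ q := by
    refine le_trans (le_of_eq ?_) hqS.le
    rw [ha2, hX, neg_add, Real.rpow_add hS, Real.rpow_neg hS.le (m - 1)]
    field_simp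
  set μ : ℕ → ℝ := fun j => 4 * M₀ / S * q ^ j with hμ
  have hμ0 : ∀ j, 0 < μ j := fun j => by positivity
  -- The levels increase from `S / 4` to `S / 2`. All of them lie above the initial datum because `4
  -- K ≤ S`.
  set k : ℕ → ℝ := fun j => S / 2 - S / 4 * (1 / 2) ^ j with hk
  have hpow : ∀ j : ℕ, (1 / 2 : ℝ) ^ j ≤ 1 := fun j => pow_le_one₀ (by norm_num) (by norm_num)
  have hkS : ∀ j, S / 4 ≤ k j := fun j => by
    have := mul_le_mul_of_nonneg_left (hpow j) (by positivity : 0 ≤ S / 4)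
    simp only [hk]
    linarith
  have hkS' : ∀ j, k j ≤ S / 2 := fun j => by
    have : 0 ≤ S / 4 * (1 / 2) ^ j := by positivity
    simp only [hk]
    linarith
  have hkk : ∀ j, k (j + 1) - k j = S / 4 * (1 / 2) ^ (j + 1) := fun j => by
    simp only [hk, pow_succ]
    ring
  have hlev : ∀ j, ∀ᵐ t, t ∈ Ioo 0 T → volume {x | k j < r (t, x)} ≤ ENNReal.ofReal (μ j) := by
    intro j
    induction j with
    | zero =>
      filter_upwards [h.slice] with t ht htT
      refine ((ht htT).volume_superlevel_le ((by positivity : 0 < S / 4).trans_le (hkS 0))).trans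
        (ENNReal.ofReal_le_ofReal ?_)
      have e : k 0 = S / 4 := by simp only [hk]; ring
      rw [e]
      simp only [hμ, pow_zero, mul_one, hM₀]
      rw [div_div_eq_mul_div]
      exact div_le_div_of_nonneg_right (by linarith) hS.le
    | succ j ih =>
      have hd : k j < k (j + 1) := by
        have : 0 < S / 4 * (1 / 2) ^ (j + 1) := by positivity
        linarith [hkk j]
      have hμn : μ j ^ (1 / (n : ℝ)) = a * p ^ j := by
        rw [hμ, Real.mul_rpow (by positivity) (by positivity), ha, hp, ← Real.rpow_natCast q,
          ← Real.rpow_natCast (q ^ _), ← Real.rpow_mul hq0.le, ← Real.rpow_mul hq0.le,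
          mul_comm (j : ℝ)]
      have hap : 0 < a * p ^ j := by rw [← hμn]; exact Real.rpow_pos_of_pos (hμ0 j) _
      have hstep := h.volume_superlevel_le (c0 := c' * X)
        (c1 := m * max 1 ((1 / 4 : ℝ) ^ (m - 1)) * X) (σ := s * (a * p ^ j)) hn hm0
        ((by positivity : 0 < S / 4).trans_le (hkS j)) hd (by positivity) (by positivity) hL hΛ hM
        (fun ρ h1 h2 => rpow_sub_one_bounds hm0 hS ((hkS j).trans h1) h2)
        (by linarith [hkS j]) (hμ0 j).le ih (by positivity)
        (by rw [hμn]; exact mul_le_mul_of_nonneg_right (by linarith) hap.le)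
      filter_upwards [hstep] with t ht htT
      refine (ht htT).trans (ENNReal.ofReal_le_ofReal ?_)
      rw [hkk j]
      refine (level_step hS hc'0 hX0 hqX (hμ0 j).le hp2 j).trans (le_of_eq ?_)
      simp only [hμ, pow_succ]
      ring
  filter_upwards [ae_all_iff.2 hlev] with t ht htT
  rw [ae_iff]
  simp only [not_le]
  -- The set `{r > S / 2}` is contained in every level set of the iteration, and their measures tend
  -- to zero.
  have hz : Tendsto (fun j => ENNReal.ofReal (μ j)) atTop (𝓝 0) := by
    have := ENNReal.tendsto_ofReal ((tendsto_pow_atTop_nhds_zero_of_lt_one hq0.le hq1).const_mul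
      (4 * M₀ / S))
    simpa using this
  refine le_antisymm (ge_of_tendsto' hz fun j => ?_) zero_le
  exact (measure_mono fun x (hx : S / 2 < r (t, x)) => (hkS' j).trans_lt hx).trans (ht j htT)

/-! ### The interaction field and its regular part. -/

variable {n : ℕ}

variable {A B lam s : ℝ}

/-- The closed form of `∇U` away from the origin. -/
noncomputable def interactionField (n : ℕ) (A B lam : ℝ) (x : Space n) : Space n :=
  (‖x‖ ^ (A - 2) - lam * ‖x‖ ^ (B - 2)) • x

/-- The interaction field without its singularity at the origin. -/
noncomputable def regularField (n : ℕ) (A B lam : ℝ) (x : Space n) : Space n :=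
  (max ‖x‖ 1 ^ (A - 2) - lam * max ‖x‖ 1 ^ (B - 2)) • x

theorem measurable_interactionField : Measurable (interactionField n A B lam) :=
  ((measurable_norm.pow_const _).sub ((measurable_norm.pow_const _).const_mul _)).smul
    measurable_id

theorem measurable_regularField : Measurable (regularField n A B lam) :=
  (((measurable_norm.max measurable_const).pow_const _).sub
    (((measurable_norm.max measurable_const).pow_const _).const_mul _)).smul measurable_id

theorem hasGradientAt_powerProfile_norm (s : ℝ) {x : Space n} (hx : x ≠ 0) :
    HasGradientAt (fun y : Space n => powerProfile s ‖y‖) (‖x‖ ^ (s - 2) • x) x := by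
  have hx0 : 0 < ‖x‖ := norm_pos_iff.2 hx
  have h1 : HasDerivAt (powerProfile s) (‖x‖ ^ (s - 1)) ‖x‖ := by
    by_cases hs : s = 0
    · have e : powerProfile s = Real.log := by ext r; simp [powerProfile, hs]
      rw [e, hs, zero_sub, Real.rpow_neg_one]
      exact Real.hasDerivAt_log hx0.ne'
    · have e : powerProfile s = fun r => r ^ s / s := by ext r; simp [powerProfile, hs]
      rw [e]
      have := (Real.hasDerivAt_rpow_const (p := s) (Or.inl hx0.ne')).div_const s
      rwa [mul_div_cancel_left₀ _ hs] at this
  -- The norm is written as the square root of the squared norm, whose derivative is explicit.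
  have h2 : HasDerivAt (fun q : ℝ => powerProfile s (√q)) (‖x‖ ^ (s - 1) * (1 / (2 * ‖x‖)))
      (‖x‖ ^ 2) := by
    have hsq := Real.hasDerivAt_sqrt (pow_pos hx0 2).ne'
    rw [Real.sqrt_sq hx0.le] at hsq
    refine HasDerivAt.comp (h₂ := powerProfile s) (‖x‖ ^ 2) ?_ hsq
    rwa [Real.sqrt_sq hx0.le]
  have h3 := h2.comp_hasFDerivAt (f := fun y : Space n => ‖y‖ ^ 2) x
    (hasStrictFDerivAt_norm_sq x).hasFDerivAt
  have h4 := h3.congr_of_eventuallyEq (f₁ := fun y : Space n => powerProfile s ‖y‖)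
    (Eventually.of_forall fun y => by simp [Real.sqrt_sq (norm_nonneg y)])
  rw [hasGradientAt_iff_hasFDerivAt]
  refine h4.congr_fderiv ?_
  ext v
  have e : ‖x‖ ^ (s - 2) = ‖x‖ ^ (s - 1) / ‖x‖ := by
    rw [← Real.rpow_sub_one hx0.ne']
    congr 1
    ring
  simp [e]
  field_simp

theorem potentialGradient_eq {x : Space n} (hx : x ≠ 0) :
    potentialGradient n A B lam x = interactionField n A B lam x := by
  have hA := (hasGradientAt_powerProfile_norm A hx).hasFDerivAt
  have hB := (hasGradientAt_powerProfile_norm B hx).hasFDerivAt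
  have h : HasGradientAt (potential n A B lam) (interactionField n A B lam x) x := by
    rw [hasGradientAt_iff_hasFDerivAt]
    refine (hA.sub (hB.const_mul lam)).congr_fderiv ?_
    ext v
    simp [interactionField]
    ring
  exact h.gradient

/-- For `s ≤ 2` the power `t^(s-2)` is convex and lies above its tangent at `t = 1`. This bounds the
variation of the truncated radial factor, and truncation at 1 keeps `x^(s-2) ≤ 1`. -/
theorem truncated_power_mul_le (hs : s ≤ 2) {a b : ℝ} (hab : a ≤ b) :
    (max a 1 ^ (s - 2) - max b 1 ^ (s - 2)) * a ≤ (2 - s) * (b - a) := by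
  set x := max a 1 with hx
  set y := max b 1 with hy
  have hx1 : 1 ≤ x := le_max_right _ _
  have hxy : x ≤ y := max_le_max_right _ hab
  have hd : y - x ≤ b - a := by
    rcases le_total b 1 with h | h
    · have e : y = 1 := max_eq_right h
      linarith
    · have e : y = b := max_eq_left h
      linarith [le_max_left a 1]
  have hx0 : 0 < x := by linarith
  have hy0 : 0 < y := by linarith
  have hp : 0 ≤ x ^ (s - 2) - y ^ (s - 2) :=
    sub_nonneg.2 (Real.rpow_le_rpow_of_nonpos hx0 hxy (by linarith))
  have hu : 1 + (s - 2) * (y / x - 1) ≤ (y / x) ^ (s - 2) := by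
    rw [Real.rpow_def_of_pos (div_pos hy0 hx0)]
    have h1 := Real.add_one_le_exp (Real.log (y / x) * (s - 2))
    have h2 := Real.log_le_sub_one_of_pos (div_pos hy0 hx0)
    nlinarith
  have hy' : y ^ (s - 2) = x ^ (s - 2) * (y / x) ^ (s - 2) := by
    rw [← Real.mul_rpow hx0.le (div_pos hy0 hx0).le, mul_div_cancel₀ _ hx0.ne']
  have h1 : x ^ (s - 2) ≤ 1 := Real.rpow_le_one_of_one_le_of_nonpos hx1 (by linarith)
  have h1' : 0 < x ^ (s - 2) := Real.rpow_pos_of_pos hx0 _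
  have h3 : (x ^ (s - 2) - y ^ (s - 2)) * x ≤ x ^ (s - 2) * ((2 - s) * (y - x)) := by
    have e : x ^ (s - 2) * ((2 - s) * (y - x)) = (x ^ (s - 2) * ((2 - s) * (y / x - 1))) * x := by
      field_simp
    rw [e, hy']
    refine mul_le_mul_of_nonneg_right ?_ hx0.le
    nlinarith
  have h4 : 0 ≤ (2 - s) * (y - x) := mul_nonneg (by linarith) (by linarith)
  calc (x ^ (s - 2) - y ^ (s - 2)) * a ≤ (x ^ (s - 2) - y ^ (s - 2)) * x :=
        mul_le_mul_of_nonneg_left (le_max_left _ _) hp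
    _ ≤ x ^ (s - 2) * ((2 - s) * (y - x)) := h3
    _ ≤ (2 - s) * (y - x) := mul_le_of_le_one_left h4 h1
    _ ≤ (2 - s) * (b - a) := mul_le_mul_of_nonneg_left hd (by linarith)

/-- The difference splits into a change of the radial factor at the shorter vector, of cost `2 - s`,
and a displacement with a factor at most 1; together `3 - s`. -/
theorem norm_truncated_power_sub_le (hs : s ≤ 2) (x y : Space n) :
    ‖max ‖x‖ 1 ^ (s - 2) • x - max ‖y‖ 1 ^ (s - 2) • y‖ ≤ (3 - s) * ‖x - y‖ := by
  wlog hxy : ‖x‖ ≤ ‖y‖ generalizing x y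
  · rw [norm_sub_rev, norm_sub_rev x y]
    exact this y x (not_le.1 hxy).le
  have h1 := truncated_power_mul_le hs hxy
  have h2 : max ‖y‖ 1 ^ (s - 2) ≤ max ‖x‖ 1 ^ (s - 2) :=
    Real.rpow_le_rpow_of_nonpos (by positivity) (max_le_max_right _ hxy) (by linarith)
  have h3 : max ‖y‖ 1 ^ (s - 2) ≤ 1 :=
    Real.rpow_le_one_of_one_le_of_nonpos (le_max_right _ _) (by linarith)
  have e : max ‖x‖ 1 ^ (s - 2) • x - max ‖y‖ 1 ^ (s - 2) • y =
      (max ‖x‖ 1 ^ (s - 2) - max ‖y‖ 1 ^ (s - 2)) • x + max ‖y‖ 1 ^ (s - 2) • (x - y) := by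
    module
  rw [e]
  refine (norm_add_le _ _).trans ?_
  rw [norm_smul, norm_smul, Real.norm_of_nonneg (sub_nonneg.2 h2),
    Real.norm_of_nonneg (by positivity)]
  have h4 := mul_le_mul_of_nonneg_right h3 (norm_nonneg (x - y))
  have h5 : ‖y‖ - ‖x‖ ≤ ‖x - y‖ := by rw [norm_sub_rev]; exact norm_sub_norm_le y x
  nlinarith [mul_le_mul_of_nonneg_left h5 (by linarith : 0 ≤ 2 - s)]

theorem norm_regularField_sub_le (hA : A ≤ 2) (hB : B ≤ 2) (hlam : 0 ≤ lam) (x y : Space n) :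
    ‖regularField n A B lam x - regularField n A B lam y‖ ≤
      ((3 - A) + lam * (3 - B)) * ‖x - y‖ := by
  have e : regularField n A B lam x - regularField n A B lam y =
      (max ‖x‖ 1 ^ (A - 2) • x - max ‖y‖ 1 ^ (A - 2) • y) -
        lam • (max ‖x‖ 1 ^ (B - 2) • x - max ‖y‖ 1 ^ (B - 2) • y) := by
    rw [regularField, regularField]
    module
  rw [e]
  refine (norm_sub_le _ _).trans ?_
  rw [norm_smul, Real.norm_of_nonneg hlam]
  have h1 := norm_truncated_power_sub_le hA x y
  have h2 := mul_le_mul_of_nonneg_left (norm_truncated_power_sub_le hB x y) hlam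
  linarith

/-- In polar coordinates the integrand becomes `y^(n + s - 2)`, whose exponent is positive. -/
theorem integrableOn_norm_rpow_mul_norm (hn : 2 ≤ n) (hs : 2 - (n : ℝ) < s) (R : ℝ) :
    IntegrableOn (fun x : Space n => ‖x‖ ^ (s - 2) * ‖x‖) (ball 0 R) := by
  have : Nonempty (Fin n) := ⟨⟨0, by omega⟩⟩
  refine (integrableOn_fun_norm_addHaar volume (f := fun y : ℝ => y ^ (s - 2) * y)).2 ?_
  rw [finrank_euclideanSpace_fin]
  have h1 : IntegrableOn (fun y : ℝ => y ^ ((n : ℝ) + s - 2)) (Ioo 0 R) := by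
    rcases le_total 0 R with hR | hR
    · have := (intervalIntegral.intervalIntegrable_rpow' (a := 0) (b := R)
        (r := (n : ℝ) + s - 2) (by linarith)).1
      exact this.mono_set Ioo_subset_Ioc_self
    · rw [Ioo_eq_empty (by linarith)]
      exact integrableOn_empty
  refine h1.congr_fun (fun y hy => ?_) measurableSet_Ioo
  have hy0 : 0 < y := hy.1
  simp only [smul_eq_mul]
  have e1 : y ^ (n - 1) = y ^ ((n : ℝ) - 1) := by
    rw [← Real.rpow_natCast, Nat.cast_sub (by omega), Nat.cast_one]
  rw [e1]
  nth_rewrite 4 [← Real.rpow_one y]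
  rw [← Real.rpow_add hy0, ← Real.rpow_add hy0]
  congr 1
  ring

/-- The two fields agree outside the unit ball, and inside it the singular powers are integrable. -/
theorem integrable_interactionField_sub (hn : 2 ≤ n) (hA : 2 - (n : ℝ) < A)
    (hB : 2 - (n : ℝ) < B) :
    Integrable fun x => interactionField n A B lam x - regularField n A B lam x := by
  have e : (fun x => interactionField n A B lam x - regularField n A B lam x) =
      (ball 0 1).indicator fun x => interactionField n A B lam x - regularField n A B lam x := by
    ext1 x
    by_cases hx : x ∈ ball (0 : Space n) 1
    · rw [indicator_of_mem hx]
    · rw [indicator_of_notMem hx, interactionField, regularField,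
        max_eq_left (by simpa using hx), sub_self]
  rw [e, integrable_indicator_iff measurableSet_ball]
  have h0 := ((integrableOn_norm_rpow_mul_norm hn hA 1).add
    ((integrableOn_norm_rpow_mul_norm hn hB 1).const_mul |lam|)).add
    (integrableOn_const (s := ball (0 : Space n) 1) (C := 1 + |lam|) measure_ball_lt_top.ne)
  refine h0.mono' (measurable_interactionField.sub measurable_regularField).aestronglyMeasurable ?_
  filter_upwards [ae_restrict_mem measurableSet_ball] with x hx
  have hx1 : ‖x‖ ≤ 1 := (mem_ball_zero_iff.1 hx).le
  refine (norm_sub_le _ _).trans (add_le_add ?_ ?_)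
  · rw [interactionField, norm_smul]
    refine (mul_le_mul_of_nonneg_right (norm_sub_le _ _) (norm_nonneg _)).trans ?_
    rw [norm_mul, Real.norm_of_nonneg (by positivity : 0 ≤ ‖x‖ ^ (A - 2)),
      Real.norm_of_nonneg (by positivity : 0 ≤ ‖x‖ ^ (B - 2)), Real.norm_eq_abs]
    simp only [Pi.add_apply]
    linarith
  · rw [regularField, max_eq_right hx1, norm_smul, Real.one_rpow, Real.one_rpow]
    refine (mul_le_of_le_one_right (norm_nonneg _) hx1).trans ((norm_sub_le _ _).trans ?_)
    simp

/-! ### The divergence of the interaction field is bounded above. -/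

variable {n : ℕ}

variable {A B lam : ℝ}

/-- Integration by parts for the vector field `x ↦ G x • x`. -/
theorem integral_inner_smul_id {G ψ : Space n → ℝ} (hG : ContDiff ℝ 1 G) (hψ : ContDiff ℝ 1 ψ)
    (hc : HasCompactSupport ψ) :
    - ∫ x, inner ℝ (G x • x) (gradient ψ x) = ∫ x, (n * G x + fderiv ℝ G x x) * ψ x := by
  have hdψ : ∀ v : Space n, Continuous fun x => fderiv ℝ ψ x v := fun v =>
    (hψ.continuous_fderiv one_ne_zero).clm_apply continuous_const
  have hcψ : ∀ v : Space n, HasCompactSupport fun x => fderiv ℝ ψ x v := fun v =>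
    hc.fderiv_apply (𝕜 := ℝ) v
  set e : Fin n → Space n := fun i => EuclideanSpace.single i 1 with he
  have hfi : ∀ (i : Fin n) (x : Space n), HasFDerivAt (fun x : Space n => G x * x i)
      (G x • (EuclideanSpace.proj i : Space n →L[ℝ] ℝ) + x i • fderiv ℝ G x) x := fun i x => by
    have h1 : HasFDerivAt (fun x : Space n => x i) (EuclideanSpace.proj i : Space n →L[ℝ] ℝ) x :=
      (EuclideanSpace.proj i : Space n →L[ℝ] ℝ).hasFDerivAt
    exact (hG.differentiable one_ne_zero x).hasFDerivAt.mul h1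
  have hfd : ∀ (i : Fin n) (x : Space n), fderiv ℝ (fun x : Space n => G x * x i) x (e i) =
      G x + x i * fderiv ℝ G x (e i) := fun i x => by
    rw [(hfi i x).fderiv]
    simp [he]
  have hxi : ∀ i : Fin n, Continuous fun x : Space n => x i := fun i =>
    (EuclideanSpace.proj i : Space n →L[ℝ] ℝ).continuous
  have hdG : ∀ v : Space n, Continuous fun x => fderiv ℝ G x v := fun v =>
    (hG.continuous_fderiv one_ne_zero).clm_apply continuous_const
  have i1 : ∀ i : Fin n, Integrable fun x : Space n => (G x * x i) * fderiv ℝ ψ x (e i) := fun i =>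
    ((hG.continuous.mul (hxi i)).mul (hdψ _)).integrable_of_hasCompactSupport (hcψ _).mul_left
  have i2 : ∀ i : Fin n, Integrable fun x : Space n => (G x + x i * fderiv ℝ G x (e i)) * ψ x :=
    fun i => ((hG.continuous.add ((hxi i).mul (hdG _))).mul
      hψ.continuous).integrable_of_hasCompactSupport hc.mul_left
  have hparts : ∀ i : Fin n, ∫ x : Space n, (G x * x i) * fderiv ℝ ψ x (e i) =
      - ∫ x, (G x + x i * fderiv ℝ G x (e i)) * ψ x := fun i => by
    rw [integral_mul_fderiv_eq_neg_fderiv_mul_of_integrable (f := fun x : Space n => G x * x i)]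
    · simp_rw [hfd]
    · simp_rw [hfd]
      exact i2 i
    · exact i1 i
    · exact ((hG.continuous.mul (hxi i)).mul hψ.continuous).integrable_of_hasCompactSupport
        hc.mul_left
    · exact fun x _ => (hfi i x).differentiableAt
    · exact fun x _ => hψ.differentiable one_ne_zero x
  have hsum : ∀ x : Space n, x = ∑ i, x i • e i := fun x => by
    ext j
    simp [he, Pi.single_apply]
  have hlin : ∀ (D : Space n →L[ℝ] ℝ) (x : Space n), D x = ∑ i, x i * D (e i) := fun D x => by
    conv_lhs => rw [hsum x]
    simp
  have h1 : ∀ x : Space n, inner ℝ (G x • x) (gradient ψ x) =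
      ∑ i, (G x * x i) * fderiv ℝ ψ x (e i) := fun x => by
    rw [real_inner_comm, inner_gradient, map_smul, hlin, smul_eq_mul, Finset.mul_sum]
    exact Finset.sum_congr rfl fun i _ => by ring
  have h2 : ∀ x : Space n, (n * G x + fderiv ℝ G x x) * ψ x =
      ∑ i, (G x + x i * fderiv ℝ G x (e i)) * ψ x := fun x => by
    rw [hlin (fderiv ℝ G x), ← Finset.sum_mul, Finset.sum_add_distrib]
    simp
  simp_rw [h1, h2]
  rw [integral_finsetSum _ fun i _ => i1 i, integral_finsetSum _ fun i _ => i2 i,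
    ← Finset.sum_neg_distrib]
  refine Finset.sum_congr rfl fun i _ => ?_
  rw [hparts i, neg_neg]

/-- The smoothed profile of the interaction field, as a function of `‖x‖ ^ 2 + ε`. -/
noncomputable def smoothProfile (A B lam p : ℝ) : ℝ :=
  p ^ ((A - 2) / 2) - lam * p ^ ((B - 2) / 2)

/-- The derivative of `smoothProfile`. -/
noncomputable def smoothProfileDeriv (A B lam p : ℝ) : ℝ :=
  (A - 2) / 2 * p ^ ((A - 2) / 2 - 1) - lam * ((B - 2) / 2 * p ^ ((B - 2) / 2 - 1))

theorem hasDerivAt_smoothProfile {p : ℝ} (hp : 0 < p) :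
    HasDerivAt (smoothProfile A B lam) (smoothProfileDeriv A B lam p) p :=
  (Real.hasDerivAt_rpow_const (Or.inl hp.ne')).sub
    ((Real.hasDerivAt_rpow_const (Or.inl hp.ne')).const_mul lam)

/-- The constant bounding the divergence of the interaction field. -/
theorem exists_divergence_bound (hn : 2 ≤ n) (hB : 2 - (n : ℝ) < B) (hBA : B < A) (hA : A ≤ 2)
    (hlam : 0 < lam) : ∃ Λ : ℝ, 0 ≤ Λ ∧ ∀ p q : ℝ, 0 < p → 0 ≤ q → q ≤ p →
      n * smoothProfile A B lam p + 2 * q * smoothProfileDeriv A B lam p ≤ Λ := by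
  have hn0 : (0 : ℝ) < n := by positivity
  -- With `p = |x|² + ε` and `q = |x|²`, the repulsive term is weakest for `q = p`, where its
  -- coefficient is `β`. Positivity of `β` is the condition `B > 2 - n`.
  set β := (n : ℝ) + B - 2 with hβ
  have hβ0 : 0 < β := by linarith
  -- At `p₀` the terms `n p^((A-2)/2)` and `lam β p^((B-2)/2)` balance. Below it repulsion dominates
  -- and the sum is nonpositive; above it the attractive power, nonincreasing since `A ≤ 2`, is at
  -- most its value at `p₀`.
  set p₀ := (lam * β / n) ^ (2 / (A - B)) with hp₀
  have hp₀0 : 0 < p₀ := by positivity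
  refine ⟨n * p₀ ^ ((A - 2) / 2), by positivity, fun p q hp hq hqp => ?_⟩
  have ea : p ^ ((A - 2) / 2 - 1) = p ^ ((A - 2) / 2) / p := Real.rpow_sub_one hp.ne' _
  have eb : p ^ ((B - 2) / 2 - 1) = p ^ ((B - 2) / 2) / p := Real.rpow_sub_one hp.ne' _
  set a := p ^ ((A - 2) / 2) with ha
  set b := p ^ ((B - 2) / 2) with hb
  have ha0 : 0 < a := Real.rpow_pos_of_pos hp _
  have hb0 : 0 < b := Real.rpow_pos_of_pos hp _
  have hw0 : 0 ≤ q / p := div_nonneg hq hp.le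
  have hw1 : q / p ≤ 1 := (div_le_one hp).2 hqp
  have e1 : n * smoothProfile A B lam p + 2 * q * smoothProfileDeriv A B lam p =
      n * a + (A - 2) * (q / p) * a - lam * (n * b + (B - 2) * (q / p) * b) := by
    rw [smoothProfile, smoothProfileDeriv, ea, eb]
    field_simp
    ring
  have h1 : (A - 2) * (q / p) * a ≤ 0 :=
    mul_nonpos_of_nonpos_of_nonneg (mul_nonpos_of_nonpos_of_nonneg (by linarith) hw0) ha0.le
  have h2 : β * b ≤ n * b + (B - 2) * (q / p) * b := by
    have : (2 - B) * (q / p) ≤ 2 - B := mul_le_of_le_one_right (by linarith) hw1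
    nlinarith
  have h3 : n * smoothProfile A B lam p + 2 * q * smoothProfileDeriv A B lam p ≤
      n * a - lam * (β * b) := by
    rw [e1]
    have := mul_le_mul_of_nonneg_left h2 hlam.le
    linarith
  refine h3.trans ?_
  rcases le_total p₀ p with h | h
  · have h4 : a ≤ p₀ ^ ((A - 2) / 2) := Real.rpow_le_rpow_of_nonpos hp₀0 h (by linarith)
    have h5 := mul_le_mul_of_nonneg_left h4 hn0.le
    have : 0 ≤ lam * (β * b) := by positivity
    linarith
  · have h4 : a = b * p ^ ((A - B) / 2) := by
      rw [ha, hb, ← Real.rpow_add hp]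
      congr 1
      ring
    have h5 : p ^ ((A - B) / 2) ≤ lam * β / n := by
      refine (Real.rpow_le_rpow hp.le h (by linarith)).trans (le_of_eq ?_)
      rw [hp₀, ← Real.rpow_mul (by positivity)]
      have : 2 / (A - B) * ((A - B) / 2) = 1 := by
        have : A - B ≠ 0 := by linarith
        field_simp
      rw [this, Real.rpow_one]
    have h6 : n * a ≤ lam * (β * b) := by
      rw [h4]
      rw [le_div_iff₀ hn0] at h5
      nlinarith
    have : 0 ≤ n * p₀ ^ ((A - 2) / 2) := by positivity
    linarith

/-- The divergence of the interaction field is bounded from above. -/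
theorem exists_divLE_interactionField (hn : 2 ≤ n) (hB : 2 - (n : ℝ) < B) (hBA : B < A)
    (hA : A ≤ 2) (hlam : 0 < lam) :
    ∃ Λ : ℝ, 0 ≤ Λ ∧ DivLE (interactionField n A B lam) Λ := by
  obtain ⟨Λ, hΛ, hbound⟩ := exists_divergence_bound hn hB hBA hA hlam
  refine ⟨Λ, hΛ, fun ψ hψ hc hψ0 => ?_⟩
  have : Nonempty (Fin n) := ⟨⟨0, by omega⟩⟩
  have hψ1 : ContDiff ℝ 1 ψ := hψ.of_le (by simp)
  -- Replacing `|x|²` by `|x|² + ε` makes the field smooth, and the divergence bound is uniform in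
  -- `ε`.
  set ε : ℕ → ℝ := fun j => 1 / ((j : ℝ) + 1) with hε
  have hε0 : ∀ j, 0 < ε j := fun j => by positivity
  set G : ℕ → Space n → ℝ := fun j x => smoothProfile A B lam (‖x‖ ^ 2 + ε j) with hG
  have hp : ∀ j (x : Space n), 0 < ‖x‖ ^ 2 + ε j := fun j x =>
    add_pos_of_nonneg_of_pos (sq_nonneg _) (hε0 j)
  have hGc : ∀ j, ContDiff ℝ 1 (G j) := fun j => by
    have h1 : ContDiff ℝ 1 fun x : Space n => ‖x‖ ^ 2 + ε j := (contDiff_norm_sq ℝ).add contDiff_const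
    exact (h1.rpow_const_of_ne fun x => (hp j x).ne').sub
      (contDiff_const.mul (h1.rpow_const_of_ne fun x => (hp j x).ne'))
  have hGd : ∀ j (x : Space n), fderiv ℝ (G j) x x =
      2 * ‖x‖ ^ 2 * smoothProfileDeriv A B lam (‖x‖ ^ 2 + ε j) := fun j x => by
    have h1 := ((hasStrictFDerivAt_norm_sq x).hasFDerivAt).add_const (ε j)
    have h2 := (hasDerivAt_smoothProfile (A := A) (B := B) (lam := lam) (hp j x)).comp_hasFDerivAt
      (f := fun y : Space n => ‖y‖ ^ 2 + ε j) x h1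
    have e : fderiv ℝ (G j) x = _ := h2.fderiv
    rw [e]
    simp
    ring
  have hj : ∀ j, - ∫ x, inner ℝ (G j x • x) (gradient ψ x) ≤ Λ * ∫ x, ψ x := fun j => by
    rw [integral_inner_smul_id (hGc j) hψ1 hc, ← integral_const_mul]
    have hdG : Continuous fun x => fderiv ℝ (G j) x x :=
      ((hGc j).continuous_fderiv one_ne_zero).clm_apply continuous_id
    refine integral_mono ?_ ((hψ1.continuous.integrable_of_hasCompactSupport hc).const_mul Λ)
      fun x => ?_
    · exact ((((hGc j).continuous.const_mul _).add hdG).mul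
        hψ1.continuous).integrable_of_hasCompactSupport hc.mul_left
    · refine mul_le_mul_of_nonneg_right ?_ (hψ0 x)
      rw [hGd]
      exact hbound _ _ (hp j x) (sq_nonneg _) (by linarith [hε0 j])
  obtain ⟨R, hR⟩ := (hasCompactSupport_gradient hc).isCompact.isBounded.subset_ball (0 : Space n)
  obtain ⟨C, hC⟩ := (continuous_gradient hψ1).bounded_above_of_compact_support
    (hasCompactSupport_gradient hc)
  have hz : ∀ x ∉ ball (0 : Space n) R, gradient ψ x = 0 := fun x hx =>
    image_eq_zero_of_notMem_tsupport fun h => hx (hR h)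
  have hlim : Tendsto (fun j => ∫ x, inner ℝ (G j x • x) (gradient ψ x)) atTop
      (𝓝 (∫ x, inner ℝ (interactionField n A B lam x) (gradient ψ x))) := by
    have hεt : Tendsto ε atTop (𝓝 0) := tendsto_one_div_add_atTop_nhds_zero_nat
    -- Both exponents are nonpositive, so adding `ε` only lowers the powers; the singular field
    -- itself, locally integrable, dominates.
    have hb := (integrable_indicator_iff measurableSet_ball).2
      (((integrableOn_norm_rpow_mul_norm hn (hB.trans hBA) R).add
        ((integrableOn_norm_rpow_mul_norm hn hB R).const_mul lam)).mul_const C)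
    refine tendsto_integral_of_dominated_convergence _ (fun j => ?_) hb (fun j => ?_) ?_
    · exact (((hGc j).continuous.smul continuous_id).inner
        (continuous_gradient hψ1)).aestronglyMeasurable
    · have hne : ∀ᵐ x : Space n, x ≠ 0 := by simp [ae_iff]
      filter_upwards [hne] with x hx
      have hx0 : 0 < ‖x‖ := norm_pos_iff.2 hx
      by_cases hxR : x ∈ ball (0 : Space n) R
      · rw [indicator_of_mem hxR]
        refine (norm_inner_le_norm _ _).trans ?_
        refine mul_le_mul ?_ (hC x) (norm_nonneg _) ?_
        · have hs : ∀ s ≤ (2 : ℝ), (‖x‖ ^ 2 + ε j) ^ ((s - 2) / 2) ≤ ‖x‖ ^ (s - 2) := fun s hs => by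
            refine (Real.rpow_le_rpow_of_nonpos (pow_pos hx0 2)
              (by linarith [hε0 j] : ‖x‖ ^ 2 ≤ ‖x‖ ^ 2 + ε j) (by linarith)).trans (le_of_eq ?_)
            rw [← Real.rpow_natCast, ← Real.rpow_mul hx0.le]
            congr 1
            push_cast
            ring
          have pA : 0 ≤ (‖x‖ ^ 2 + ε j) ^ ((A - 2) / 2) := (Real.rpow_pos_of_pos (hp j x) _).le
          have pB : 0 ≤ (‖x‖ ^ 2 + ε j) ^ ((B - 2) / 2) := (Real.rpow_pos_of_pos (hp j x) _).le
          have h2 := mul_le_mul_of_nonneg_left (hs B (by linarith)) hlam.le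
          have h1 := hs A hA
          rw [norm_smul]
          simp only [hG, smoothProfile, Pi.add_apply]
          rw [← mul_assoc, ← add_mul]
          refine mul_le_mul_of_nonneg_right ((norm_sub_le _ _).trans ?_) (norm_nonneg _)
          rw [norm_mul, Real.norm_of_nonneg pA, Real.norm_of_nonneg pB,
            Real.norm_of_nonneg hlam.le]
          linarith
        · simp only [Pi.add_apply]
          positivity
      · rw [indicator_of_notMem hxR, hz x hxR, inner_zero_right, norm_zero]
    · have hne : ∀ᵐ x : Space n, x ≠ 0 := by simp [ae_iff]
      filter_upwards [hne] with x hx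
      have hx0 : 0 < ‖x‖ := norm_pos_iff.2 hx
      have hs : ∀ s : ℝ, Tendsto (fun j => (‖x‖ ^ 2 + ε j) ^ ((s - 2) / 2)) atTop
          (𝓝 (‖x‖ ^ (s - 2))) := fun s => by
        have h1 : Tendsto (fun j => ‖x‖ ^ 2 + ε j) atTop (𝓝 (‖x‖ ^ 2)) := by
          simpa using hεt.const_add (‖x‖ ^ 2)
        have h2 := h1.rpow_const (p := (s - 2) / 2) (Or.inl (pow_pos hx0 2).ne')
        have e : (‖x‖ ^ 2) ^ ((s - 2) / 2) = ‖x‖ ^ (s - 2) := by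
          rw [← Real.rpow_natCast, ← Real.rpow_mul hx0.le]
          congr 1
          push_cast
          ring
        rwa [e] at h2
      exact (((hs A).sub ((hs B).const_mul lam)).smul_const x).inner tendsto_const_nhds
  exact le_of_tendsto' hlim.neg hj

/-! ### The drift generated by a density. -/

variable {n : ℕ}

/-- The field generated by the density `u` through the kernel `W`. -/
noncomputable def drift (W : Space n → Space n) (u : Space n → ℝ) (x : Space n) : Space n :=
  ∫ y, u y • W (x - y)

theorem gradient_comp_add_right (f : Space n → ℝ) (x y : Space n) :
    gradient (fun z => f (z + y)) x = gradient f (x + y) := by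
  simp [gradient, fderiv_comp_add_right]

/-- A kernel which is the sum of a Lipschitz and an integrable kernel, and whose divergence is
bounded from above. -/
structure IsDriftKernel (W W₁ : Space n → Space n) (L₁ Λ₀ : ℝ) : Prop where
  measurable : Measurable W
  measurable_regular : Measurable W₁
  lipschitz : ∀ x y, ‖W₁ x - W₁ y‖ ≤ L₁ * ‖x - y‖
  integrable_sub : Integrable fun x => W x - W₁ x
  div : DivLE W Λ₀

/-- A bounded integrable density with a well-defined drift. -/
structure IsDriftDensity (W : Space n → Space n) (S M : ℝ) (u : Space n → ℝ) : Prop where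
  measurable : Measurable u
  mem_Icc : ∀ x, u x ∈ Icc 0 S
  integrable : Integrable u
  mass : ∫ x, u x ≤ M
  exists_integrable : ∃ x₀, Integrable fun y => u y • W (x₀ - y)

variable {W W₁ : Space n → Space n} {L₁ Λ₀ S M : ℝ} {u : Space n → ℝ}

theorem IsDriftDensity.integrable_singular (hu : IsDriftDensity W S M u)
    (hW : IsDriftKernel W W₁ L₁ Λ₀) (x : Space n) :
    Integrable fun y => u y • (W (x - y) - W₁ (x - y)) :=
  Integrable.bdd_smul (hW.integrable_sub.comp_sub_left x) S hu.measurable.aestronglyMeasurable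
    (Eventually.of_forall fun y => by
      rw [Real.norm_of_nonneg (hu.mem_Icc y).1]
      exact (hu.mem_Icc y).2)

/-- One point of absolute convergence suffices: moving to another point changes the Lipschitz kernel
by a bounded amount, and the density is integrable. -/
theorem IsDriftDensity.integrable_regular (hu : IsDriftDensity W S M u)
    (hW : IsDriftKernel W W₁ L₁ Λ₀) (x : Space n) :
    Integrable fun y => u y • W₁ (x - y) := by
  obtain ⟨x₀, h₀⟩ := hu.exists_integrable
  have h1 : Integrable fun y => u y • W₁ (x₀ - y) := by
    refine (h₀.sub (hu.integrable_singular hW x₀)).congr (Eventually.of_forall fun y => ?_)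
    simp only [Pi.sub_apply]
    module
  have h2 : Integrable fun y => u y • (W₁ (x - y) - W₁ (x₀ - y)) := by
    refine (hu.integrable.mul_const (L₁ * ‖x - x₀‖)).mono'
      (hu.measurable.smul ((hW.measurable_regular.comp (measurable_id.const_sub x)).sub
        (hW.measurable_regular.comp (measurable_id.const_sub x₀)))).aestronglyMeasurable
      (Eventually.of_forall fun y => ?_)
    rw [norm_smul, Real.norm_of_nonneg (hu.mem_Icc y).1]
    refine mul_le_mul_of_nonneg_left ((hW.lipschitz _ _).trans (le_of_eq ?_)) (hu.mem_Icc y).1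
    congr 2
    abel
  refine (h1.add h2).congr (Eventually.of_forall fun y => ?_)
  simp only [Pi.add_apply]
  module

theorem IsDriftDensity.integrable_smul (hu : IsDriftDensity W S M u)
    (hW : IsDriftKernel W W₁ L₁ Λ₀) (x : Space n) : Integrable fun y => u y • W (x - y) := by
  refine ((hu.integrable_regular hW x).add (hu.integrable_singular hW x)).congr
    (Eventually.of_forall fun y => ?_)
  simp only [Pi.add_apply]
  module

theorem IsDriftKernel.lipschitz_nonneg (hn : 2 ≤ n) (hW : IsDriftKernel W W₁ L₁ Λ₀) : 0 ≤ L₁ := by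
  have h := (norm_nonneg _).trans (hW.lipschitz (EuclideanSpace.single ⟨0, by omega⟩ 1) 0)
  simpa using h

/-- The drift deviates from a constant by at most a linear function. -/
theorem IsDriftDensity.norm_drift_sub_le (hn : 2 ≤ n) (hu : IsDriftDensity W S M u)
    (hW : IsDriftKernel W W₁ L₁ Λ₀) (x : Space n) :
    ‖drift W u x - ∫ y, u y • W₁ (- y)‖ ≤ L₁ * M * ‖x‖ + S * ∫ y, ‖W y - W₁ y‖ := by
  have hL := hW.lipschitz_nonneg hn
  have i0 : Integrable fun y => u y • W₁ (- y) := by simpa using hu.integrable_regular hW 0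
  have i1 : Integrable fun y => u y • (W₁ (x - y) - W₁ (- y)) := by
    refine ((hu.integrable_regular hW x).sub i0).congr (Eventually.of_forall fun y => ?_)
    simp only [Pi.sub_apply]
    module
  -- The Lipschitz part varies by at most `L₁ ‖x‖` times the mass. The singular part is at most the
  -- supremum of the density times the `L¹` norm of the singular kernel.
  have e : drift W u x - ∫ y, u y • W₁ (- y) =
      (∫ y, u y • (W₁ (x - y) - W₁ (- y))) + ∫ y, u y • (W (x - y) - W₁ (x - y)) := by
    rw [drift, ← integral_sub (hu.integrable_smul hW x) i0,
      ← integral_add i1 (hu.integrable_singular hW x)]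
    congr 1
    ext1 y
    module
  rw [e]
  refine (norm_add_le _ _).trans (add_le_add ?_ ?_)
  · have h1 : ‖∫ y, u y • (W₁ (x - y) - W₁ (- y))‖ ≤ ∫ y, u y * (L₁ * ‖x‖) := by
      refine norm_integral_le_of_norm_le (hu.integrable.mul_const _)
        (Eventually.of_forall fun y => ?_)
      rw [norm_smul, Real.norm_of_nonneg (hu.mem_Icc y).1]
      refine mul_le_mul_of_nonneg_left ((hW.lipschitz _ _).trans (le_of_eq ?_)) (hu.mem_Icc y).1
      congr 2
      abel
    rw [integral_mul_const] at h1
    refine h1.trans ?_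
    have := mul_le_mul_of_nonneg_right hu.mass (mul_nonneg hL (norm_nonneg x))
    linarith
  · have h1 : ‖∫ y, u y • (W (x - y) - W₁ (x - y))‖ ≤ ∫ y, S * ‖W (x - y) - W₁ (x - y)‖ := by
      refine norm_integral_le_of_norm_le ((hW.integrable_sub.comp_sub_left x).norm.const_mul S)
        (Eventually.of_forall fun y => ?_)
      rw [norm_smul, Real.norm_of_nonneg (hu.mem_Icc y).1]
      exact mul_le_mul_of_nonneg_right (hu.mem_Icc y).2 (norm_nonneg _)
    rwa [integral_const_mul, integral_sub_left_eq_self (fun y => ‖W y - W₁ y‖)] at h1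

/-- The divergence of the drift is controlled by the mass of the density. -/
theorem IsDriftDensity.divLE (hn : 2 ≤ n) (hu : IsDriftDensity W S M u)
    (hW : IsDriftKernel W W₁ L₁ Λ₀) (hΛ : 0 ≤ Λ₀) : DivLE (drift W u) (Λ₀ * M) := by
  intro ψ hψ hc hψ0
  have hψ1 : ContDiff ℝ 1 ψ := hψ.of_le (by simp)
  have hgc := continuous_gradient hψ1
  have hgs := hasCompactSupport_gradient hc
  have hgi : Integrable (gradient ψ) := hgc.integrable_of_hasCompactSupport hgs
  have hL := hW.lipschitz_nonneg hn
  obtain ⟨C, hC⟩ := hgc.bounded_above_of_compact_support hgs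
  have hum2 : Measurable fun p : Space n × Space n => u p.2 := hu.measurable.comp measurable_snd
  have hgm : Measurable fun p : Space n × Space n => gradient ψ p.1 :=
    hgc.measurable.comp measurable_fst
  have hsubm : Measurable fun p : Space n × Space n => p.1 - p.2 :=
    measurable_fst.sub measurable_snd
  have j1 : Integrable (fun p : Space n × Space n =>
      inner ℝ (u p.2 • W₁ (p.1 - p.2)) (gradient ψ p.1)) (volume.prod volume) := by
    have i0 : Integrable fun y => u y • W₁ (- y) := by simpa using hu.integrable_regular hW 0
    have hb := ((hgi.norm.mul_prod i0.norm).add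
      (((hgc.norm.mul (continuous_norm.const_mul L₁) :
        Continuous fun x => ‖gradient ψ x‖ * (L₁ * ‖x‖)).integrable_of_hasCompactSupport
        hgs.norm.mul_right).mul_prod hu.integrable))
    refine hb.mono' ((hum2.smul (hW.measurable_regular.comp hsubm)).inner hgm).aestronglyMeasurable
      (Eventually.of_forall fun p => ?_)
    refine (norm_inner_le_norm _ _).trans ?_
    have h1 : ‖W₁ (p.1 - p.2)‖ ≤ ‖W₁ (-p.2)‖ + L₁ * ‖p.1‖ := by
      have := hW.lipschitz (p.1 - p.2) (-p.2)
      have e : p.1 - p.2 - -p.2 = p.1 := by abel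
      rw [e] at this
      linarith [norm_sub_norm_le (W₁ (p.1 - p.2)) (W₁ (-p.2))]
    simp only [Pi.add_apply, Pi.mul_apply]
    rw [norm_smul, norm_smul, Real.norm_of_nonneg (hu.mem_Icc p.2).1]
    have h2 := mul_le_mul_of_nonneg_left h1
      (mul_nonneg (norm_nonneg (gradient ψ p.1)) (hu.mem_Icc p.2).1)
    linarith
  have j2 : Integrable (fun p : Space n × Space n =>
      inner ℝ (u p.2 • (W (p.1 - p.2) - W₁ (p.1 - p.2))) (gradient ψ p.1))
      (volume.prod volume) := by
    have hb := (hu.integrable.convolution_integrand (lsmul ℝ ℝ) hW.integrable_sub).norm.mul_const C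
    refine hb.mono' ((hum2.smul ((hW.measurable.comp hsubm).sub
      (hW.measurable_regular.comp hsubm))).inner hgm).aestronglyMeasurable
      (Eventually.of_forall fun p => ?_)
    refine (norm_inner_le_norm _ _).trans ?_
    exact mul_le_mul_of_nonneg_left (hC _) (norm_nonneg _)
  have j : Integrable (fun p : Space n × Space n =>
      inner ℝ (u p.2 • W (p.1 - p.2)) (gradient ψ p.1)) (volume.prod volume) := by
    refine (j1.add j2).congr (Eventually.of_forall fun p => ?_)
    simp only [Pi.add_apply]
    rw [← inner_add_left, ← smul_add, add_sub_cancel]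
  -- After Fubini the drift is a superposition of fields from single points, each a translate of `W`
  -- satisfying the same divergence bound.
  have e1 : ∫ x, inner ℝ (drift W u x) (gradient ψ x) =
      ∫ y, ∫ x, inner ℝ (u y • W (x - y)) (gradient ψ x) := by
    rw [← integral_integral_swap (f := fun x y => inner ℝ (u y • W (x - y)) (gradient ψ x)) j]
    congr 1
    ext1 x
    rw [drift, real_inner_comm, ← integral_inner (hu.integrable_smul hW x)]
    simp_rw [real_inner_comm]
  rw [e1, ← integral_neg]
  have hle : ∀ y, - ∫ x, inner ℝ (u y • W (x - y)) (gradient ψ x) ≤ u y * (Λ₀ * ∫ x, ψ x) :=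
    fun y => by
      have h1 := hW.div (fun z => ψ (z + y)) (hψ.comp (contDiff_id.add contDiff_const))
        (hc.comp_homeomorph (Homeomorph.addRight y)) fun z => hψ0 _
      rw [integral_add_right_eq_self (fun z => ψ z)] at h1
      have h2 : ∫ x, inner ℝ (u y • W (x - y)) (gradient ψ x) =
          u y * ∫ x, inner ℝ (W x) (gradient (fun z => ψ (z + y)) x) := by
        rw [← integral_const_mul, ← integral_add_right_eq_self _ y]
        congr 1
        ext1 x
        rw [gradient_comp_add_right, add_sub_cancel_right, inner_smul_left]
        rfl
      rw [h2, ← mul_neg]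
      exact mul_le_mul_of_nonneg_left h1 (hu.mem_Icc y).1
  refine (integral_mono j.integral_prod_right.neg (hu.integrable.mul_const _) hle).trans ?_
  rw [integral_mul_const]
  have hψi : 0 ≤ ∫ x, ψ x := integral_nonneg hψ0
  have := mul_le_mul_of_nonneg_right hu.mass (mul_nonneg hΛ hψi)
  linarith

/-- Subtracting a constant and translating do not affect the divergence. -/
theorem DivLE.translate {b : Space n → Space n} {Λ : ℝ} (hb : DivLE b Λ)
    (hbi : LocallyIntegrable b volume) (a c : Space n) : DivLE (fun x => b (x - a) - c) Λ := by
  intro ψ hψ hc hψ0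
  have hψ1 : ContDiff ℝ 1 ψ := hψ.of_le (by simp)
  have h1 := hb (fun z => ψ (z + a)) (hψ.comp (contDiff_id.add contDiff_const))
    (hc.comp_homeomorph (Homeomorph.addRight a)) fun z => hψ0 _
  rw [integral_add_right_eq_self (fun z => ψ z)] at h1
  refine le_trans (le_of_eq ?_) h1
  have hgi : Integrable (gradient ψ) :=
    (continuous_gradient hψ1).integrable_of_hasCompactSupport (hasCompactSupport_gradient hc)
  -- The gradient of a compactly supported function has zero mean, so the constant `c` does not
  -- contribute.
  have h0 : ∫ x, gradient ψ x = 0 := by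
    have := integral_smul_gradient_eq (f := fun _ => (1 : ℝ)) contDiff_const hψ1 hc
    simpa [gradient] using this
  have i2 : Integrable fun x => inner ℝ c (gradient ψ x) := hgi.const_inner c
  have i1 : Integrable fun x => inner ℝ (b (x - a)) (gradient ψ x) := by
    have hg' : Continuous fun x => gradient ψ (x + a) :=
      (continuous_gradient hψ1).comp (by fun_prop)
    have hs' : HasCompactSupport fun x => gradient ψ (x + a) :=
      (hasCompactSupport_gradient hc).comp_homeomorph (Homeomorph.addRight a)
    have h3 : Integrable fun x => inner ℝ (b x) (gradient ψ (x + a)) := by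
      refine (hbi.integrable_smul_left_of_hasCompactSupport hg'.norm hs'.norm).mono
        (hbi.aestronglyMeasurable.inner hg'.aestronglyMeasurable)
        (Eventually.of_forall fun x => ?_)
      rw [norm_smul, norm_norm, mul_comm]
      exact norm_inner_le_norm _ _
    simpa using h3.comp_sub_right a
  simp_rw [inner_sub_left]
  rw [integral_sub i1 i2, integral_inner hgi, h0, inner_zero_right, sub_zero,
    ← integral_add_right_eq_self _ a]
  simp_rw [gradient_comp_add_right, add_sub_cancel_right]

/-! ### Translations in space and moving frames. -/

variable {n : ℕ}

variable {m S M L Λ K T : ℝ}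

theorem HasWeakGradient.translate {w : Space n → ℝ} {g : Space n → Space n}
    (h : HasWeakGradient w g) (a : Space n) :
    HasWeakGradient (fun x => w (x - a)) fun x => g (x - a) := by
  have hl : ∀ {F : Type} [NormedAddCommGroup F] {f : Space n → F}, LocallyIntegrable f volume →
      LocallyIntegrable (fun x => f (x - a)) volume := fun {F} _ {f} hf => by
    rw [locallyIntegrable_iff] at hf ⊢
    intro K hK
    have h1 := hf _ (hK.image (by fun_prop : Continuous fun x : Space n => x - a))
    have h2 := (measurePreserving_sub_right (volume : Measure (Space n)) a).integrableOn_comp_preimage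
      (MeasurableEquiv.subRight a).measurableEmbedding (f := f) (s := (fun x => x - a) '' K)
    refine (h2.2 h1).mono_set fun x hx => ⟨x, hx, rfl⟩
  refine ⟨hl h.1, hl h.2.1, fun ψ hψ hc => ?_⟩
  have h1 := h.2.2 (fun z => ψ (z + a)) (hψ.comp (contDiff_id.add contDiff_const))
    (hc.comp_homeomorph (Homeomorph.addRight a))
  rw [← integral_add_right_eq_self _ a, ← integral_add_right_eq_self (fun x => ψ x • g (x - a)) a]
  simpa [gradient_comp_add_right] using h1

theorem IsSlice.locallyIntegrable_drift {r : Space n → ℝ} {V b : Space n → Space n}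
    (h : IsSlice m S M L Λ r V b) (hL : 0 ≤ L) : LocallyIntegrable b volume := by
  rw [locallyIntegrable_iff]
  intro k hk
  obtain ⟨R, hR⟩ := hk.isBounded.subset_closedBall (0 : Space n)
  have hfin : IsFiniteMeasure (volume.restrict (closedBall (0 : Space n) R)) :=
    ⟨by rw [Measure.restrict_apply_univ]; exact measure_closedBall_lt_top⟩
  have h1 : IntegrableOn b (closedBall 0 R) := by
    refine Integrable.mono' (integrable_const (L * (1 + R))) h.drift_measurable.restrict ?_
    filter_upwards [ae_restrict_of_ae h.growth, ae_restrict_mem measurableSet_closedBall]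
      with x hx hxR
    rw [mem_closedBall_zero_iff] at hxR
    exact hx.trans (by gcongr)
  exact h1.mono_set hR

theorem memLp_translate_ball {F : Type*} [NormedAddCommGroup F] {V : Space n → F}
    (h : ∀ R : ℝ, MemLp V 2 (volume.restrict (ball 0 R))) (a : Space n) (R : ℝ) :
    MemLp (fun x => V (x - a)) 2 (volume.restrict (ball 0 R)) := by
  have h1 := ((memLp_indicator_iff_restrict measurableSet_ball).2
    (h (R + ‖a‖))).comp_measurePreserving (measurePreserving_sub_right volume a)
  refine (h1.restrict (ball 0 R)).ae_eq ?_
  filter_upwards [ae_restrict_mem measurableSet_ball] with x hx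
  rw [Function.comp_apply, indicator_of_mem]
  rw [mem_ball_zero_iff] at hx ⊢
  exact (norm_sub_le _ _).trans_lt (by linarith)

theorem IsSlice.translate {r : Space n → ℝ} {V b : Space n → Space n}
    (h : IsSlice m S M L Λ r V b) (hL : 0 ≤ L) {a : Space n} {D : ℝ} (ha : ‖a‖ ≤ D) :
    IsSlice m S M (L * (1 + D)) Λ (fun x => r (x - a)) (fun x => V (x - a))
      fun x => b (x - a) where
  measurable := h.measurable.comp (measurable_id.sub_const a)
  mem_Icc x := h.mem_Icc _
  integrable := h.integrable.comp_sub_right a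
  mass := by
    rw [integral_sub_right_eq_self r]
    exact h.mass
  weak := h.weak.translate a
  sq := memLp_translate_ball h.sq a
  drift_measurable :=
    h.drift_measurable.comp_measurePreserving (measurePreserving_sub_right volume a)
  growth := by
    filter_upwards [(measurePreserving_sub_right volume a).quasiMeasurePreserving.ae h.growth]
      with x hx
    have h1 := norm_sub_le x a
    have h2 : 0 ≤ D := (norm_nonneg a).trans ha
    refine hx.trans ?_
    rw [mul_assoc]
    refine mul_le_mul_of_nonneg_left ?_ hL
    nlinarith [norm_nonneg x]
  div := by simpa using h.div.translate (h.locallyIntegrable_drift hL) a 0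

/-- A solution on `(0, T) × ℝⁿ` of `∂ₜ u = div (V + u (b + c))` with initial datum `u₀`, where the
field `c` depends only on time and is merely integrable. -/
structure IsDriftedFlow (m S M L Λ K T : ℝ) (u₀ : Space n → ℝ) (u : ℝ × Space n → ℝ)
    (V b : ℝ × Space n → Space n) (c : ℝ → Space n) : Prop where
  measurable : Measurable u
  measurable_V : Measurable V
  measurable_b : Measurable b
  integrable_c : Integrable c
  mem_Icc : ∀ z, u z ∈ Icc 0 S
  measurable_initial : Measurable u₀
  initial : ∀ x, u₀ x ∈ Icc 0 K
  le_bound : K ≤ S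
  eq_zero : ∀ z : ℝ × Space n, z.1 ∉ Ioo 0 T → u z = 0
  V_eq_zero : ∀ z : ℝ × Space n, z.1 ∉ Ioo 0 T → V z = 0
  b_eq_zero : ∀ z : ℝ × Space n, z.1 ∉ Ioo 0 T → b z = 0
  growth : ∀ z, ‖b z‖ ≤ L * (1 + ‖z.2‖)
  slice : ∀ᵐ t, t ∈ Ioo 0 T → IsSlice m S M L Λ (fun x => u (t, x)) (fun x => V (t, x))
    fun x => b (t, x)
  V_sq : ∀ R : ℝ, MemLp V 2 (volume.restrict (univ ×ˢ ball 0 R))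
  eqn : ∀ φ : ℝ × Space n → ℝ, ContDiff ℝ ∞ φ → HasCompactSupport φ →
    (∀ z : ℝ × Space n, T ≤ z.1 → φ z = 0) →
    (∫ z, (u z * deriv (fun s => φ (s, z.2)) z.1 -
      inner ℝ (V z + u z • (b z + c z.1)) (gradient (fun y => φ (z.1, y)) z.2))) +
      ∫ x, u₀ x * φ (0, x) = 0

/-- The time derivative of a function on space-time. -/
noncomputable def timeDeriv (ψ : ℝ × Space n → ℝ) (z : ℝ × Space n) : ℝ := fderiv ℝ ψ z (1, 0)

/-- The spatial gradient of a function on space-time. -/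
noncomputable def spaceGradient (ψ : ℝ × Space n → ℝ) (z : ℝ × Space n) : Space n :=
  (InnerProductSpace.toDual ℝ (Space n)).symm ((fderiv ℝ ψ z).comp (ContinuousLinearMap.inr ℝ ℝ _))

section

variable {ψ : ℝ × Space n → ℝ}

theorem inner_spaceGradient (z : ℝ × Space n) (v : Space n) :
    inner ℝ (spaceGradient ψ z) v = fderiv ℝ ψ z (0, v) := by
  simp [spaceGradient]

theorem gradient_slice (hψ : Differentiable ℝ ψ) (z : ℝ × Space n) :
    gradient (fun y => ψ (z.1, y)) z.2 = spaceGradient ψ z := by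
  have hin : HasFDerivAt (fun y : Space n => (z.1, y)) (ContinuousLinearMap.inr ℝ ℝ (Space n)) z.2 :=
    hasFDerivAt_prodMk_right z.1 z.2
  have h := HasFDerivAt.comp (f := fun y : Space n => (z.1, y)) z.2 (hψ (z.1, z.2)).hasFDerivAt hin
  have e : fderiv ℝ (fun y => ψ (z.1, y)) z.2 = _ := h.fderiv
  rw [gradient, e]
  rfl

theorem continuous_timeDeriv (hψ : ContDiff ℝ 1 ψ) : Continuous (timeDeriv ψ) :=
  (hψ.continuous_fderiv one_ne_zero).clm_apply continuous_const

theorem continuous_spaceGradient (hψ : ContDiff ℝ 1 ψ) : Continuous (spaceGradient ψ) :=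
  (InnerProductSpace.toDual ℝ (Space n)).symm.continuous.comp
    ((hψ.continuous_fderiv one_ne_zero).clm_comp continuous_const)

theorem timeDeriv_eq_zero {z : ℝ × Space n} (hz : z ∉ tsupport ψ) : timeDeriv ψ z = 0 := by
  rw [timeDeriv, fderiv_of_notMem_tsupport ℝ hz]
  simp

theorem spaceGradient_eq_zero {z : ℝ × Space n} (hz : z ∉ tsupport ψ) :
    spaceGradient ψ z = 0 := by
  rw [spaceGradient, fderiv_of_notMem_tsupport ℝ hz]
  simp

/-- Following the path `Y` adds `Y' · ∇ψ` to the time derivative; with `Y' = c` this cancels the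
spatially constant part of the drift. -/
theorem hasDerivAt_moving (hψ : Differentiable ℝ ψ) {Y : ℝ → Space n} {Y' : Space n} {t : ℝ}
    (hY : HasDerivAt Y Y' t) (x : Space n) :
    HasDerivAt (fun s => ψ (s, x + Y s))
      (timeDeriv ψ (t, x + Y t) + inner ℝ Y' (spaceGradient ψ (t, x + Y t))) t := by
  have hin : HasDerivAt (fun s => (s, x + Y s)) ((1 : ℝ), Y') t :=
    (hasDerivAt_id t).prodMk (hY.const_add x)
  have h := HasFDerivAt.comp_hasDerivAt (f := fun s => (s, x + Y s)) t
    (hψ (t, x + Y t)).hasFDerivAt hin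
  refine h.congr_deriv ?_
  rw [real_inner_comm, inner_spaceGradient, timeDeriv, ← map_add]
  simp

theorem hasDerivAt_time (hψ : Differentiable ℝ ψ) (t : ℝ) (x : Space n) :
    HasDerivAt (fun s => ψ (s, x)) (timeDeriv ψ (t, x)) t := by
  simpa using hasDerivAt_moving hψ (hasDerivAt_const t (0 : Space n)) x

end

/-- The time-dependent translation of space-time along the path `Y`. -/
def moveBack (Y : ℝ → Space n) (z : ℝ × Space n) : ℝ × Space n := (z.1, z.2 - Y z.1)

theorem continuous_moveBack {Y : ℝ → Space n} (hY : Continuous Y) : Continuous (moveBack Y) :=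
  continuous_fst.prodMk (continuous_snd.sub (hY.comp continuous_fst))

theorem measurableEmbedding_moveBack {Y : ℝ → Space n} (hY : Continuous Y) :
    MeasurableEmbedding (moveBack Y) :=
  (continuous_moveBack hY).measurableEmbedding fun a b hab => by
    simp only [moveBack, Prod.mk.injEq] at hab
    obtain ⟨h1, h2⟩ := hab
    rw [h1] at h2
    exact Prod.ext h1 (sub_left_injective h2)

/-- A skew product over time whose fibre maps are translations. -/
theorem measurePreserving_moveBack {Y : ℝ → Space n} (hY : Continuous Y) :
    MeasurePreserving (moveBack Y) := by
  refine (MeasurePreserving.id (volume : Measure ℝ)).skew_product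
    (μc := (volume : Measure (Space n))) (g := fun t x => x - Y t) ?_ ?_
  · exact (continuous_snd.sub (hY.comp continuous_fst)).measurable
  · exact Eventually.of_forall fun t => (measurePreserving_sub_right volume (Y t)).map_eq

/-! ### Test functions moving along a path. -/

variable {n : ℕ}

variable {m S M L Λ K T : ℝ} {u₀ : Space n → ℝ} {u : ℝ × Space n → ℝ}
  {V b : ℝ × Space n → Space n} {c : ℝ → Space n}

/-- The path with velocity `c` starting from the origin. -/
noncomputable def path (c : ℝ → Space n) (t : ℝ) : Space n := ∫ s in 0..t, c s

theorem continuous_path (hc : Integrable c) : Continuous (path c) :=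
  intervalIntegral.continuous_primitive (fun _ _ => hc.intervalIntegrable) 0

theorem norm_path_sub_le {c' : ℝ → Space n} (hc : Integrable c) (hc' : Integrable c') (t : ℝ) :
    ‖path c t - path c' t‖ ≤ ∫ s, ‖c s - c' s‖ := by
  rw [path, path, ← intervalIntegral.integral_sub hc.intervalIntegrable hc'.intervalIntegrable]
  refine (intervalIntegral.norm_integral_le_integral_norm_uIoc).trans ?_
  exact setIntegral_le_integral (hc.sub hc').norm (Eventually.of_forall fun _ => norm_nonneg _)

theorem norm_path_le (hc : Integrable c) (t : ℝ) : ‖path c t‖ ≤ ∫ s, ‖c s‖ := by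
  refine (intervalIntegral.norm_integral_le_integral_norm_uIoc).trans ?_
  exact setIntegral_le_integral hc.norm (Eventually.of_forall fun _ => norm_nonneg _)

theorem hasDerivAt_path (hc : Continuous c) (t : ℝ) : HasDerivAt (path c) (c t) t :=
  intervalIntegral.integral_hasDerivAt_right (hc.intervalIntegrable _ _)
    (hc.stronglyMeasurableAtFilter _ _) hc.continuousAt

theorem contDiff_path (hc : ContDiff ℝ ∞ c) : ContDiff ℝ ∞ (path c) := by
  rw [contDiff_infty_iff_deriv]
  have hd := hasDerivAt_path hc.continuous
  refine ⟨fun t => (hd t).differentiableAt, ?_⟩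
  have : deriv (path c) = c := funext fun t => (hd t).deriv
  rwa [this]

/-- The equation tested against a function moving along a smooth path. -/
theorem IsDriftedFlow.eqn_moving (h : IsDriftedFlow m S M L Λ K T u₀ u V b c)
    {ψ : ℝ × Space n → ℝ} (hψ : ContDiff ℝ ∞ ψ) (hψc : HasCompactSupport ψ)
    (hψT : ∀ z : ℝ × Space n, T ≤ z.1 → ψ z = 0) {a : ℝ → Space n} (ha : ContDiff ℝ ∞ a)
    (hai : Integrable a) :
    (∫ z : ℝ × Space n, (u z * (timeDeriv ψ (z.1, z.2 + path a z.1) +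
        inner ℝ (a z.1) (spaceGradient ψ (z.1, z.2 + path a z.1))) -
      inner ℝ (V z + u z • (b z + c z.1)) (spaceGradient ψ (z.1, z.2 + path a z.1)))) +
      ∫ x, u₀ x * ψ (0, x) = 0 := by
  have hψd : Differentiable ℝ ψ := hψ.differentiable (by simp)
  have hY := contDiff_path ha
  have hcs : HasCompactSupport fun z : ℝ × Space n => ψ (z.1, z.2 + path a z.1) := by
    obtain ⟨ρ, hρ⟩ := hψc.isCompact.isBounded.subset_closedBall (0 : ℝ × Space n)
    refine HasCompactSupport.intro
      (isCompact_closedBall (0 : ℝ × Space n) (ρ + ∫ s, ‖a s‖)) fun z hz => ?_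
    refine image_eq_zero_of_notMem_tsupport fun hm => hz ?_
    have h1 := hρ hm
    rw [mem_closedBall_zero_iff] at h1 ⊢
    have e : z = (z.1, z.2 + path a z.1) - (0, path a z.1) := by ext <;> simp
    rw [e]
    refine (norm_sub_le _ _).trans (add_le_add h1 ?_)
    have := norm_path_le hai z.1
    rw [Prod.norm_def]
    exact max_le (by rw [norm_zero]; exact (norm_nonneg _).trans this) this
  have key := h.eqn (fun z => ψ (z.1, z.2 + path a z.1))
    (hψ.comp (contDiff_fst.prodMk (contDiff_snd.add (hY.comp contDiff_fst)))) hcs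
    fun z hz => hψT _ hz
  have e0 : path a 0 = 0 := by simp [path]
  simp only [e0, add_zero] at key
  refine Eq.trans ?_ key
  congr 2
  ext1 z
  rw [(hasDerivAt_moving hψd (hasDerivAt_path ha.continuous z.1) z.2).deriv,
    gradient_comp_add_right (fun y => ψ (z.1, y)), ← gradient_slice hψd]

theorem IsDriftedFlow.nonneg_bound (h : IsDriftedFlow m S M L Λ K T u₀ u V b c) : 0 ≤ L := by
  have := (norm_nonneg _).trans (h.growth 0)
  simpa using this

/-- The equation tested against a function moving along an absolutely continuous path. -/
theorem IsDriftedFlow.eqn_path (h : IsDriftedFlow m S M L Λ K T u₀ u V b c)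
    {ψ : ℝ × Space n → ℝ} (hψ : ContDiff ℝ ∞ ψ) (hψc : HasCompactSupport ψ)
    (hψT : ∀ z : ℝ × Space n, T ≤ z.1 → ψ z = 0) :
    Integrable (fun z : ℝ × Space n => u z * timeDeriv ψ (z.1, z.2 + path c z.1)) ∧
    Integrable (fun z : ℝ × Space n =>
      inner ℝ (V z + u z • b z) (spaceGradient ψ (z.1, z.2 + path c z.1))) ∧
    (∫ z : ℝ × Space n, (u z * timeDeriv ψ (z.1, z.2 + path c z.1) -
      inner ℝ (V z + u z • b z) (spaceGradient ψ (z.1, z.2 + path c z.1)))) +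
      ∫ x, u₀ x * ψ (0, x) = 0 := by
  have hψ1 : ContDiff ℝ 1 ψ := hψ.of_le (by simp)
  have hL := h.nonneg_bound
  have hS : 0 ≤ S := (h.mem_Icc 0).1.trans (h.mem_Icc 0).2
  have hDc := continuous_timeDeriv hψ1
  have hGc := continuous_spaceGradient hψ1
  obtain ⟨C1, hC1⟩ := hDc.bounded_above_of_compact_support
    (HasCompactSupport.intro hψc.isCompact fun z hz => timeDeriv_eq_zero hz)
  obtain ⟨C2, hC2⟩ := hGc.bounded_above_of_compact_support
    (HasCompactSupport.intro hψc.isCompact fun z hz => spaceGradient_eq_zero hz)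
  have hC20 : 0 ≤ C2 := (norm_nonneg _).trans (hC2 0)
  obtain ⟨ρ, hρ⟩ := hψc.isCompact.isBounded.subset_closedBall (0 : ℝ × Space n)
  set D := ∫ s, ‖c s‖ with hD
  -- All paths considered stay within `D + 1` of the origin, so the shifted supports lie strictly
  -- inside this radius.
  set R := ρ + D + 2 with hR
  have hout : ∀ (y : Space n) (z : ℝ × Space n), ‖y‖ ≤ D + 1 → z.2 ∉ ball (0 : Space n) R →
      (z.1, z.2 + y) ∉ tsupport ψ := fun y z hy hz hm => by
    have h1 := hρ hm
    rw [mem_closedBall_zero_iff] at h1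
    have h2 : ‖z.2 + y‖ ≤ ρ := (_root_.norm_snd_le (z.1, z.2 + y)).trans h1
    rw [mem_ball_zero_iff] at hz
    have h3 : ‖z.2‖ ≤ ‖z.2 + y‖ + ‖y‖ := by simpa using norm_sub_le (z.2 + y) y
    linarith
  set k : Set (ℝ × Space n) := Ioo 0 T ×ˢ ball 0 R with hk
  have hkm : MeasurableSet k := measurableSet_Ioo.prod measurableSet_ball
  have hkfin : IsFiniteMeasure (volume.restrict k) :=
    ⟨by rw [Measure.restrict_apply_univ]; exact lt_top_iff_ne_top.2 (volume_slab_ne_top _ _ _)⟩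
  have hVk : IntegrableOn V k :=
    ((h.V_sq R).mono_measure (Measure.restrict_mono (prod_mono_left (subset_univ _))
      le_rfl)).integrable (by norm_num)
  have hflux0 : ∀ z : ℝ × Space n, z.1 ∉ Ioo 0 T → V z + u z • b z = 0 := fun z hz => by
    rw [h.V_eq_zero z hz, h.eq_zero z hz, zero_smul, add_zero]
  have hu0 := h.eq_zero
  have hfluxm : Measurable fun z => V z + u z • b z :=
    h.measurable_V.add (h.measurable.smul h.measurable_b)
  have hboundP : Integrable (k.indicator fun z => S * C1 + (‖V z‖ + S * (L * (1 + R))) * C2) :=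
    (integrable_indicator_iff hkm).2 ((integrable_const _).add
      ((hVk.norm.add (integrable_const _)).mul_const _))
  have hboundQ : Integrable (k.indicator fun _ => S * C1) :=
    (integrable_indicator_iff hkm).2 (integrable_const _)
  have hboundF : Integrable (k.indicator fun z => (‖V z‖ + S * (L * (1 + R))) * C2) :=
    (integrable_indicator_iff hkm).2 ((hVk.norm.add (integrable_const _)).mul_const _)
  have hb1 : ∀ (y : ℝ → Space n), (∀ t, ‖y t‖ ≤ D + 1) → ∀ z : ℝ × Space n,
      ‖u z * timeDeriv ψ (z.1, z.2 + y z.1)‖ ≤ k.indicator (fun _ => S * C1) z := fun y hy z => by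
    by_cases hz : z ∈ k
    · rw [indicator_of_mem hz, norm_mul, Real.norm_of_nonneg (h.mem_Icc z).1]
      exact mul_le_mul (h.mem_Icc z).2 (hC1 _) (norm_nonneg _) hS
    · rw [indicator_of_notMem hz, norm_le_zero_iff]
      by_cases h1 : z.1 ∈ Ioo 0 T
      · rw [timeDeriv_eq_zero (hout _ z (hy _) fun h2 => hz ⟨h1, h2⟩), mul_zero]
      · rw [hu0 z h1, zero_mul]
  have hb2 : ∀ (y : ℝ → Space n), (∀ t, ‖y t‖ ≤ D + 1) → ∀ z : ℝ × Space n,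
      ‖inner ℝ (V z + u z • b z) (spaceGradient ψ (z.1, z.2 + y z.1))‖ ≤
        k.indicator (fun z => (‖V z‖ + S * (L * (1 + R))) * C2) z := fun y hy z => by
    by_cases hz : z ∈ k
    · rw [indicator_of_mem hz]
      refine (norm_inner_le_norm _ _).trans (mul_le_mul ?_ (hC2 _) (norm_nonneg _) ?_)
      · refine (norm_add_le _ _).trans (add_le_add le_rfl ?_)
        rw [norm_smul, Real.norm_of_nonneg (h.mem_Icc z).1]
        have hz2 : ‖z.2‖ < R := by simpa using hz.2
        exact mul_le_mul (h.mem_Icc z).2 ((h.growth z).trans (by gcongr)) (norm_nonneg _) hS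
      · have hz2 : ‖z.2‖ < R := by simpa using hz.2
        have : 0 ≤ R := (norm_nonneg _).trans hz2.le
        positivity
    · rw [indicator_of_notMem hz, norm_le_zero_iff]
      by_cases h1 : z.1 ∈ Ioo 0 T
      · rw [spaceGradient_eq_zero (hout _ z (hy _) fun h2 => hz ⟨h1, h2⟩), inner_zero_right]
      · rw [hflux0 z h1, inner_zero_left]
  have hm1 : ∀ y : ℝ → Space n, Continuous y → Measurable fun z : ℝ × Space n =>
      u z * timeDeriv ψ (z.1, z.2 + y z.1) := fun y hy =>
    h.measurable.mul (hDc.comp (continuous_fst.prodMk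
      (continuous_snd.add (hy.comp continuous_fst)))).measurable
  have hm2' : ∀ y : ℝ → Space n, Continuous y → Measurable fun z : ℝ × Space n =>
      spaceGradient ψ (z.1, z.2 + y z.1) := fun y hy => (hGc.comp (continuous_fst.prodMk
      (continuous_snd.add (hy.comp continuous_fst)))).measurable
  have hm2 : ∀ y : ℝ → Space n, Continuous y → Measurable fun z : ℝ × Space n =>
      inner ℝ (V z + u z • b z) (spaceGradient ψ (z.1, z.2 + y z.1)) := fun y hy =>
    hfluxm.inner (hm2' y hy)
  have hYc := continuous_path h.integrable_c
  have hYD : ∀ t, ‖path c t‖ ≤ D + 1 := fun t => (norm_path_le h.integrable_c t).trans (by linarith)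
  have hi1 : ∀ y : ℝ → Space n, Continuous y → (∀ t, ‖y t‖ ≤ D + 1) → Integrable fun z : ℝ × Space n =>
      u z * timeDeriv ψ (z.1, z.2 + y z.1) := fun y hy hyD =>
    hboundQ.mono' (hm1 y hy).aestronglyMeasurable (Eventually.of_forall (hb1 y hyD))
  have hi2 : ∀ y : ℝ → Space n, Continuous y → (∀ t, ‖y t‖ ≤ D + 1) → Integrable fun z : ℝ × Space n =>
      inner ℝ (V z + u z • b z) (spaceGradient ψ (z.1, z.2 + y z.1)) := fun y hy hyD =>
    hboundF.mono' (hm2 y hy).aestronglyMeasurable (Eventually.of_forall (hb2 y hyD))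
  refine ⟨hi1 _ hYc hYD, hi2 _ hYc hYD, ?_⟩
  -- approximation of the velocity
  set a : ℕ → ℝ → Space n := fun j => mollify j c with ha
  have haC : ∀ j, ContDiff ℝ ∞ (a j) := fun j => contDiff_mollify j h.integrable_c.locallyIntegrable
  have hai : ∀ j, Integrable (a j) := fun j => integrable_mollify j h.integrable_c
  set d : ℕ → ℝ := fun j => ∫ s, ‖a j s - c s‖ with hd
  have hd0 : Tendsto d atTop (𝓝 0) := by
    have h1 := (ENNReal.tendsto_toReal ENNReal.zero_ne_top).comp (tendsto_mollify_L1 h.integrable_c)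
    refine h1.congr fun j => ?_
    exact (integral_norm_eq_lintegral_enorm ((hai j).sub h.integrable_c).1).symm
  have hYj : ∀ t, Tendsto (fun j => path (a j) t) atTop (𝓝 (path c t)) := fun t => by
    rw [tendsto_iff_norm_sub_tendsto_zero]
    exact squeeze_zero (fun _ => norm_nonneg _)
      (fun j => norm_path_sub_le (hai j) h.integrable_c t) hd0
  have hYjD : ∀ᶠ j in atTop, ∀ t, ‖path (a j) t‖ ≤ D + 1 := by
    filter_upwards [hd0.eventually_lt_const one_pos] with j hj t
    have h1 := norm_path_sub_le (hai j) h.integrable_c t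
    have h2 := norm_path_le h.integrable_c t
    have h3 : ‖path (a j) t‖ ≤ ‖path (a j) t - path c t‖ + ‖path c t‖ := by
      simpa using norm_add_le (path (a j) t - path c t) (path c t)
    linarith
  -- The terms without the velocity converge because the paths do; the bounds `hb1` and `hb2` are
  -- uniform over paths staying within `D + 1`.
  have hP : Tendsto (fun j => ∫ z : ℝ × Space n, (u z * timeDeriv ψ (z.1, z.2 + path (a j) z.1) -
      inner ℝ (V z + u z • b z) (spaceGradient ψ (z.1, z.2 + path (a j) z.1)))) atTop
      (𝓝 (∫ z : ℝ × Space n, (u z * timeDeriv ψ (z.1, z.2 + path c z.1) -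
      inner ℝ (V z + u z • b z) (spaceGradient ψ (z.1, z.2 + path c z.1))))) := by
    refine tendsto_integral_filter_of_dominated_convergence
      (fun z => k.indicator (fun _ => S * C1) z +
        k.indicator (fun z => (‖V z‖ + S * (L * (1 + R))) * C2) z)
      (Eventually.of_forall fun j => ((hm1 _ (continuous_path (hai j))).sub
        (hm2 _ (continuous_path (hai j)))).aestronglyMeasurable) ?_ (hboundQ.add hboundF) ?_
    · filter_upwards [hYjD] with j hj
      exact Eventually.of_forall fun z =>
        (norm_sub_le _ _).trans (add_le_add (hb1 _ hj z) (hb2 _ hj z))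
    · refine Eventually.of_forall fun z => ?_
      have hz : Tendsto (fun j => (z.1, z.2 + path (a j) z.1)) atTop
          (𝓝 (z.1, z.2 + path c z.1)) :=
        tendsto_const_nhds.prodMk_nhds ((hYj z.1).const_add z.2)
      exact (((hDc.tendsto _).comp hz).const_mul _).sub
        (tendsto_const_nhds.inner ((hGc.tendsto _).comp hz))
  -- The mismatch between the smooth velocity and `c` is controlled by its `L¹` norm in time;
  -- integrability of `c` is all that is needed.
  have hQb : ∀ᶠ j in atTop, ∀ z : ℝ × Space n,
      ‖u z * inner ℝ (a j z.1 - c z.1) (spaceGradient ψ (z.1, z.2 + path (a j) z.1))‖ ≤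
        ‖a j z.1 - c z.1‖ * (ball (0 : Space n) R).indicator (fun _ => S * C2) z.2 := by
    filter_upwards [hYjD] with j hj z
    by_cases hz : z.2 ∈ ball (0 : Space n) R
    · rw [indicator_of_mem hz, norm_mul, Real.norm_of_nonneg (h.mem_Icc z).1]
      have h1 := (norm_inner_le_norm (𝕜 := ℝ) (a j z.1 - c z.1)
        (spaceGradient ψ (z.1, z.2 + path (a j) z.1))).trans
        (mul_le_mul_of_nonneg_left (hC2 _) (norm_nonneg _))
      refine (mul_le_mul (h.mem_Icc z).2 h1 (norm_nonneg _) hS).trans (le_of_eq ?_)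
      ring
    · rw [indicator_of_notMem hz, spaceGradient_eq_zero (hout _ z (hj _) hz)]
      simp
  have hballi : Integrable ((ball (0 : Space n) R).indicator fun _ => S * C2) :=
    (integrable_indicator_iff measurableSet_ball).2 (integrableOn_const measure_ball_lt_top.ne)
  have hQi : ∀ᶠ j in atTop, Integrable fun z : ℝ × Space n =>
      u z * inner ℝ (a j z.1 - c z.1) (spaceGradient ψ (z.1, z.2 + path (a j) z.1)) := by
    filter_upwards [hQb] with j hj
    refine Integrable.mono' (((hai j).sub h.integrable_c).norm.mul_prod hballi) ?_
      (Eventually.of_forall hj)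
    exact h.measurable.aestronglyMeasurable.mul
      ((((hai j).sub h.integrable_c).1.comp_fst).inner
        (hm2' _ (continuous_path (hai j))).aestronglyMeasurable)
  have hQ : Tendsto (fun j => ∫ z : ℝ × Space n, u z *
      inner ℝ (a j z.1 - c z.1) (spaceGradient ψ (z.1, z.2 + path (a j) z.1))) atTop (𝓝 0) := by
    have h1 := hd0.mul_const (∫ x, (ball (0 : Space n) R).indicator (fun _ => S * C2) x)
    rw [zero_mul] at h1
    refine squeeze_zero_norm' ?_ h1
    filter_upwards [hQb] with j hj
    refine (norm_integral_le_of_norm_le (((hai j).sub h.integrable_c).norm.mul_prod hballi)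
      (Eventually.of_forall hj)).trans (le_of_eq ?_)
    exact integral_prod_mul (fun s => ‖a j s - c s‖) _
  have hlim := ((hP.add hQ).add_const (∫ x, u₀ x * ψ (0, x)))
  rw [add_zero] at hlim
  refine tendsto_nhds_unique hlim (tendsto_const_nhds.congr' ?_)
  -- The term `u a · ∇ψ` from the moving test function combines with `-u c · ∇ψ` from the drift to
  -- give exactly the mismatch `u (a - c) · ∇ψ`.
  filter_upwards [hYjD, hQi] with j hj hQj
  refine (h.eqn_moving hψ hψc hψT (haC j) (hai j)).symm.trans ?_
  congr 1
  have hcj := continuous_path (hai j)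
  have hPj : Integrable fun z : ℝ × Space n => u z * timeDeriv ψ (z.1, z.2 + path (a j) z.1) -
      inner ℝ (V z + u z • b z) (spaceGradient ψ (z.1, z.2 + path (a j) z.1)) :=
    (hi1 _ hcj hj).sub (hi2 _ hcj hj)
  rw [← integral_add hPj hQj]
  congr 1
  ext1 z
  simp only [inner_add_left, inner_sub_left, inner_smul_left, conj_trivial]
  ring

/-! ### The equation in the moving frame. -/

variable {n : ℕ}

variable {m S M L Λ K T : ℝ} {u₀ : Space n → ℝ} {u : ℝ × Space n → ℝ}
  {V b : ℝ × Space n → Space n} {c : ℝ → Space n}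

/-- The density in the moving frame, extended by the initial datum to nonpositive times. -/
noncomputable def movedDensity (u₀ : Space n → ℝ) (u : ℝ × Space n → ℝ) (Y : ℝ → Space n)
    (z : ℝ × Space n) : ℝ :=
  u (moveBack Y z) + if z.1 ≤ 0 then u₀ z.2 else 0

/-- Since `∫ ∂ₜψ` over negative times equals `ψ (0, x)`, extending the density by `u₀` to `t ≤ 0`
turns the initial term into part of the bulk integral. -/
theorem integral_initial {ψ : ℝ × Space n → ℝ} (hψ : ContDiff ℝ 1 ψ) (hψc : HasCompactSupport ψ)
    (hu₀ : Measurable u₀) (hK : ∀ x, u₀ x ∈ Icc 0 K) :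
    Integrable (fun z : ℝ × Space n => (if z.1 ≤ 0 then u₀ z.2 else 0) * timeDeriv ψ z) ∧
    ∫ z : ℝ × Space n, (if z.1 ≤ 0 then u₀ z.2 else 0) * timeDeriv ψ z =
      ∫ x, u₀ x * ψ (0, x) := by
  have hD : Integrable (timeDeriv ψ) := (continuous_timeDeriv hψ).integrable_of_hasCompactSupport
    (HasCompactSupport.intro hψc.isCompact fun z hz => timeDeriv_eq_zero hz)
  have hK0 : 0 ≤ K := (hK 0).1.trans (hK 0).2
  have hm : Measurable fun z : ℝ × Space n => if z.1 ≤ 0 then u₀ z.2 else 0 :=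
    Measurable.ite (measurableSet_le measurable_fst measurable_const)
      (hu₀.comp measurable_snd) measurable_const
  have hi : Integrable fun z : ℝ × Space n => (if z.1 ≤ 0 then u₀ z.2 else 0) * timeDeriv ψ z :=
    hD.bdd_mul (c := K) hm.aestronglyMeasurable (Eventually.of_forall fun z => by
      split_ifs
      · rw [Real.norm_of_nonneg (hK _).1]
        exact (hK _).2
      · simpa using hK0)
  refine ⟨hi, ?_⟩
  rw [Measure.volume_eq_prod, integral_prod_symm _ hi]
  congr 1
  ext1 x
  have e : ∀ t : ℝ, (if t ≤ 0 then u₀ x else 0) * timeDeriv ψ (t, x) =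
      (Iic (0 : ℝ)).indicator (fun t => u₀ x * timeDeriv ψ (t, x)) t := fun t => by
    by_cases ht : t ≤ 0
    · simp [ht]
    · simp [ht]
  simp_rw [e]
  rw [integral_indicator measurableSet_Iic, integral_const_mul]
  congr 1
  have hc1 : ContDiff ℝ 1 fun t => ψ (t, x) := hψ.comp (contDiff_id.prodMk contDiff_const)
  have hcs : HasCompactSupport fun t => ψ (t, x) := by
    obtain ⟨ρ, hρ⟩ := hψc.isCompact.isBounded.subset_closedBall (0 : ℝ × Space n)
    refine HasCompactSupport.intro (isCompact_closedBall (0 : ℝ) ρ) fun t ht => ?_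
    refine image_eq_zero_of_notMem_tsupport fun hm => ht ?_
    have := hρ hm
    rw [mem_closedBall_zero_iff] at this ⊢
    exact (_root_.norm_fst_le (t, x)).trans this
  have := hcs.integral_Iic_deriv_eq hc1 0
  rw [← this]
  refine setIntegral_congr_fun measurableSet_Iic fun t _ => ?_
  exact (hasDerivAt_time (hψ.differentiable one_ne_zero) t x).deriv.symm

/-- In a frame moving along the path generated by the spatially constant part of the drift, the
solution is a flow. -/
theorem IsDriftedFlow.isFlow (h : IsDriftedFlow m S M L Λ K T u₀ u V b c) :
    IsFlow m S M (L * (1 + ∫ s, ‖c s‖)) Λ K T (movedDensity u₀ u (path c))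
      (fun z => V (moveBack (path c) z)) fun z => b (moveBack (path c) z) := by
  have hYc := continuous_path h.integrable_c
  set Y := path c with hY
  have hYD : ∀ t, ‖Y t‖ ≤ ∫ s, ‖c s‖ := norm_path_le h.integrable_c
  have hL := h.nonneg_bound
  have hτ := measurePreserving_moveBack hYc
  have hτe := measurableEmbedding_moveBack hYc
  set D := ∫ s, ‖c s‖ with hD
  have hD0 : 0 ≤ D := (norm_nonneg _).trans (hYD 0)
  have hu0 : ∀ z : ℝ × Space n, z.1 ∉ Ioo 0 T → u (moveBack Y z) = 0 := fun z hz =>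
    h.eq_zero (moveBack Y z) hz
  have hnot : ∀ z : ℝ × Space n, z.1 ≤ 0 → z.1 ∉ Ioo 0 T := fun z hz h1 => by linarith [h1.1]
  refine ⟨?_, h.measurable_V.comp hτ.measurable, h.measurable_b.comp hτ.measurable, fun z => ?_,
    fun z hz => ?_, fun z hz => h.V_eq_zero (moveBack Y z) hz,
    fun z hz => h.b_eq_zero (moveBack Y z) hz, fun z => ?_, ?_, fun R => ?_, fun ψ hψ hψc hψT => ?_⟩
  · exact (h.measurable.comp hτ.measurable).add
      (Measurable.ite (measurableSet_le measurable_fst measurable_const)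
        (h.measurable_initial.comp measurable_snd) measurable_const)
  · rw [movedDensity]
    split_ifs with hz
    · rw [hu0 z (hnot z hz), zero_add]
      exact ⟨(h.initial _).1, (h.initial _).2.trans h.le_bound⟩
    · rw [add_zero]
      exact h.mem_Icc _
  · rw [movedDensity, if_pos hz, hu0 z (hnot z hz), zero_add]
    exact (h.initial _).2
  · refine (h.growth _).trans ?_
    have h1 : ‖(moveBack Y z).2‖ ≤ ‖z.2‖ + D := (norm_sub_le _ _).trans (by gcongr; exact hYD _)
    rw [mul_assoc]
    refine mul_le_mul_of_nonneg_left ?_ hL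
    nlinarith [norm_nonneg z.2]
  · filter_upwards [h.slice] with t ht htT
    have h1 := (ht htT).translate hL (hYD t)
    have e : (fun x => movedDensity u₀ u Y (t, x)) = fun x => u (t, x - Y t) := by
      ext x
      rw [movedDensity, if_neg (not_le.2 htT.1), add_zero]
      rfl
    rw [e]
    exact h1
  · have hms : ∀ R : ℝ, MeasurableSet ((univ : Set ℝ) ×ˢ ball (0 : Space n) R) := fun R =>
      MeasurableSet.univ.prod measurableSet_ball
    have h1 := ((memLp_indicator_iff_restrict (hms (R + D))).2
      (h.V_sq (R + D))).comp_measurePreserving hτ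
    refine (h1.restrict (univ ×ˢ ball 0 R)).ae_eq ?_
    filter_upwards [ae_restrict_mem (hms R)] with z hz
    rw [Function.comp_apply, indicator_of_mem]
    refine ⟨mem_univ _, ?_⟩
    have hz2 := hz.2
    rw [mem_ball_zero_iff] at hz2 ⊢
    exact (norm_sub_le _ _).trans_lt (by linarith [hYD z.1])
  · have hψ1 : ContDiff ℝ 1 ψ := hψ.of_le (by simp)
    have hψd : Differentiable ℝ ψ := hψ1.differentiable one_ne_zero
    obtain ⟨i1, i2, key⟩ := h.eqn_path hψ hψc hψT
    simp only [← hY] at i1 i2 key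
    obtain ⟨i3, h3⟩ := integral_initial hψ1 hψc h.measurable_initial h.initial
    have hinv : ∀ z : ℝ × Space n, ((moveBack Y z).1, (moveBack Y z).2 + Y (moveBack Y z).1) = z :=
      fun z => by simp [moveBack]
    have j1 : Integrable fun z => u (moveBack Y z) * timeDeriv ψ z := by
      have := hτ.integrable_comp_of_integrable i1
      refine this.congr (Eventually.of_forall fun z => ?_)
      simp only [Function.comp_apply, hinv]
    have e1 : ∫ z, u (moveBack Y z) * timeDeriv ψ z =
        ∫ z : ℝ × Space n, u z * timeDeriv ψ (z.1, z.2 + Y z.1) := by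
      rw [← hτ.integral_comp hτe fun z : ℝ × Space n => u z * timeDeriv ψ (z.1, z.2 + Y z.1)]
      simp only [hinv]
    have e2 : ∫ z, inner ℝ (V (moveBack Y z) + u (moveBack Y z) • b (moveBack Y z))
        (spaceGradient ψ z) = ∫ z : ℝ × Space n, inner ℝ (V z + u z • b z)
          (spaceGradient ψ (z.1, z.2 + Y z.1)) := by
      rw [← hτ.integral_comp hτe fun z : ℝ × Space n => inner ℝ (V z + u z • b z)
        (spaceGradient ψ (z.1, z.2 + Y z.1))]
      simp only [hinv]
    have e3 : ∫ z, movedDensity u₀ u Y z * deriv (fun s => ψ (s, z.2)) z.1 =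
        (∫ z, u (moveBack Y z) * timeDeriv ψ z) + ∫ x, u₀ x * ψ (0, x) := by
      rw [← h3, ← integral_add j1 i3]
      congr 1
      ext1 z
      rw [(hasDerivAt_time hψd z.1 z.2).deriv, movedDensity, add_mul]
    -- The extension to nonpositive times carries no flux, because `b` vanishes there.
    have e4 : ∫ z, inner ℝ (V (moveBack Y z) + movedDensity u₀ u Y z • b (moveBack Y z))
        (gradient (fun y => ψ (z.1, y)) z.2) =
        ∫ z, inner ℝ (V (moveBack Y z) + u (moveBack Y z) • b (moveBack Y z))
          (spaceGradient ψ z) := by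
      congr 1
      ext1 z
      rw [gradient_slice hψd z, movedDensity]
      split_ifs with hz
      · rw [h.b_eq_zero (moveBack Y z) (hnot z hz), smul_zero, smul_zero]
      · rw [add_zero]
    rw [e3, e4, e1, e2]
    rw [integral_sub i1 i2] at key
    linarith

/-! ### Measurable representatives of a weak solution. -/

variable {n : ℕ}

variable {m A B lam S M K T L₁ Λ₀ : ℝ} {ρ₀ : Space n → ℝ} {ρ : ℝ → Space n → ℝ}
  {W W₁ : Space n → Space n}

theorem restrict_slab (s : Set ℝ) (t : Set (Space n)) :
    (volume : Measure (ℝ × Space n)).restrict (s ×ˢ t) =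
      (volume.restrict s).prod (volume.restrict t) := by
  rw [Measure.volume_eq_prod, Measure.prod_restrict]

theorem restrict_slab_univ (s : Set ℝ) :
    (volume : Measure (ℝ × Space n)).restrict (s ×ˢ univ) = (volume.restrict s).prod volume := by
  rw [restrict_slab, Measure.restrict_univ]

/-- Truncation of a function to the values in `[0, S]`. -/
noncomputable def clip (S a : ℝ) : ℝ := max 0 (min S a)

theorem clip_mem (hS : 0 ≤ S) (a : ℝ) : clip S a ∈ Icc 0 S :=
  ⟨le_max_left _ _, max_le hS (min_le_left _ _)⟩

theorem clip_of_mem {a : ℝ} (ha : 0 ≤ a) (haS : a ≤ S) : clip S a = a := by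
  rw [clip, min_eq_right haS, max_eq_right ha]

theorem measurable_clip : Measurable (clip S) :=
  measurable_const.max (measurable_const.min measurable_id)

/-- A bounded measurable representative of the solution on a time interval. -/
theorem IsGlobalWeakSolution.exists_density (h : IsGlobalWeakSolution n m A B lam ρ₀ ρ)
    (hS0 : 0 ≤ S) (hS : ∀ᵐ t ∂(volume.restrict (Ioo 0 T)), ∀ᵐ x, ρ t x ≤ S) :
    ∃ u : ℝ × Space n → ℝ, Measurable u ∧ (∀ z, u z ∈ Icc 0 S) ∧
      (∀ z : ℝ × Space n, z.1 ∉ Ioo 0 T → u z = 0) ∧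
      ∀ᵐ t ∂(volume.restrict (Ioo 0 T)), (fun x => u (t, x)) =ᵐ[volume] ρ t := by
  have hmeas : AEStronglyMeasurable (fun z : ℝ × Space n => ρ z.1 z.2)
      ((volume.restrict (Ioo 0 T)).prod volume) := by
    rw [← restrict_slab_univ]
    exact h.measurable.mono_measure
      (Measure.restrict_mono (prod_mono_left Ioo_subset_Ioi_self) le_rfl)
  refine ⟨(Ioo 0 T ×ˢ univ).indicator fun z => clip S (hmeas.mk _ z), ?_, fun z => ?_,
    fun z hz => ?_, ?_⟩
  · exact (measurable_clip.comp hmeas.stronglyMeasurable_mk.measurable).indicator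
      (measurableSet_Ioo.prod MeasurableSet.univ)
  · by_cases hz : z ∈ Ioo 0 T ×ˢ (univ : Set (Space n))
    · rw [indicator_of_mem hz]
      exact clip_mem hS0 _
    · rw [indicator_of_notMem hz]
      exact ⟨le_rfl, hS0⟩
  · exact indicator_of_notMem (fun h' => hz h'.1) _
  · have h1 := Measure.ae_ae_of_ae_prod hmeas.ae_eq_mk
    have h2 : ∀ᵐ t ∂(volume.restrict (Ioo 0 T)), ∀ᵐ x, 0 ≤ ρ t x :=
      ae_mono (Measure.restrict_mono Ioo_subset_Ioi_self le_rfl) h.nonneg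
    filter_upwards [h1, h2, hS, ae_restrict_mem measurableSet_Ioo] with t h1 h2 h3 htT
    filter_upwards [h1, h2, h3] with x h1 h2 h3
    rw [indicator_of_mem (by exact ⟨htT, mem_univ _⟩), ← h1]
    exact clip_of_mem h2 h3

/-- A measurable representative of the gradient of `ρ ^ m` on a time interval. -/
theorem exists_gradient {G : ℝ → Space n → Space n} (hT : 0 < T)
    (hG : ∀ T R : ℝ, 0 < T → 0 < R → MemLp (fun z : ℝ × Space n => G z.1 z.2) 2
      (volume.restrict (Ioo (0 : ℝ) T ×ˢ ball (0 : Space n) R))) :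
    ∃ V : ℝ × Space n → Space n, Measurable V ∧
      (∀ z : ℝ × Space n, z.1 ∉ Ioo 0 T → V z = 0) ∧
      (∀ R : ℝ, MemLp V 2 (volume.restrict (univ ×ˢ ball 0 R))) ∧
      ∀ᵐ t ∂(volume.restrict (Ioo 0 T)), (fun x => V (t, x)) =ᵐ[volume] G t := by
  -- Measurability of `G` is known only on bounded cylinders; a countable union of them covers the
  -- slab.
  have hU : Ioo 0 T ×ˢ (univ : Set (Space n)) =
      ⋃ R : ℕ, Ioo 0 T ×ˢ ball (0 : Space n) ((R : ℝ) + 1) := by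
    rw [← prod_iUnion]
    congr 1
    refine (eq_univ_of_forall fun x => mem_iUnion.2 ?_).symm
    obtain ⟨R, hR⟩ := exists_nat_gt ‖x‖
    exact ⟨R, by rw [mem_ball_zero_iff]; linarith⟩
  have hmeas : AEStronglyMeasurable (fun z : ℝ × Space n => G z.1 z.2)
      (volume.restrict (Ioo 0 T ×ˢ univ)) := by
    rw [hU, aestronglyMeasurable_iUnion_iff]
    exact fun R => (hG T _ hT (by positivity)).1
  have hms : MeasurableSet (Ioo 0 T ×ˢ (univ : Set (Space n))) :=
    measurableSet_Ioo.prod MeasurableSet.univ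
  obtain ⟨g, hg, hgG⟩ := hmeas
  refine ⟨(Ioo 0 T ×ˢ univ).indicator g, ?_, fun z hz => ?_, fun R => ?_, ?_⟩
  · exact hg.measurable.indicator hms
  · exact indicator_of_notMem (fun h' => hz h'.1) _
  · rw [memLp_indicator_iff_restrict hms, Measure.restrict_restrict hms, prod_inter_prod,
      inter_univ, univ_inter]
    have h1 := (hG T (max R 1) hT (by positivity)).mono_measure
      (Measure.restrict_mono (prod_mono_right (ball_subset_ball (le_max_left R 1))) le_rfl)
    refine h1.ae_eq ?_
    exact ae_mono (Measure.restrict_mono (prod_mono_right (subset_univ _)) le_rfl) hgG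
  · rw [restrict_slab_univ] at hgG
    have h2 := Measure.ae_ae_of_ae_prod hgG
    filter_upwards [h2, ae_restrict_mem measurableSet_Ioo] with t h2 htT
    filter_upwards [h2] with x h2
    rw [indicator_of_mem (by exact ⟨htT, mem_univ _⟩)]
    exact h2.symm

theorem locallyIntegrable_of_growth {f : Space n → Space n} (hf : AEStronglyMeasurable f volume)
    {C : ℝ} (hC : 0 ≤ C) (hfC : ∀ x, ‖f x‖ ≤ C * (1 + ‖x‖)) : LocallyIntegrable f volume := by
  rw [locallyIntegrable_iff]
  intro k hk
  obtain ⟨R, hR⟩ := hk.isBounded.subset_closedBall (0 : Space n)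
  have hfin : IsFiniteMeasure (volume.restrict (closedBall (0 : Space n) R)) :=
    ⟨by rw [Measure.restrict_apply_univ]; exact measure_closedBall_lt_top⟩
  have h1 : IntegrableOn f (closedBall 0 R) := by
    refine Integrable.mono' (integrable_const (C * (1 + R))) hf.restrict ?_
    filter_upwards [ae_restrict_mem measurableSet_closedBall] with x hxR
    rw [mem_closedBall_zero_iff] at hxR
    exact (hfC x).trans (by gcongr)
  exact h1.mono_set hR

/-- Integer radii suffice, so a single null set of times serves all radii. -/
theorem memLp_slices {V : ℝ × Space n → Space n} (hV : Measurable V)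
    (h : ∀ R : ℝ, MemLp V 2 (volume.restrict (univ ×ˢ ball 0 R))) :
    ∀ᵐ t, ∀ R : ℝ, MemLp (fun x => V (t, x)) 2 (volume.restrict (ball 0 R)) := by
  have h1 : ∀ᵐ t, ∀ R : ℕ, MemLp (fun x => V (t, x)) 2 (volume.restrict (ball 0 (R : ℝ))) := by
    refine ae_all_iff.2 fun R => ?_
    have h2 := (memLp_two_iff_integrable_sq_norm (h R).1).1 (h R)
    rw [restrict_slab, Measure.restrict_univ] at h2
    filter_upwards [h2.prod_right_ae] with t ht
    exact (memLp_two_iff_integrable_sq_norm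
      (hV.comp (by fun_prop : Measurable fun x : Space n => (t, x))).aestronglyMeasurable).2 ht
  filter_upwards [h1] with t ht R
  obtain ⟨k, hk⟩ := exists_nat_ge R
  exact (ht k).mono_measure (Measure.restrict_mono (ball_subset_ball hk) le_rfl)

/-- The drift generated by a density depending on time. -/
noncomputable def timeDrift (W : Space n → Space n) (u : ℝ × Space n → ℝ) (z : ℝ × Space n) :
    Space n :=
  drift W (fun x => u (z.1, x)) z.2

theorem measurable_timeDrift {u : ℝ × Space n → ℝ} (hW : Measurable W) (hu : Measurable u) :
    Measurable (timeDrift W u) := by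
  have h : Measurable fun p : (ℝ × Space n) × Space n => u (p.1.1, p.2) • W (p.1.2 - p.2) :=
    (hu.comp (by fun_prop)).smul (hW.comp (by fun_prop))
  exact (h.stronglyMeasurable.integral_prod_right' (ν := volume)).measurable

/-- The spatially constant part of the drift. -/
noncomputable def meanDrift (W₁ : Space n → Space n) (u : ℝ × Space n → ℝ) (T t : ℝ) : Space n :=
  (Ioo 0 T).indicator (fun t => ∫ y, u (t, y) • W₁ (-y)) t

theorem meanDrift_eq_indicator {u : ℝ × Space n → ℝ} :
    (Ioo 0 T).indicator (meanDrift W₁ u T) = meanDrift W₁ u T := by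
  ext1 t
  by_cases ht : t ∈ Ioo 0 T
  · rw [indicator_of_mem ht]
  · rw [indicator_of_notMem ht, meanDrift, indicator_of_notMem ht]

theorem measurable_meanDrift {u : ℝ × Space n → ℝ} (hW : Measurable W₁) (hu : Measurable u) :
    Measurable (meanDrift W₁ u T) := by
  have h : Measurable fun p : ℝ × Space n => u p • W₁ (-p.2) :=
    hu.smul (hW.comp measurable_snd.neg)
  exact ((h.stronglyMeasurable.integral_prod_right' (ν := volume)).measurable).indicator
    measurableSet_Ioo

/-- The gradient of the potential and `W` may differ at the origin, a null set for the convolution.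
Hence `forceField` agrees with the drift of the representative at every point, and one point of
absolute convergence is inherited. -/
theorem IsGlobalWeakSolution.isDriftDensity (h : IsGlobalWeakSolution n m A B lam ρ₀ ρ)
    (hn : 2 ≤ n) (hT : 0 < T) (hWU : ∀ x, x ≠ 0 → potentialGradient n A B lam x = W x)
    (hM : ∫ x, ρ₀ x ≤ M) {u : ℝ × Space n → ℝ} (hu : Measurable u) (huS : ∀ z, u z ∈ Icc 0 S)
    (huρ : ∀ᵐ t ∂(volume.restrict (Ioo 0 T)), (fun x => u (t, x)) =ᵐ[volume] ρ t) :
    ∀ᵐ t ∂(volume.restrict (Ioo 0 T)), IsDriftDensity W S M (fun x => u (t, x)) ∧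
      ∀ x, forceField n A B lam (ρ t) x = timeDrift W u (t, x) := by
  have hmono : ∀ {p : ℝ → Prop}, (∀ᵐ t ∂(volume.restrict (Ioi (0 : ℝ))), p t) →
      ∀ᵐ t ∂(volume.restrict (Ioo 0 T)), p t := fun hp =>
    ae_mono (Measure.restrict_mono Ioo_subset_Ioi_self le_rfl) hp
  obtain ⟨C, hC⟩ := h.locally_bounded T hT
  have : Nonempty (Fin n) := ⟨⟨0, by omega⟩⟩
  filter_upwards [huρ, hC, hmono h.mass, hmono h.force_exists] with t h1 h2 h3 h4
  have hut : Measurable fun x => u (t, x) := hu.comp (by fun_prop)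
  have hne : ∀ x : Space n, ∀ᵐ y : Space n, x - y ≠ 0 := fun x => by
    have : ∀ᵐ y : Space n, y ≠ x := by simp [ae_iff]
    filter_upwards [this] with y hy h0
    exact hy (sub_eq_zero.1 h0).symm
  have hcongr : ∀ x, (fun y => ρ t y • potentialGradient n A B lam (x - y)) =ᵐ[volume]
      fun y => u (t, y) • W (x - y) := fun x => by
    filter_upwards [h1, hne x] with y hy hxy
    rw [hy, hWU _ hxy]
  refine ⟨⟨hut, fun x => huS _, ?_, ?_, ?_⟩, fun x => ?_⟩
  · rw [← memLp_one_iff_integrable]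
    refine ⟨hut.aestronglyMeasurable, ?_⟩
    rw [eLpNorm_congr_ae h1]
    exact h2.1.trans_lt ENNReal.coe_lt_top
  · rw [integral_congr_ae h1, h3]
    exact hM
  · obtain ⟨x, hx⟩ := h4.exists
    exact ⟨x, Integrable.congr hx (hcongr x)⟩
  · exact integral_congr_ae (hcongr x)

/-! ### Reduction of a weak solution to a drifted flow. -/

variable {n : ℕ}

variable {m A B lam S M K T L₁ Λ₀ : ℝ} {ρ₀ : Space n → ℝ} {ρ : ℝ → Space n → ℝ}
  {W W₁ : Space n → Space n}

/-- The spatially constant part of the drift is integrable in time. -/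
theorem IsGlobalWeakSolution.integrable_meanDrift (h : IsGlobalWeakSolution n m A B lam ρ₀ ρ)
    (hT : 0 < T) (hW : IsDriftKernel W W₁ L₁ Λ₀)
    {u : ℝ × Space n → ℝ} (hu : Measurable u) {L : ℝ} (hL : 0 ≤ L)
    (hgrowth : ∀ᵐ t ∂(volume.restrict (Ioo 0 T)), ∀ x,
      ‖timeDrift W u (t, x) - meanDrift W₁ u T t‖ ≤ L * (1 + ‖x‖))
    (hforce : ∀ᵐ t ∂(volume.restrict (Ioo 0 T)), ∀ x,
      forceField n A B lam (ρ t) x = timeDrift W u (t, x)) :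
    Integrable (meanDrift W₁ u T) := by
  have hms := measurable_meanDrift (T := T) hW.measurable_regular hu
  have hF := h.force_integrable T 1 hT one_pos
  rw [IntegrableOn, restrict_slab] at hF
  have hFi := hF.integral_norm_prod_left
  have hFs := hF.prod_right_ae
  set β := volume.real (ball (0 : Space n) 1) with hβ
  have hβ0 : 0 < β := ENNReal.toReal_pos (measure_ball_pos _ _ one_pos).ne' measure_ball_lt_top.ne
  have e : meanDrift W₁ u T = (Ioo 0 T).indicator (meanDrift W₁ u T) := by
    rw [meanDrift_eq_indicator]
  rw [e, integrable_indicator_iff measurableSet_Ioo]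
  have hfinT : IsFiniteMeasure (volume.restrict (Ioo (0 : ℝ) T)) := inferInstance
  refine ((hFi.div_const β).add (integrable_const (L * 2))).mono' hms.aestronglyMeasurable ?_
  have hfin : IsFiniteMeasure (volume.restrict (ball (0 : Space n) 1)) :=
    ⟨by rw [Measure.restrict_apply_univ]; exact measure_ball_lt_top⟩
  filter_upwards [hgrowth, hforce, hFs] with t h1 h2 h3
  -- The mean drift does not depend on `x`, so averaging over the unit ball bounds it by the average
  -- of the force plus a constant. Local integrability of the force in space-time then yields
  -- integrability in time.
  have h4 : ∫ x in ball (0 : Space n) 1, ‖meanDrift W₁ u T t‖ ≤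
      ∫ x in ball (0 : Space n) 1, (‖forceField n A B lam (ρ t) x‖ + L * 2) := by
    refine integral_mono_ae (integrable_const _) (h3.norm.add (integrable_const _)) ?_
    filter_upwards [ae_restrict_mem measurableSet_ball] with x hx
    have h5 := h1 x
    rw [← h2 x] at h5
    have h6 := norm_sub_norm_le (meanDrift W₁ u T t) (forceField n A B lam (ρ t) x)
    rw [norm_sub_rev] at h6
    rw [mem_ball_zero_iff] at hx
    have h7 : L * (1 + ‖x‖) ≤ L * 2 := mul_le_mul_of_nonneg_left (by linarith) hL
    linarith
  rw [integral_add h3.norm (integrable_const _), setIntegral_const, setIntegral_const, smul_eq_mul,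
    smul_eq_mul, ← hβ] at h4
  simp only [Pi.add_apply]
  rw [← sub_le_iff_le_add, le_div_iff₀ hβ0]
  linarith

/-- The integrand of the weak formulation is integrable in space-time. -/
theorem integrable_weak_integrand {u : ℝ × Space n → ℝ} {V b : ℝ × Space n → Space n}
    {c : ℝ → Space n} (hu : Measurable u) (huS : ∀ z, u z ∈ Icc 0 S)
    (hu0 : ∀ z : ℝ × Space n, z.1 ∉ Ioo 0 T → u z = 0)
    (hVm : Measurable V) (hV0 : ∀ z : ℝ × Space n, z.1 ∉ Ioo 0 T → V z = 0)
    (hV : ∀ R : ℝ, MemLp V 2 (volume.restrict (univ ×ˢ ball 0 R)))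
    (hb : Measurable b) {L : ℝ} (hL : 0 ≤ L) (hbL : ∀ z, ‖b z‖ ≤ L * (1 + ‖z.2‖))
    (hc : Integrable c) {φ : ℝ × Space n → ℝ} (hφ : ContDiff ℝ 1 φ) (hφc : HasCompactSupport φ) :
    Integrable fun z => u z * timeDeriv φ z -
      inner ℝ (V z + u z • (b z + c z.1)) (spaceGradient φ z) := by
  have hS : 0 ≤ S := (huS 0).1.trans (huS 0).2
  have hDc := continuous_timeDeriv hφ
  have hGc := continuous_spaceGradient hφ
  have hDs : HasCompactSupport (timeDeriv φ) :=
    HasCompactSupport.intro hφc.isCompact fun z hz => timeDeriv_eq_zero hz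
  obtain ⟨C2, hC2⟩ := hGc.bounded_above_of_compact_support
    (HasCompactSupport.intro hφc.isCompact fun z hz => spaceGradient_eq_zero hz)
  have hC20 : 0 ≤ C2 := (norm_nonneg _).trans (hC2 0)
  obtain ⟨ρ, hρ⟩ := hφc.isCompact.isBounded.subset_closedBall (0 : ℝ × Space n)
  set R := ρ + 1 with hR
  set k : Set (ℝ × Space n) := Ioo 0 T ×ˢ ball 0 R with hk
  have hkm : MeasurableSet k := measurableSet_Ioo.prod measurableSet_ball
  have hkfin : IsFiniteMeasure (volume.restrict k) :=
    ⟨by rw [Measure.restrict_apply_univ]; exact lt_top_iff_ne_top.2 (volume_slab_ne_top _ _ _)⟩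
  have hVk : IntegrableOn V k :=
    ((hV R).mono_measure (Measure.restrict_mono (prod_mono_left (subset_univ _))
      le_rfl)).integrable (by norm_num)
  have i1 : Integrable fun z => u z * timeDeriv φ z :=
    (hDc.integrable_of_hasCompactSupport hDs).bdd_mul (c := S) hu.aestronglyMeasurable
      (Eventually.of_forall fun z => by
        rw [Real.norm_of_nonneg (huS z).1]
        exact (huS z).2)
  have hck : IntegrableOn (fun z : ℝ × Space n => c z.1) k := by
    rw [IntegrableOn, hk, restrict_slab]
    have : IsFiniteMeasure (volume.restrict (ball (0 : Space n) R)) :=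
      ⟨by rw [Measure.restrict_apply_univ]; exact measure_ball_lt_top⟩
    exact hc.integrableOn.comp_fst _
  have i2 : Integrable (k.indicator fun z : ℝ × Space n =>
      (‖V z‖ + S * (L * (1 + R) + ‖c z.1‖)) * C2) :=
    (integrable_indicator_iff hkm).2 ((hVk.norm.add
      (((integrable_const _).add hck.norm).const_mul S)).mul_const _)
  refine i1.sub (i2.mono' ?_ (Eventually.of_forall fun z => ?_))
  · exact (hVm.aestronglyMeasurable.add (hu.aestronglyMeasurable.smul
      (hb.aestronglyMeasurable.add hc.1.comp_fst))).inner hGc.aestronglyMeasurable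
  · by_cases hz : z ∈ k
    · rw [indicator_of_mem hz]
      have hz2 : ‖z.2‖ < R := by simpa using hz.2
      have hR0 : 0 ≤ R := (norm_nonneg _).trans hz2.le
      refine (norm_inner_le_norm _ _).trans (mul_le_mul ?_ (hC2 _) (norm_nonneg _) (by positivity))
      refine (norm_add_le _ _).trans (add_le_add le_rfl ?_)
      rw [norm_smul, Real.norm_of_nonneg (huS z).1]
      refine mul_le_mul (huS z).2 ?_ (norm_nonneg _) hS
      exact (norm_add_le _ _).trans (add_le_add ((hbL z).trans (by gcongr)) le_rfl)
    · rw [indicator_of_notMem hz, norm_le_zero_iff]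
      by_cases h1 : z.1 ∈ Ioo 0 T
      · rw [spaceGradient_eq_zero, inner_zero_right]
        intro hm
        have h2 := hρ hm
        rw [mem_closedBall_zero_iff] at h2
        refine hz ⟨h1, ?_⟩
        rw [mem_ball_zero_iff]
        linarith [_root_.norm_snd_le z]
      · rw [hV0 z h1, hu0 z h1, zero_smul, add_zero, inner_zero_left]

/-- The data of a global weak solution on a finite time interval. -/
theorem IsGlobalWeakSolution.exists_isDriftedFlow (h : IsGlobalWeakSolution n m A B lam ρ₀ ρ)
    (hn : 2 ≤ n) (hT : 0 < T) (hWU : ∀ x, x ≠ 0 → potentialGradient n A B lam x = W x)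
    (hW : IsDriftKernel W W₁ L₁ Λ₀) (hΛ₀ : 0 ≤ Λ₀) (hM0 : 0 ≤ M) (hM : ∫ x, ρ₀ x ≤ M)
    (hK : 0 ≤ K) (hKS : K ≤ S) (hρ₀m : AEMeasurable ρ₀ volume) (hρ₀ : ∀ᵐ x, 0 ≤ ρ₀ x)
    (hρ₀K : ∀ᵐ x, ρ₀ x ≤ K)
    (hS : ∀ᵐ t ∂(volume.restrict (Ioo 0 T)), ∀ᵐ x, ρ t x ≤ S) :
    ∃ (L : ℝ) (u₀ : Space n → ℝ) (u : ℝ × Space n → ℝ) (V b : ℝ × Space n → Space n)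
      (c : ℝ → Space n), IsDriftedFlow m S M L (Λ₀ * M) K T u₀ u V b c ∧
        ∀ᵐ t ∂(volume.restrict (Ioo 0 T)), (fun x => u (t, x)) =ᵐ[volume] ρ t := by
  have hS0 : 0 ≤ S := hK.trans hKS
  have hL₁ := hW.lipschitz_nonneg hn
  obtain ⟨u, hum, huS, hu0, huρ⟩ := h.exists_density hS0 hS
  obtain ⟨G, hG, hGw, heq⟩ := h.equation
  obtain ⟨V, hVm, hV0, hV2, hVG⟩ := exists_gradient hT hG
  have hdens := h.isDriftDensity hn hT hWU hM hum huS huρ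
  set c := meanDrift W₁ u T with hc
  set I₂ := ∫ y, ‖W y - W₁ y‖ with hI₂
  have hI₂0 : 0 ≤ I₂ := integral_nonneg fun _ => norm_nonneg _
  set L := L₁ * M + S * I₂ with hLd
  have hL : 0 ≤ L := by positivity
  have hgrowth : ∀ᵐ t ∂(volume.restrict (Ioo 0 T)), ∀ x,
      ‖timeDrift W u (t, x) - c t‖ ≤ L * (1 + ‖x‖) := by
    filter_upwards [hdens, ae_restrict_mem measurableSet_Ioo] with t ht htT x
    have e : c t = ∫ y, u (t, y) • W₁ (-y) := indicator_of_mem htT _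
    rw [e]
    refine (ht.1.norm_drift_sub_le hn hW x).trans ?_
    have h1 : 0 ≤ L₁ * M := by positivity
    have h2 : 0 ≤ S * I₂ := by positivity
    rw [hLd]
    nlinarith [norm_nonneg x, mul_nonneg h2 (norm_nonneg x)]
  have hci : Integrable c := h.integrable_meanDrift hT hW hum hL hgrowth
    (hdens.mono fun t ht => ht.2)
  have hcm := measurable_meanDrift (T := T) hW.measurable_regular hum
  have hfm := measurable_timeDrift hW.measurable hum
  -- Setting the field to zero wherever the growth bound fails makes that bound hold everywhere, as
  -- a drifted flow requires; only a null set of times is affected.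
  set b : ℝ × Space n → Space n := fun z =>
    if z.1 ∈ Ioo 0 T ∧ ‖timeDrift W u z - c z.1‖ ≤ L * (1 + ‖z.2‖) then timeDrift W u z - c z.1
      else 0 with hb
  have hdiffm : Measurable fun z : ℝ × Space n => timeDrift W u z - c z.1 :=
    hfm.sub (hcm.comp measurable_fst)
  have hbm : Measurable b := Measurable.ite ((measurable_fst measurableSet_Ioo).inter
    (measurableSet_le hdiffm.norm ((measurable_snd.norm.const_add 1).const_mul L)))
    hdiffm measurable_const
  have hbL : ∀ z, ‖b z‖ ≤ L * (1 + ‖z.2‖) := fun z => by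
    simp only [hb]
    split_ifs with hz
    · exact hz.2
    · rw [norm_zero]
      positivity
  have hb0 : ∀ z : ℝ × Space n, z.1 ∉ Ioo 0 T → b z = 0 := fun z hz =>
    if_neg fun h' => hz h'.1
  have hbt : ∀ᵐ t ∂(volume.restrict (Ioo 0 T)), ∀ x, b (t, x) = timeDrift W u (t, x) - c t := by
    filter_upwards [hgrowth, ae_restrict_mem measurableSet_Ioo] with t ht htT x
    exact if_pos ⟨htT, ht x⟩
  have hGw' : ∀ᵐ t ∂(volume.restrict (Ioo 0 T)), HasWeakGradient (fun x => ρ t x ^ m) (G t) :=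
    ae_mono (Measure.restrict_mono Ioo_subset_Ioi_self le_rfl) hGw
  refine ⟨L, fun x => clip K (hρ₀m.mk ρ₀ x), u, V, b, c, ⟨hum, hVm, hbm, hci, huS,
    measurable_clip.comp hρ₀m.measurable_mk, fun x => clip_mem hK _, hKS, hu0, hV0, hb0, hbL, ?_,
    hV2, fun φ hφ hφc hφT => ?_⟩, huρ⟩
  · rw [← ae_restrict_iff' measurableSet_Ioo]
    filter_upwards [hdens, huρ, hVG, hGw', hbt, ae_restrict_of_ae (memLp_slices hVm hV2)]
      with t h1 h2 h3 h4 h5 h6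
    have hut : Measurable fun x => u (t, x) := hum.comp (by fun_prop)
    refine ⟨hut, fun x => huS _, h1.1.integrable, h1.1.mass, ?_, h6,
      (hbm.comp (by fun_prop : Measurable fun x : Space n => (t, x))).aestronglyMeasurable,
      Eventually.of_forall fun x => hbL (t, x), ?_⟩
    · refine h4.congr ?_ h3.symm
      filter_upwards [h2] with x hx
      rw [hx]
    · have hloc : LocallyIntegrable (drift W fun x => u (t, x)) volume := by
        have h7 : LocallyIntegrable (fun x => b (t, x)) volume := locallyIntegrable_of_growth
          (hbm.comp (by fun_prop : Measurable fun x : Space n => (t, x))).aestronglyMeasurable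
          hL fun x => hbL (t, x)
        have e : (drift W fun x => u (t, x)) = (fun x => b (t, x)) + fun _ => c t := by
          ext1 x
          simp only [Pi.add_apply]
          rw [h5 x, timeDrift, sub_add_cancel]
        rw [e]
        exact h7.add (locallyIntegrable_const _)
      have h8 := (h1.1.divLE hn hW hΛ₀).translate hloc 0 (c t)
      have e : (fun x => b (t, x)) = fun x => drift W (fun x => u (t, x)) (x - 0) - c t := by
        ext1 x
        rw [h5 x, sub_zero, timeDrift]
      rw [e]
      exact h8
  · have hφ1 : ContDiff ℝ 1 φ := hφ.of_le (by simp)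
    have hφd : Differentiable ℝ φ := hφ1.differentiable one_ne_zero
    have hI := integrable_weak_integrand hum huS hu0 hVm hV0 hV2 hbm hL hbL hci hφ1 hφc
    have e0 : ∀ z : ℝ × Space n, u z * deriv (fun s => φ (s, z.2)) z.1 -
        inner ℝ (V z + u z • (b z + c z.1)) (gradient (fun y => φ (z.1, y)) z.2) =
        u z * timeDeriv φ z - inner ℝ (V z + u z • (b z + c z.1)) (spaceGradient φ z) := fun z => by
      rw [gradient_slice hφd z, (hasDerivAt_time hφd z.1 z.2).deriv]
    simp_rw [e0]
    have hI0 : ∀ z : ℝ × Space n, z.1 ∉ Ioo 0 T → u z * timeDeriv φ z -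
        inner ℝ (V z + u z • (b z + c z.1)) (spaceGradient φ z) = 0 := fun z hz => by
      rw [hV0 z hz, hu0 z hz]
      simp
    rw [integral_eq_integral_slices hI hI0]
    have key := heq φ hφ hφc
    have einit : ∫ x, clip K (hρ₀m.mk ρ₀ x) * φ (0, x) = ∫ x, ρ₀ x * φ (0, x) := by
      refine integral_congr_ae ?_
      filter_upwards [hρ₀m.ae_eq_mk, hρ₀, hρ₀K] with x h1 h2 h3
      rw [← h1, clip_of_mem h2 h3]
    rw [einit]
    refine Eq.trans (congrArg (· + _) ?_) key
    have hzero : ∀ t, T < t → ∀ x, (ρ t x * deriv (fun s => φ (s, x)) t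
        - inner ℝ (G t x) (gradient (fun y => φ (t, y)) x)
        - ρ t x * inner ℝ (forceField n A B lam (ρ t) x) (gradient (fun y => φ (t, y)) x)) = 0 := by
      intro t ht x
      have h1 : (fun s => φ (s, x)) =ᶠ[𝓝 t] fun _ => 0 := by
        filter_upwards [lt_mem_nhds ht] with s hs using hφT (s, x) hs.le
      have h2 : (fun y => φ (t, y)) = fun _ => 0 := funext fun y => hφT (t, y) ht.le
      have h3 : gradient (fun _ : Space n => (0 : ℝ)) x = 0 := by simp [gradient]
      rw [h1.deriv_eq, h2, h3]
      simp
    have hz' : ∀ t ∈ Ioi 0 \ Ioc 0 T, ∫ x, (ρ t x * deriv (fun s => φ (s, x)) t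
        - inner ℝ (G t x) (gradient (fun y => φ (t, y)) x)
        - ρ t x * inner ℝ (forceField n A B lam (ρ t) x) (gradient (fun y => φ (t, y)) x)) = 0 := by
      intro t ht
      have h1 : T < t := by
        by_contra h'
        exact ht.2 ⟨ht.1, not_lt.1 h'⟩
      exact integral_eq_zero_of_ae (Eventually.of_forall (hzero t h1))
    refine Eq.trans ?_ (setIntegral_eq_of_subset_of_forall_sdiff_eq_zero measurableSet_Ioi
      Ioc_subset_Ioi_self hz').symm
    rw [integral_Ioc_eq_integral_Ioo]
    refine integral_congr_ae ?_
    filter_upwards [hdens, huρ, hVG, hbt] with t h1 h2 h3 h4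
    refine integral_congr_ae ?_
    filter_upwards [h2, h3] with x h2 h3
    rw [h1.2 x, ← h2, ← h3, gradient_slice hφd (t, x), (hasDerivAt_time hφd t x).deriv, h4 x,
      sub_add_cancel, inner_add_left, inner_smul_left]
    simp only [conj_trivial]
    ring

/-! ### The uniform bound. -/

variable {n : ℕ}

variable {m A B lam : ℝ}

theorem exists_isDriftKernel (hn : 2 ≤ n) (hB : 2 - (n : ℝ) < B) (hBA : B < A) (hA : A ≤ 2)
    (hlam : 0 < lam) : ∃ L₁ Λ₀ : ℝ, 0 ≤ Λ₀ ∧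
      IsDriftKernel (interactionField n A B lam) (regularField n A B lam) L₁ Λ₀ := by
  obtain ⟨Λ₀, hΛ₀, hdiv⟩ := exists_divLE_interactionField hn hB hBA hA hlam
  exact ⟨_, Λ₀, hΛ₀, measurable_interactionField, measurable_regularField,
    norm_regularField_sub_le hA (hBA.le.trans hA) hlam.le,
    integrable_interactionField_sub hn (hB.trans hBA) hB, hdiv⟩

theorem ae_le_of_eLpNorm_top_le {f : Space n → ℝ} {K : ℝ≥0} (h : eLpNorm f ⊤ volume ≤ K) :
    ∀ᵐ x, f x ≤ K := by
  rw [eLpNorm_exponent_top] at h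
  filter_upwards [ae_le_eLpNormEssSup (f := f) (μ := volume)] with x hx
  have h1 : ‖f x‖₊ ≤ K := by
    have := hx.trans h
    rwa [enorm_eq_nnnorm, ENNReal.coe_le_coe] at this
  exact (le_abs_self _).trans (by exact_mod_cast h1)

/-- Above a threshold depending only on the data, the upper bound of a solution on a finite time
interval can be halved. -/
theorem exists_solution_halving_threshold (hn : 2 ≤ n) (hm : 1 - 2 / (n : ℝ) < m)
    (hB : 2 - (n : ℝ) < B) (hBA : B < A) (hA : A ≤ 2) (hlam : 0 < lam) (M K : ℝ≥0) :
    ∃ S₀ : ℝ, 0 < S₀ ∧ ∀ ρ₀ : Space n → ℝ, (∀ᵐ x, 0 ≤ ρ₀ x) → MemLp ρ₀ 1 volume →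
      eLpNorm ρ₀ 1 volume ≤ M → eLpNorm ρ₀ ⊤ volume ≤ K →
      ∀ ρ : ℝ → Space n → ℝ, IsGlobalWeakSolution n m A B lam ρ₀ ρ → ∀ T, 0 < T → ∀ S, S₀ ≤ S →
        (∀ᵐ t ∂(volume.restrict (Ioo 0 T)), ∀ᵐ x, ρ t x ≤ S) →
          ∀ᵐ t ∂(volume.restrict (Ioo 0 T)), ∀ᵐ x, ρ t x ≤ S / 2 := by
  obtain ⟨L₁, Λ₀, hΛ₀, hW⟩ := exists_isDriftKernel hn hB hBA hA hlam
  have hM0 : (0 : ℝ) ≤ M := M.2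
  have hK0 : (0 : ℝ) ≤ K := K.2
  obtain ⟨S₀, hS₀, hhalf⟩ := exists_halving_threshold (Λ := Λ₀ * M) hn hm hM0 (by positivity)
  -- The term `4 K` places the initial datum below the first level `S / 4` of the iteration.
  refine ⟨max S₀ (4 * K), by positivity, fun ρ₀ h0 h1 hM hK ρ hρ T hT S hS hle => ?_⟩
  have h4 : 4 * (K : ℝ) ≤ S := (le_max_right _ _).trans hS
  have hmass : ∫ x, ρ₀ x ≤ M := by
    have e := integral_norm_eq_lintegral_enorm h1.1
    rw [eLpNorm_one_eq_lintegral_enorm] at hM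
    refine (Real.le_norm_self _).trans ((norm_integral_le_integral_norm _).trans ?_)
    rw [e]
    exact ENNReal.toReal_le_of_le_ofReal hM0 (by rwa [ENNReal.ofReal_coe_nnreal])
  obtain ⟨L, u₀, u, V, b, c, hflow, hu⟩ := hρ.exists_isDriftedFlow hn hT
    (fun x hx => potentialGradient_eq hx) hW hΛ₀ hM0 hmass hK0 (by linarith)
    h1.1.aemeasurable h0 (ae_le_of_eLpNorm_top_le hK) hle
  have hLc : 0 ≤ L * (1 + ∫ s, ‖c s‖) := mul_nonneg hflow.nonneg_bound
    (add_nonneg zero_le_one (integral_nonneg fun _ => norm_nonneg _))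
  have key := hhalf S ((le_max_left _ _).trans hS) K _ T h4 hLc _ _ _ hflow.isFlow
  filter_upwards [hu, (ae_restrict_iff' measurableSet_Ioo).2 key,
    ae_restrict_mem measurableSet_Ioo] with t h2 h3 htT
  -- Return from the moving frame: a translation at each fixed time preserves almost everywhere
  -- bounds.
  have h5 : ∀ᵐ x : Space n, u (t, x) ≤ S / 2 := by
    have h6 := (measurePreserving_add_right (volume : Measure (Space n))
      (path c t)).quasiMeasurePreserving.ae h3
    filter_upwards [h6] with x hx
    rw [movedDensity, if_neg (not_le.2 htT.1), add_zero] at hx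
    simpa [moveBack] using hx
  filter_upwards [h2, h5] with x h2 h5
  rwa [← h2]

/-- Global weak solutions are bounded uniformly in time. -/
theorem exists_uniform_bound (hn : 2 ≤ n) (hm : 1 - 2 / (n : ℝ) < m)
    (hB : 2 - (n : ℝ) < B) (hBA : B < A) (hA : A ≤ 2) (hlam : 0 < lam) (M K : ℝ≥0) :
    ∃ C : ℝ≥0, ∀ ρ₀ : Space n → ℝ,
      (∀ᵐ x, 0 ≤ ρ₀ x) → MemLp ρ₀ 1 volume →
      eLpNorm ρ₀ 1 volume ≤ M → eLpNorm ρ₀ ⊤ volume ≤ K →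
      ∀ ρ : ℝ → Space n → ℝ, IsGlobalWeakSolution n m A B lam ρ₀ ρ →
        essSup (fun t => eLpNorm (ρ t) ⊤ volume) (volume.restrict (Ioi (0 : ℝ))) ≤ C := by
  obtain ⟨S₀, hS₀, hhalf⟩ := exists_solution_halving_threshold hn hm hB hBA hA hlam M K
  refine ⟨S₀.toNNReal, fun ρ₀ h0 h1 hM hK ρ hρ => essSup_le_of_ae_le _ ?_⟩
  have hT : ∀ T, 0 < T → ∀ᵐ t ∂(volume.restrict (Ioo 0 T)), ∀ᵐ x, ρ t x ≤ S₀ := fun T hT => by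
    obtain ⟨C, hC⟩ := hρ.locally_bounded T hT
    -- The number of halvings depends on the solution and on `T` through `C`, but the terminal bound
    -- `S₀` does not.
    obtain ⟨N, hN⟩ := pow_unbounded_of_one_lt (C / S₀) one_lt_two
    have hdown : ∀ j ≤ N, ∀ᵐ t ∂(volume.restrict (Ioo 0 T)), ∀ᵐ x, ρ t x ≤ S₀ * 2 ^ (N - j) := by
      intro j
      induction j with
      | zero =>
        intro _
        filter_upwards [hC] with t ht
        filter_upwards [ae_le_of_eLpNorm_top_le ht.2] with x hx
        rw [div_lt_iff₀ hS₀] at hN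
        rw [Nat.sub_zero]
        linarith
      | succ j ih =>
        intro hj
        have h2 := hhalf ρ₀ h0 h1 hM hK ρ hρ T hT (S₀ * 2 ^ (N - j))
          (le_mul_of_one_le_right hS₀.le (one_le_pow₀ one_le_two)) (ih (by omega))
        have e : S₀ * 2 ^ (N - j) / 2 = S₀ * 2 ^ (N - (j + 1)) := by
          have : N - j = N - (j + 1) + 1 := by omega
          rw [this, pow_succ]
          ring
        rwa [e] at h2
    simpa using hdown N le_rfl
  have hall : ∀ᵐ t, ∀ N : ℕ, t ∈ Ioo (0 : ℝ) (N + 1) → ∀ᵐ x, ρ t x ≤ S₀ :=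
    ae_all_iff.2 fun N => (ae_restrict_iff' measurableSet_Ioo).1 (hT (N + 1) (by positivity))
  filter_upwards [ae_restrict_of_ae hall, hρ.nonneg, ae_restrict_mem measurableSet_Ioi]
    with t h2 h3 ht
  obtain ⟨N, hN⟩ := exists_nat_gt t
  rw [eLpNorm_exponent_top]
  refine eLpNormEssSup_le_of_ae_bound ?_
  filter_upwards [h2 N ⟨ht, by linarith⟩, h3] with x h4 h5
  rwa [Real.norm_of_nonneg h5]

end Main

end AggregationDiffusion

theorem theorem2p1 (n : ℕ) (hn : 2 ≤ n) (m A B lam : ℝ)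
    (hm : 1 - 2 / (n : ℝ) < m)
    (hB : 2 - (n : ℝ) < B) (hBA : B < A) (hA : A ≤ 2) (hlam : 0 < lam)
    (M K : ℝ≥0) :
    ∃ C : ℝ≥0, ∀ ρ₀ : AggregationDiffusion.Space n → ℝ,
      (∀ᵐ x, 0 ≤ ρ₀ x) → MemLp ρ₀ 1 volume → MemLp ρ₀ ∞ volume →
      eLpNorm ρ₀ 1 volume ≤ M → eLpNorm ρ₀ ∞ volume ≤ K →
      ∀ ρ : ℝ → AggregationDiffusion.Space n → ℝ,
        AggregationDiffusion.IsGlobalWeakSolution n m A B lam ρ₀ ρ →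
          essSup (fun t => eLpNorm (ρ t) ∞ volume) (volume.restrict (Ioi (0 : ℝ))) ≤ C := by
  obtain ⟨C, hC⟩ := AggregationDiffusion.exists_uniform_bound hn hm hB hBA hA hlam M K
  exact ⟨C, fun ρ₀ h0 h1 _ hM hK ρ hρ => hC ρ₀ h0 h1 hM hK ρ hρ⟩
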